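/- Let $(E,d)$ be a locally compact separable metric space and $\mu$ a positive $\sigma$-finite Borel measure on $E$ with full support; write $\langle f,g\rangle=\int_E fg\,d\mu$. Let $(\mathcal E,\mathcal F)$ be a regular lower bounded semi-Dirichlet form on $L^2(E,\mu)$: $\mathcal F$ is a dense subspace of $L^2(E,\mu)$, $\mathcal E$ is a (not necessarily symmetric) bilinear form on $\mathcal F$, and there is a constant $\beta_0\ge 0$ such that, with $\mathcal E_\beta(f,g)=\mathcal E(f,g)+\beta\langle f,g\rangle$, 1. $\mathcal E_{\beta_0}(f,f)\ge 0$ for $f\in\mathcal F$; 2. for some $C\ge1$, $|\mathcal E(f,g)|\le C\sqrt{\mathcal E_{\beta_0}(f,f)}\sqrt{\mathcal E_{\beta_0}(g,g)}$ for $f,g\in\mathcal F$; 3. for every $\beta>\beta_0$, $\mathcal F$ is a Hilbert space for the inner product $\frac12(\mathcal E_\beta(f,g)+\mathcal E_\beta(g,f))$; 4. $f^+\wedge1\in\mathcal F$ and $\mathcal E(f^+\wedge 1,f-f^+\wedge1)\ge0$ for $f\in\mathcal F$; 5. (regularity) with $C_0(E)$ the continuous functions of compact support, $\mathcal F\cap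 C_0(E)$ is uniformly dense in $C_0(E)$ and $\mathcal E_\beta$-dense in $\mathcal F$ for $\beta>\beta_0$. The terms quasi-everywhere (q.e., outside a set of capacity zero) and quasi-continuous refer to the capacity of the form: for open $G$ it is $\inf\{\mathcal E_{\beta_0+1}(f,f): f\in\mathcal F,\ f\ge1\ \mu\text{-a.e. on }G\}$, and for arbitrary $A$ it is the infimum over open $G\supseteq A$. For an open set $\Omega\subset E$ let $\mathcal F^\Omega$ be the set of $f\in\mathcal F$ having a quasi-continuous version that vanishes q.e. on $\Omega^c$. Let $\Omega\subset E$ be open, $\beta>\beta_0$, $\xi\in L^2(\Omega,\mu|_\Omega)$, write $\langle\xi,f\rangle=\int_\Omega \xi f\,d\mu$, and put $\mathcal M_{\Omega,\delta}=\{f\in\mathcal F^\Omega:\langle\xi,f\rangle=\delta\}$ for $\delta=0,1$. **Theorem.** There is a unique weak solution $u_\beta$ of $(\beta-\mathcal L)u=\xi$ in $\Omega$, $u=0$ q.e. on $\Omega^c$ ($\mathcal L$ being the generator of the form), that is, a unique $u_\beta\in\mathcal F^\Omega$ with $\mathcal E_\beta(u_\beta,f)=\langle\xi,f\rangle$ for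 all $f\in\mathcal F^\Omega$. If $X$ is any Hunt process on $E$ (with cemetery adjoined) generated by the form, i.e. such that for every $\alpha>\beta_0$ and every bounded Borel $f\in L^2(E,\mu)$ the function $R_\alpha f(x)=\mathbb E_x\int_0^\infty e^{-\alpha t}f(X_t)\,dt$ is a version of an element of $\mathcal F$ with $\mathcal E_\alpha(R_\alpha f,g)=\langle f,g\rangle$ for all $g\in\mathcal F$, then $u_\beta=R^\Omega_\beta\xi$ $\mu$-a.e., where $$R^\Omega_\beta\xi(x)=\mathbb E_x\int_0^{\tau_\Omega}e^{-\beta t}\xi(X_t)\,dt,\qquad \tau_\Omega=\inf\{t\ge0:X_t\notin\Omega\},$$ and these integrals exist for $\mu$-a.e. $x$. Moreover $$\frac1{\langle\xi,u_\beta\rangle}=\inf_{f\in\mathcal M_{\Omega,1}}\ \sup_{g\in\mathcal M_{\Omega,0}}\mathcal E_\beta(f+g,f-g),$$ and if $\mathcal E$ is symmetric, i.e. $\mathcal E(f,g)=\mathcal E(g,f)$ for all $f,g\in\mathcal F$, then $$\frac1{\langle\xi,u_\beta\rangle}=\inf_{f\in\mathcal M_{\Omega,1}}\mathcal E_\beta(f,f).$$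 Both identities are in $[-\infty,\infty]$, with the conventions $1/0=+\infty$ and $\inf\emptyset=+\infty$ (which matter only in the degenerate case $\langle\xi,u_\beta\rangle=0$). -/

import Mathlib

open MeasureTheory ProbabilityTheory Topology Filter Set
open scoped NNReal ENNReal

/-! ## Lower bounded semi-Dirichlet forms -/

/-- A lower bounded semi-Dirichlet form `(form, dom)` on `L²(E, μ)`, together with its constant
`β₀`.  Here `form f g + β * ⟪f, g⟫` is the shifted form `form_β`. -/
structure LowerBoundedSemiDirichletForm {E : Type*} [MeasurableSpace E] (μ : Measure E) where
  /-- the domain, a linear subspace of `L²(E, μ)` -/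
  dom : Submodule ℝ (Lp ℝ 2 μ)
  /-- the bilinear form, not assumed symmetric -/
  form : LinearMap.BilinForm ℝ dom
  /-- the lower bound constant -/
  β₀ : ℝ
  β₀_nonneg : 0 ≤ β₀
  dense_dom : Dense (dom : Set (Lp ℝ 2 μ))
  lower_bounded : ∀ f : dom, 0 ≤ form f f + β₀ * inner ℝ (f : Lp ℝ 2 μ) f
  /-- weak sector condition -/
  sector : ∃ C : ℝ, 1 ≤ C ∧ ∀ f g : dom,
    |form f g| ≤ C * √(form f f + β₀ * inner ℝ (f : Lp ℝ 2 μ) f)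
      * √(form g g + β₀ * inner ℝ (g : Lp ℝ 2 μ) g)
  /-- closedness: for `β > β₀`, `dom` is complete for the inner product
  `(form_β f g + form_β g f) / 2`, whose squared norm is `form_β f f` -/
  complete : ∀ β : ℝ, β₀ < β → ∀ u : ℕ → dom,
    (∀ ε : ℝ, 0 < ε → ∃ N, ∀ m ≥ N, ∀ n ≥ N,
      form (u m - u n) (u m - u n)
        + β * inner ℝ ((u m - u n : dom) : Lp ℝ 2 μ) (u m - u n : dom) < ε) →
    ∃ f : dom, Tendsto (fun n => form (u n - f) (u n - f)
        + β * inner ℝ ((u n - f : dom) : Lp ℝ 2 μ) (u n - f : dom)) atTop (𝓝 0)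
  /-- Markov property: `f⁺ ∧ 1 ∈ dom` and `form (f⁺ ∧ 1) (f - f⁺ ∧ 1) ≥ 0` -/
  markov : ∀ f : dom, ∃ g : dom,
    ((g : Lp ℝ 2 μ) : E → ℝ) =ᵐ[μ] (fun x => min (max ((f : Lp ℝ 2 μ) x) 0) 1) ∧
      0 ≤ form g (f - g)

namespace LowerBoundedSemiDirichletForm

variable {E : Type*} [MeasurableSpace E] {μ : Measure E}

/-- The shifted form `𝓔_β(f, g) = 𝓔(f, g) + β ⟨f, g⟩`. -/
noncomputable def shifted (𝓔 : LowerBoundedSemiDirichletForm μ) (β : ℝ) (f g : 𝓔.dom) : ℝ :=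
  𝓔.form f g + β * inner ℝ (f : Lp ℝ 2 μ) g

/-- Continuous compactly supported functions (defined everywhere) whose class lies in `dom`. -/
def core [TopologicalSpace E] (𝓔 : LowerBoundedSemiDirichletForm μ) : Set (E → ℝ) :=
  {φ | Continuous φ ∧ HasCompactSupport φ ∧ ∃ f : 𝓔.dom, ((f : Lp ℝ 2 μ) : E → ℝ) =ᵐ[μ] φ}

/-- Regularity: `core` is uniformly dense in the continuous compactly supported functions
and `𝓔_β`-dense in `dom` for `β > β₀`. -/
def IsRegular [TopologicalSpace E] (𝓔 : LowerBoundedSemiDirichletForm μ) : Prop :=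
  (∀ φ : E → ℝ, Continuous φ → HasCompactSupport φ → ∀ ε : ℝ, 0 < ε →
    ∃ ψ ∈ 𝓔.core, ∀ x, |φ x - ψ x| < ε) ∧
  (∀ β : ℝ, 𝓔.β₀ < β → ∀ f : 𝓔.dom, ∀ ε : ℝ, 0 < ε →
    ∃ φ ∈ 𝓔.core, ∃ g : 𝓔.dom, ((g : Lp ℝ 2 μ) : E → ℝ) =ᵐ[μ] φ ∧
      𝓔.shifted β (f - g) (f - g) < ε)

/-- Symmetry of the form. -/
def IsSymmetric (𝓔 : LowerBoundedSemiDirichletForm μ) : Prop :=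
  ∀ f g : 𝓔.dom, 𝓔.form f g = 𝓔.form g f

/-- The capacity of a set, at level `β₀ + 1`: the infimum of `𝓔_{β₀+1}(f, f)` over the `f ∈ dom`
with `f ≥ 1` a.e. on some open neighbourhood of the set.  Any other level above `β₀`, and any
other usual normalization of the capacity of a non-symmetric form, is comparable to this one up to
multiplicative constants (weak sector condition), so that it has the same null sets and the same
quasi-continuous functions. -/
noncomputable def cap [TopologicalSpace E] (𝓔 : LowerBoundedSemiDirichletForm μ)
    (A : Set E) : ℝ≥0∞ :=
  ⨅ (G : Set E) (_ : IsOpen G) (_ : A ⊆ G) (f : 𝓔.dom)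
    (_ : ∀ᵐ x ∂μ, x ∈ G → 1 ≤ (f : Lp ℝ 2 μ) x), ENNReal.ofReal (𝓔.shifted (𝓔.β₀ + 1) f f)

/-- Quasi-continuity: continuity on the complement of open sets of arbitrarily small capacity. -/
def QuasiContinuous [TopologicalSpace E] (𝓔 : LowerBoundedSemiDirichletForm μ)
    (f : E → ℝ) : Prop :=
  ∀ ε : ℝ≥0∞, 0 < ε → ∃ G : Set E, IsOpen G ∧ 𝓔.cap G < ε ∧ ContinuousOn f Gᶜ

/-- The domain `𝓕^Ω` of the part of the form on `Ω`: those `f ∈ dom` with a quasi-continuous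
version vanishing quasi-everywhere on `Ωᶜ`. -/
def partDom [TopologicalSpace E] (𝓔 : LowerBoundedSemiDirichletForm μ) (Ω : Set E) :
    Set 𝓔.dom :=
  {f | ∃ f' : E → ℝ, f' =ᵐ[μ] ((f : Lp ℝ 2 μ) : E → ℝ) ∧ 𝓔.QuasiContinuous f' ∧
    𝓔.cap {x | x ∈ Ωᶜ ∧ f' x ≠ 0} = 0}

/-- The pairing `⟨ξ, f⟩ = ∫_Ω ξ f dμ`. -/
noncomputable def pairing (𝓔 : LowerBoundedSemiDirichletForm μ) (Ω : Set E) (ξ : E → ℝ)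
    (f : 𝓔.dom) : ℝ :=
  ∫ x in Ω, ξ x * (f : Lp ℝ 2 μ) x ∂μ

/-- `u` is a weak solution of `(β - L) u = ξ` in `Ω`, `u = 0` q.e. on `Ωᶜ`. -/
def IsWeakSolution [TopologicalSpace E] (𝓔 : LowerBoundedSemiDirichletForm μ) (Ω : Set E)
    (β : ℝ) (ξ : E → ℝ) (u : 𝓔.dom) : Prop :=
  u ∈ 𝓔.partDom Ω ∧ ∀ f ∈ 𝓔.partDom Ω, 𝓔.shifted β u f = 𝓔.pairing Ω ξ f

/-- The set `{f ∈ 𝓕^Ω : ⟨ξ, f⟩ = δ}`. -/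
def constraintSet [TopologicalSpace E] (𝓔 : LowerBoundedSemiDirichletForm μ) (Ω : Set E)
    (ξ : E → ℝ) (δ : ℝ) : Set 𝓔.dom :=
  {f | f ∈ 𝓔.partDom Ω ∧ 𝓔.pairing Ω ξ f = δ}

end LowerBoundedSemiDirichletForm

/-- The reciprocal `1 / r` of a nonnegative real, with the convention `1 / 0 = +∞`. -/
noncomputable def extendedRecip (r : ℝ) : EReal := if r = 0 then ⊤ else ((1 / r : ℝ) : EReal)

/-! ## Hunt processes -/

/-- The Borel σ-algebra on `E ∪ {∂}`, the one-point compactification of `E`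
(`∂ = OnePoint.infty` is an isolated point when `E` is already compact). -/
instance onePointMeasurableSpace {E : Type*} [TopologicalSpace E] :
    MeasurableSpace (OnePoint E) := borel (OnePoint E)

instance onePointBorelSpace {E : Type*} [TopologicalSpace E] : BorelSpace (OnePoint E) := ⟨rfl⟩

/-- A Hunt process on `E` with cemetery `∂ = OnePoint.infty` and sample space `S`. -/
structure HuntProcess (E : Type*) [TopologicalSpace E] (S : Type*) [MeasurableSpace S] where
  /-- the coordinate `X t ω` -/
  X : ℝ≥0 → S → OnePoint E
  /-- the laws `P x`, `x ∈ E ∪ {∂}` -/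
  P : Kernel (OnePoint E) S
  isMarkov : IsMarkovKernel P
  filt : Filtration ℝ≥0 ‹MeasurableSpace S›
  adapted : ∀ t, Measurable[filt t] (X t)
  rightCont_filt : filt.IsRightContinuous
  start : ∀ x, ∀ᵐ ω ∂(P x), X 0 ω = x
  /-- `∂` is absorbing -/
  absorbing : ∀ ω s t, s ≤ t → X s ω = OnePoint.infty → X t ω = OnePoint.infty
  rightCont : ∀ ω t, ContinuousWithinAt (fun s => X s ω) (Ici t) t
  leftLim : ∀ ω t, 0 < t → ∃ y, Tendsto (fun s => X s ω) (𝓝[<] t) (𝓝 y)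
  /-- strong Markov property: `P_x(X_{σ+s} ∈ B | 𝓕_σ) = P_{X_σ}(X_s ∈ B)` on `{σ < ∞}` -/
  strongMarkov : ∀ (σ : S → WithTop ℝ≥0) (hσ : IsStoppingTime filt σ) (s : ℝ≥0)
    (B : Set (OnePoint E)), MeasurableSet B → ∀ A : Set S, MeasurableSet[hσ.measurableSpace] A →
    ∀ x, P x (A ∩ {ω | σ ω ≠ ⊤ ∧ X ((σ ω).untopD 0 + s) ω ∈ B}) =
      ∫⁻ ω in A ∩ {ω | σ ω ≠ ⊤}, P (X ((σ ω).untopD 0) ω) {ω' | X s ω' ∈ B} ∂(P x)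
  /-- quasi-left-continuity on `[0, ∞)` -/
  quasiLeftCont : ∀ (σ : ℕ → S → WithTop ℝ≥0) (τ : S → WithTop ℝ≥0),
    (∀ n, IsStoppingTime filt (σ n)) → (∀ ω, Monotone fun n => σ n ω) →
    (∀ ω, IsLUB (range fun n => σ n ω) (τ ω)) →
    ∀ x, ∀ᵐ ω ∂(P x), τ ω ≠ ⊤ →
      Tendsto (fun n => X ((σ n ω).untopD 0) ω) atTop (𝓝 (X ((τ ω).untopD 0) ω))

namespace HuntProcess

variable {E : Type*} [TopologicalSpace E] {S : Type*} [MeasurableSpace S]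

/-- The first exit time `inf {t ≥ 0 : X_t ∉ Ω}`; the cemetery is not in `Ω`. -/
noncomputable def exitTime (X : HuntProcess E S) (Ω : Set E) (ω : S) : ℝ≥0∞ :=
  ⨅ (t : ℝ≥0) (_ : X.X t ω ∉ ((↑) : E → OnePoint E) '' Ω), (t : ℝ≥0∞)

/-- The integrand `e^{-α t} f(X_t(ω))`, `t ≥ 0`, with `f(∂) = 0`. -/
noncomputable def discounted (X : HuntProcess E S) (α : ℝ) (f : E → ℝ) (ω : S) (t : ℝ) : ℝ :=
  Real.exp (-α * t) * (X.X t.toNNReal ω).elim 0 f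

/-- The time interval `[0, T)`, `T ∈ [0, ∞]`. -/
def timeInterval (T : ℝ≥0∞) : Set ℝ := {t | 0 ≤ t ∧ ENNReal.ofReal t < T}

/-- The resolvent `R_α f(x) = E_x ∫_0^∞ e^{-α t} f(X_t) dt`. -/
noncomputable def resolvent (X : HuntProcess E S) (α : ℝ) (f : E → ℝ) (x : E) : ℝ :=
  ∫ ω, (∫ t in timeInterval ⊤, X.discounted α f ω t) ∂(X.P x)

/-- The resolvent `R^Ω_α f(x) = E_x ∫_0^{τ_Ω} e^{-α t} f(X_t) dt` of the process killed upon
leaving `Ω`. -/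
noncomputable def partResolvent (X : HuntProcess E S) (Ω : Set E) (α : ℝ) (f : E → ℝ)
    (x : E) : ℝ :=
  ∫ ω, (∫ t in timeInterval (X.exitTime Ω ω), X.discounted α f ω t) ∂(X.P x)

/-- The integrals that define `R^Ω_α f(x)` exist. -/
def PartResolventExists (X : HuntProcess E S) (Ω : Set E) (α : ℝ) (f : E → ℝ) (x : E) : Prop :=
  (∀ᵐ ω ∂(X.P x), IntegrableOn (X.discounted α f ω) (timeInterval (X.exitTime Ω ω))) ∧
  Integrable (fun ω => ∫ t in timeInterval (X.exitTime Ω ω), X.discounted α f ω t) (X.P x)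

/-- `X` is generated by (associated with) the form: for `α > β₀` and every bounded Borel
`f ∈ L²(μ)`, the function `R_α f` is a version of the `α`-resolvent of the form, i.e. of the element
`u` of the domain with `𝓔_α(u, g) = ⟨f, g⟩` for all `g` in the domain. -/
def IsGeneratedBy [MeasurableSpace E] {μ : Measure E} (X : HuntProcess E S)
    (𝓔 : LowerBoundedSemiDirichletForm μ) : Prop :=
  ∀ α : ℝ, 𝓔.β₀ < α → ∀ f : E → ℝ, Measurable f → (∃ C, ∀ x, |f x| ≤ C) → MemLp f 2 μ →
    ∃ u : 𝓔.dom, ((u : Lp ℝ 2 μ) : E → ℝ) =ᵐ[μ] X.resolvent α f ∧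
      ∀ g : 𝓔.dom, 𝓔.shifted α u g = ∫ x, f x * (g : Lp ℝ 2 μ) x ∂μ

end HuntProcess

/-! The analytic half is Hilbert space theory. Normed by the symmetric part of $\mathcal
E_{\beta_0+1}$, the domain is a Hilbert space on which $\mathcal E_\beta$ is bounded, by the sector
condition, and coercive with constant $\min(1,\beta-\beta_0)$. The subspace $\mathcal F^\Omega$ is
closed (`isClosed_partSub`), because quasi-continuous versions of a rapidly convergent sequence
converge q.e. Lax–Milgram on $\mathcal F^\Omega$ then gives a unique $u$. With $v$ the solution of
the adjoint problem and $a=\langle\xi,u\rangle=\langle\xi,v\rangle\ne0$, the saddle point identity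
(`extendedRecip_eq_iInf_iSup`) is a completion of squares: the choice $g=u/a-f$ always gives the
value $1/a$, and for $f=(u+v)/2a$ the value is $1/a-\mathcal E_\beta(k,k)$ with $k=g-(u-v)/2a$.

The probabilistic half is a penalization argument. For a continuous cutoff $\varphi$ with values in
$[0,1]$ and compact support, kill the process at rate $n(1-\varphi(X_t))$. The Markov property at
fixed times gives $R_\beta f=Uf+U(n(1-\varphi)R_\beta f)$ for the killed resolvent $U$
(`lintegral_resolvent_eq`). Hence $Uh$ solves the problem for the form with the added term
$n\langle(1-\varphi)f,g\rangle$ (`ae_eq_killed`). These solutions are bounded in the form norm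
uniformly in $n$, and they converge in $L^2$ by domination by $R_\beta|h|$, hence weakly in the form
domain. Letting $n\to\infty$ leaves the process killed on leaving $\{\varphi=1\}$, tested against
functions vanishing off that set.

Next, cutoffs $\varphi_m$ increase to $1$ on $\Omega$, and a second weak limit lies in $\mathcal
F^\Omega$. It satisfies the equation for test functions with compact support in $\Omega$, and these
generate $\mathcal F^\Omega$ as a closed subspace (`partSub_le`), so it is the weak solution.
Quasi-left-continuity shows that the exits from the sets $\{\varphi_m=1\}$ cannot accumulate
strictly before $\tau_\Omega$ (`ae_exists_clock_eq_zero_iff`), which turns the limiting weight into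
$e^{-\beta t}1_{t<\tau_\Omega}$ up to a single time. -/

/-! ### Coercive bilinear forms and weak limits in Hilbert space -/

section Hilbert

variable {H : Type*} [NormedAddCommGroup H] [InnerProductSpace ℝ H] [CompleteSpace H]

/-- Lax–Milgram on a closed subspace. -/
theorem existsUnique_of_coercive (B : H →L[ℝ] H →L[ℝ] ℝ) {c : ℝ} (hc : 0 < c)
    (hB : ∀ f, c * ‖f‖ ^ 2 ≤ B f f) (W : Submodule ℝ H) (hW : IsClosed (W : Set H))
    (ℓ : H →L[ℝ] ℝ) : ∃! u, u ∈ W ∧ ∀ g ∈ W, B u g = ℓ g := by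
  have : CompleteSpace W := hW.completeSpace_coe
  let BW : W →L[ℝ] W →L[ℝ] ℝ := B.bilinearComp W.subtypeL W.subtypeL
  have hcoer : IsCoercive BW := ⟨c, hc, fun u => by
    have := hB u
    simp only [BW, ContinuousLinearMap.bilinearComp_apply, Submodule.subtypeL_apply]
    calc c * ‖u‖ * ‖u‖ = c * ‖(u : H)‖ ^ 2 := by rw [Submodule.coe_norm]; ring
      _ ≤ _ := this⟩
  let w := (InnerProductSpace.toDual ℝ W).symm (ℓ.comp W.subtypeL)
  let u : W := hcoer.continuousLinearEquivOfBilin.symm w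
  have hu : ∀ g : W, B u g = ℓ g := fun g => by
    have h1 := hcoer.continuousLinearEquivOfBilin_apply u g
    simp only [u, ContinuousLinearEquiv.apply_symm_apply, w,
      InnerProductSpace.toDual_symm_apply] at h1
    simpa [BW, u, w] using h1.symm
  refine ⟨u, ⟨u.2, fun g hg => hu ⟨g, hg⟩⟩, fun v hv => ?_⟩
  have h0 : B (v - u) (v - u) = 0 := by
    have hm := W.sub_mem hv.1 u.2
    rw [map_sub B, sub_apply, hv.2 _ hm, hu ⟨_, hm⟩, sub_self]
  have h2 := hB (v - u)
  rw [h0] at h2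
  have h3 : ‖v - u‖ ^ 2 ≤ 0 := by
    by_contra h
    have := mul_pos hc (not_le.mp h)
    linarith
  have h4 : ‖v - u‖ = 0 := by
    have := sq_nonneg ‖v - u‖
    exact pow_eq_zero_iff two_ne_zero |>.mp (le_antisymm h3 this)
  exact sub_eq_zero.mp (norm_eq_zero.mp h4)

theorem norm_le_of_coercive (B : H →L[ℝ] H →L[ℝ] ℝ) {c : ℝ} (hc : 0 < c)
    (hB : ∀ f, c * ‖f‖ ^ 2 ≤ B f f) {u : H} {r : ℝ} (h0r : 0 ≤ r) (hr : B u u ≤ r * ‖u‖) :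
    ‖u‖ ≤ r / c := by
  rw [le_div_iff₀ hc]
  have h := (hB u).trans hr
  rcases (norm_nonneg u).eq_or_lt with h0 | h0
  · simpa [← h0] using h0r
  · nlinarith

variable {L : Type*} [NormedAddCommGroup L] [InnerProductSpace ℝ L] [CompleteSpace L]

/-- Banach–Alaoglu, carried to $H$ by the Riesz isomorphism. Ultrafilters replace subsequences, so
separability of $H$ plays no role. -/
theorem exists_weak_limit_ultrafilter (x : ℕ → H) {M : ℝ} (hx : ∀ n, ‖x n‖ ≤ M)
    (U : Ultrafilter ℕ) :
    ∃ z, ‖z‖ ≤ M ∧ ∀ ℓ : H →L[ℝ] ℝ, Tendsto (fun n => ℓ (x n)) U (𝓝 (ℓ z)) := by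
  have hK := WeakDual.isCompact_closedBall (𝕜 := ℝ) (0 : StrongDual ℝ H) M
  let φ : ℕ → WeakDual ℝ H := fun n =>
    StrongDual.toWeakDual (InnerProductSpace.toDual ℝ H (x n))
  obtain ⟨ψ, hψ, hle⟩ := hK.ultrafilter_le_nhds (U.map φ) (by
    refine le_principal_iff.mpr (Filter.mem_map.mpr (Filter.Eventually.of_forall fun n => ?_))
    change InnerProductSpace.toDual ℝ H (x n) ∈ Metric.closedBall 0 M
    rw [mem_closedBall_zero_iff, LinearIsometryEquiv.norm_map]
    exact hx n)
  let z := (InnerProductSpace.toDual ℝ H).symm (WeakDual.toStrongDual ψ)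
  refine ⟨z, ?_, fun ℓ => ?_⟩
  · rw [LinearIsometryEquiv.norm_map]
    exact mem_closedBall_zero_iff.mp hψ
  · let w := (InnerProductSpace.toDual ℝ H).symm ℓ
    have hw : ∀ v, ℓ v = inner ℝ v w := fun v => by
      rw [real_inner_comm]; exact InnerProductSpace.toDual_symm_apply.symm
    have h1 : Tendsto (fun n => φ n w) U (𝓝 (ψ w)) :=
      ((WeakDual.eval_continuous w).tendsto ψ).comp (show Tendsto φ U (𝓝 ψ) from hle)
    have h2 : ψ w = ℓ z := by
      rw [hw]; exact InnerProductSpace.toDual_symm_apply.symm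
    rw [← h2]
    refine h1.congr fun n => ?_
    rw [hw]; rfl

/-- A bounded sequence whose image under an injective map converges is weakly convergent. -/
theorem exists_weak_limit (J : H →L[ℝ] L) (hJ : Function.Injective J) (x : ℕ → H) {M : ℝ}
    (hx : ∀ n, ‖x n‖ ≤ M) {y : L} (hy : Tendsto (fun n => J (x n)) atTop (𝓝 y)) :
    ∃ z, J z = y ∧ ‖z‖ ≤ M ∧ ∀ ℓ : H →L[ℝ] ℝ, Tendsto (fun n => ℓ (x n)) atTop (𝓝 (ℓ z)) := by
  -- Along each ultrafilter finer than `atTop` a weak limit exists, and $J$ maps it to $y$.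
  -- Injectivity makes all these limits coincide, so the full sequence converges weakly.
  have key : ∀ U : Ultrafilter ℕ, ↑U ≤ (atTop : Filter ℕ) → ∃ z, J z = y ∧ ‖z‖ ≤ M ∧
      ∀ ℓ : H →L[ℝ] ℝ, Tendsto (fun n => ℓ (x n)) U (𝓝 (ℓ z)) := by
    intro U hU
    obtain ⟨z, hz, hℓ⟩ := exists_weak_limit_ultrafilter x hx U
    refine ⟨z, ?_, hz, hℓ⟩
    refine ext_inner_left ℝ fun v => ?_
    have h1 := hℓ ((innerSL ℝ v).comp J)
    have h2 : Tendsto (fun n => inner ℝ v (J (x n))) U (𝓝 (inner ℝ v y)) :=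
      tendsto_const_nhds.inner (hy.mono_left hU)
    exact tendsto_nhds_unique h1 h2
  obtain ⟨z, hzJ, hzM, -⟩ := key (Ultrafilter.of atTop) (Ultrafilter.of_le _)
  refine ⟨z, hzJ, hzM, fun ℓ => ?_⟩
  rw [tendsto_iff_ultrafilter]
  intro U hU
  obtain ⟨z', hz', -, h⟩ := key U hU
  rw [hJ (hzJ.trans hz'.symm)]
  exact h ℓ

/-- A closed subspace is its own double orthogonal complement, hence cut out by continuous
functionals. -/
theorem mem_of_weak_limit {D : Submodule ℝ H} (hD : IsClosed (D : Set H)) {x : ℕ → H}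
    (hx : ∀ n, x n ∈ D) {z : H}
    (hz : ∀ ℓ : H →L[ℝ] ℝ, Tendsto (fun n => ℓ (x n)) atTop (𝓝 (ℓ z))) : z ∈ D := by
  have : CompleteSpace D := hD.completeSpace_coe
  rw [← Submodule.orthogonal_orthogonal D, Submodule.mem_orthogonal]
  intro u hu
  refine tendsto_nhds_unique (hz (innerSL ℝ u)) (tendsto_const_nhds.congr fun n => ?_)
  exact ((Submodule.mem_orthogonal' D u).mp hu _ (hx n)).symm

end Hilbert

/-! ### Convergence in $L^2$ -/

section Lp

variable {E : Type*} [MeasurableSpace E] {μ : Measure E}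

/-- Dominated convergence in `L²`. -/
theorem exists_lp_limit_of_dominated {f : ℕ → Lp ℝ 2 μ} {g : Lp ℝ 2 μ} {v : E → ℝ}
    (hb : ∀ n, ∀ᵐ x ∂μ, |f n x| ≤ g x)
    (hv : ∀ᵐ x ∂μ, Tendsto (fun n => f n x) atTop (𝓝 (v x))) :
    ∃ y : Lp ℝ 2 μ, y =ᵐ[μ] v ∧ Tendsto f atTop (𝓝 y) := by
  have hvm : AEStronglyMeasurable v μ :=
    aestronglyMeasurable_of_tendsto_ae atTop (fun n => (Lp.aestronglyMeasurable (f n))) hv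
  have hvb : ∀ᵐ x ∂μ, |v x| ≤ g x := by
    filter_upwards [hv, ae_all_iff.mpr hb] with x hx hbx
    exact le_of_tendsto hx.abs (Eventually.of_forall hbx)
  have hvL : MemLp v 2 μ := (Lp.memLp g).mono hvm (by
    filter_upwards [hvb] with x hx
    exact hx.trans (le_abs_self _))
  refine ⟨hvL.toLp v, hvL.coeFn_toLp, ?_⟩
  rw [Lp.tendsto_Lp_iff_tendsto_eLpNorm']
  have h1 : ∀ n, eLpNorm (⇑(f n) - ⇑(hvL.toLp v)) 2 μ
      = (∫⁻ x, ‖f n x - v x‖ₑ ^ (2 : ℝ) ∂μ) ^ (1 / 2 : ℝ) := fun n => by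
    rw [eLpNorm_congr_ae (g := fun x => f n x - v x), eLpNorm_eq_lintegral_rpow_enorm_toReal
      (by norm_num) (by norm_num)]
    · simp
    · filter_upwards [hvL.coeFn_toLp] with x hx
      simp [hx]
  simp_rw [h1]
  have h2 : Tendsto (fun n => ∫⁻ x, ‖f n x - v x‖ₑ ^ (2 : ℝ) ∂μ) atTop (𝓝 (∫⁻ _, 0 ∂μ)) := by
    refine tendsto_lintegral_of_dominated_convergence' (fun x => ‖2 * g x‖ₑ ^ (2 : ℝ)) ?_ ?_ ?_ ?_
    · intro n
      exact (((Lp.aestronglyMeasurable (f n)).sub hvm).enorm).pow_const _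
    · intro n
      filter_upwards [hb n, hvb] with x h1 h2
      refine ENNReal.rpow_le_rpow ?_ (by norm_num)
      rw [Real.enorm_eq_ofReal_abs, Real.enorm_eq_ofReal_abs]
      refine ENNReal.ofReal_le_ofReal ?_
      have := abs_sub (f n x) (v x)
      have := le_abs_self (2 * g x)
      linarith
    · have h3 := ((Lp.memLp g).const_mul 2).eLpNorm_lt_top
      have h4 := lintegral_rpow_enorm_lt_top_of_eLpNorm_lt_top (by norm_num) (by norm_num) h3
      simpa using h4.ne
    · filter_upwards [hv] with x hx
      have h5 : Tendsto (fun n => ‖f n x - v x‖ₑ) atTop (𝓝 0) := by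
        have := (hx.sub_const (v x)).enorm
        simpa using this
      have := (ENNReal.continuous_rpow_const (y := (2 : ℝ))).tendsto 0 |>.comp h5
      simpa [Function.comp_def] using this
  have h3 := (ENNReal.continuous_rpow_const (y := (1 / 2 : ℝ))).tendsto _ |>.comp h2
  simpa [Function.comp_def] using h3

theorem exists_subseq_tendsto_ae {f : ℕ → Lp ℝ 2 μ} {y : Lp ℝ 2 μ}
    (hf : Tendsto f atTop (𝓝 y)) :
    ∃ ns : ℕ → ℕ, StrictMono ns ∧
      ∀ᵐ x ∂μ, Tendsto (fun i => f (ns i) x) atTop (𝓝 (y x)) :=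
  (tendstoInMeasure_of_tendsto_Lp hf).exists_seq_tendsto_ae

theorem ae_eq_of_tendsto_lp {f : ℕ → Lp ℝ 2 μ} {y : Lp ℝ 2 μ} {v : E → ℝ}
    (hf : Tendsto f atTop (𝓝 y))
    (hv : ∀ᵐ x ∂μ, Tendsto (fun n => f n x) atTop (𝓝 (v x))) : y =ᵐ[μ] v := by
  obtain ⟨ns, hns, h⟩ := exists_subseq_tendsto_ae hf
  filter_upwards [h, hv] with x h1 h2
  exact tendsto_nhds_unique h1 (h2.comp hns.tendsto_atTop)

end Lp

/-! ### The form domain as a Hilbert space -/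

namespace LowerBoundedSemiDirichletForm

section Hilbert

variable {E : Type*} [MeasurableSpace E] {μ : Measure E} (𝓔 : LowerBoundedSemiDirichletForm μ)

/-- The domain of the form, with the Hilbert space structure given by the symmetric part of
`𝓔_{β₀ + 1}`. -/
def FormSpace (𝓔 : LowerBoundedSemiDirichletForm μ) : Type _ := 𝓔.dom

instance : AddCommGroup 𝓔.FormSpace := inferInstanceAs (AddCommGroup 𝓔.dom)
noncomputable instance : Module ℝ 𝓔.FormSpace := inferInstanceAs (Module ℝ 𝓔.dom)

theorem shifted_add_left (β : ℝ) (f g h : 𝓔.dom) :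
    𝓔.shifted β (f + g) h = 𝓔.shifted β f h + 𝓔.shifted β g h := by
  simp only [shifted, map_add, LinearMap.add_apply, Submodule.coe_add, inner_add_left]; ring

theorem shifted_add_right (β : ℝ) (f g h : 𝓔.dom) :
    𝓔.shifted β f (g + h) = 𝓔.shifted β f g + 𝓔.shifted β f h := by
  simp only [shifted, map_add, Submodule.coe_add, inner_add_right]; ring

theorem shifted_smul_left (β c : ℝ) (f g : 𝓔.dom) :
    𝓔.shifted β (c • f) g = c * 𝓔.shifted β f g := by
  simp only [shifted, map_smul, LinearMap.smul_apply, Submodule.coe_smul, real_inner_smul_left,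
    smul_eq_mul]; ring

theorem shifted_smul_right (β c : ℝ) (f g : 𝓔.dom) :
    𝓔.shifted β f (c • g) = c * 𝓔.shifted β f g := by
  simp only [shifted, map_smul, Submodule.coe_smul, real_inner_smul_right, smul_eq_mul]; ring

theorem shifted_self (β : ℝ) (f : 𝓔.dom) :
    𝓔.shifted β f f = 𝓔.shifted 𝓔.β₀ f f + (β - 𝓔.β₀) * ‖(f : Lp ℝ 2 μ)‖ ^ 2 := by
  simp only [shifted, real_inner_self_eq_norm_sq]; ring

theorem shifted_bound_nonneg (f : 𝓔.dom) : 0 ≤ 𝓔.shifted 𝓔.β₀ f f := 𝓔.lower_bounded f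

/-- The identification of `FormSpace` with the domain. -/
noncomputable def toDom : 𝓔.FormSpace ≃ₗ[ℝ] 𝓔.dom := LinearEquiv.refl ℝ 𝓔.dom

/-- The level $\beta_0+1$ is the one used in `cap`, so the energies defining capacity are squared
norms. By `shifted_self` it exceeds $\mathcal E_{\beta_0}(f,f)\ge0$ by exactly $\|f\|_{L^2}^2$,
which gives definiteness. -/
noncomputable instance : InnerProductSpace.Core ℝ 𝓔.FormSpace where
  inner f g := (𝓔.shifted (𝓔.β₀ + 1) (𝓔.toDom f) (𝓔.toDom g)
    + 𝓔.shifted (𝓔.β₀ + 1) (𝓔.toDom g) (𝓔.toDom f)) / 2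
  conj_inner_symm f g := by simp [add_comm]
  re_inner_nonneg f := by
    have h := 𝓔.shifted_self (𝓔.β₀ + 1) (𝓔.toDom f)
    have h0 := 𝓔.shifted_bound_nonneg (𝓔.toDom f)
    have := sq_nonneg ‖(𝓔.toDom f : Lp ℝ 2 μ)‖
    simp only [RCLike.re_to_real]
    nlinarith
  add_left f g h := by
    simp only [map_add, shifted_add_left, shifted_add_right]
    ring
  smul_left f g c := by
    simp only [map_smul, shifted_smul_left, shifted_smul_right, conj_trivial]
    ring
  definite f hf := by
    have h := 𝓔.shifted_self (𝓔.β₀ + 1) (𝓔.toDom f)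
    have h0 := 𝓔.shifted_bound_nonneg (𝓔.toDom f)
    have h2 : ‖(𝓔.toDom f : Lp ℝ 2 μ)‖ ^ 2 = 0 := by
      have := sq_nonneg ‖(𝓔.toDom f : Lp ℝ 2 μ)‖
      nlinarith
    have h3 := norm_eq_zero.mp (pow_eq_zero_iff two_ne_zero |>.mp h2)
    exact 𝓔.toDom.map_eq_zero_iff.mp (Subtype.ext h3)

noncomputable instance : NormedAddCommGroup 𝓔.FormSpace :=
  InnerProductSpace.Core.toNormedAddCommGroup (𝕜 := ℝ)

noncomputable instance : InnerProductSpace ℝ 𝓔.FormSpace :=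
  InnerProductSpace.ofCore inferInstance

theorem FormSpace.norm_sq (f : 𝓔.FormSpace) :
    ‖f‖ ^ 2 = 𝓔.shifted (𝓔.β₀ + 1) (𝓔.toDom f) (𝓔.toDom f) := by
  rw [← real_inner_self_eq_norm_sq]
  change (𝓔.shifted (𝓔.β₀ + 1) (𝓔.toDom f) (𝓔.toDom f)
    + 𝓔.shifted (𝓔.β₀ + 1) (𝓔.toDom f) (𝓔.toDom f)) / 2 = _
  ring

theorem FormSpace.norm_eq (f : 𝓔.FormSpace) :
    ‖f‖ = √(𝓔.shifted (𝓔.β₀ + 1) (𝓔.toDom f) (𝓔.toDom f)) := by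
  rw [← FormSpace.norm_sq, Real.sqrt_sq (norm_nonneg f)]

theorem FormSpace.norm_sq_eq (f : 𝓔.FormSpace) :
    ‖f‖ ^ 2 = 𝓔.shifted 𝓔.β₀ (𝓔.toDom f) (𝓔.toDom f) + ‖(𝓔.toDom f : Lp ℝ 2 μ)‖ ^ 2 := by
  rw [FormSpace.norm_sq, shifted_self]; ring

instance : CompleteSpace 𝓔.FormSpace := by
  refine Metric.complete_of_cauchySeq_tendsto fun u hu => ?_
  obtain ⟨f, hf⟩ := 𝓔.complete (𝓔.β₀ + 1) (by linarith) (fun n => 𝓔.toDom (u n)) (fun ε hε => by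
    obtain ⟨N, hN⟩ := Metric.cauchySeq_iff.mp hu (√ε) (Real.sqrt_pos.mpr hε)
    refine ⟨N, fun m hm n hn => ?_⟩
    have h1 := hN m hm n hn
    rw [dist_eq_norm, FormSpace.norm_eq, Real.sqrt_lt_sqrt_iff_of_pos hε, map_sub] at h1
    exact h1)
  refine ⟨𝓔.toDom.symm f, tendsto_iff_norm_sub_tendsto_zero.mpr ?_⟩
  have := (Real.continuous_sqrt.tendsto 0).comp hf
  rw [Real.sqrt_zero] at this
  refine this.congr fun n => ?_
  rw [FormSpace.norm_eq, map_sub, LinearEquiv.apply_symm_apply]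
  rfl

theorem norm_toDom_le (f : 𝓔.FormSpace) : ‖(𝓔.toDom f : Lp ℝ 2 μ)‖ ≤ ‖f‖ := by
  refine le_of_sq_le_sq ?_ (norm_nonneg _)
  have h := FormSpace.norm_sq_eq 𝓔 f
  have h0 := 𝓔.shifted_bound_nonneg (𝓔.toDom f)
  linarith

/-- The inclusion of the form domain into `L²`. -/
noncomputable def incl : 𝓔.FormSpace →L[ℝ] Lp ℝ 2 μ :=
  LinearMap.mkContinuous (𝓔.dom.subtype ∘ₗ (𝓔.toDom : 𝓔.FormSpace →ₗ[ℝ] 𝓔.dom)) 1 (fun f => by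
    rw [one_mul]
    exact 𝓔.norm_toDom_le f)

theorem incl_apply (f : 𝓔.FormSpace) : 𝓔.incl f = (𝓔.toDom f : Lp ℝ 2 μ) := rfl

theorem incl_injective : Function.Injective 𝓔.incl :=
  Subtype.val_injective.comp 𝓔.toDom.injective

theorem norm_incl_le (f : 𝓔.FormSpace) : ‖𝓔.incl f‖ ≤ ‖f‖ := 𝓔.norm_toDom_le f

theorem sqrt_shifted_le_norm (f : 𝓔.FormSpace) :
    √(𝓔.shifted 𝓔.β₀ (𝓔.toDom f) (𝓔.toDom f)) ≤ ‖f‖ := by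
  rw [FormSpace.norm_eq]
  refine Real.sqrt_le_sqrt ?_
  rw [shifted_self 𝓔 (𝓔.β₀ + 1)]
  have := sq_nonneg ‖(𝓔.toDom f : Lp ℝ 2 μ)‖
  linarith

/-- The constant in the weak sector condition. -/
noncomputable def sectorConst : ℝ := 𝓔.sector.choose

theorem one_le_sectorConst : 1 ≤ 𝓔.sectorConst := 𝓔.sector.choose_spec.1

theorem abs_form_le (f g : 𝓔.FormSpace) :
    |𝓔.form (𝓔.toDom f) (𝓔.toDom g)| ≤ 𝓔.sectorConst * ‖f‖ * ‖g‖ := by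
  have h0 := 𝓔.one_le_sectorConst
  refine (𝓔.sector.choose_spec.2 _ _).trans ?_
  have h1 := 𝓔.sqrt_shifted_le_norm f
  have h2 := 𝓔.sqrt_shifted_le_norm g
  have h3 := norm_nonneg f
  change 𝓔.sectorConst * √(𝓔.shifted 𝓔.β₀ (𝓔.toDom f) (𝓔.toDom f))
    * √(𝓔.shifted 𝓔.β₀ (𝓔.toDom g) (𝓔.toDom g)) ≤ _
  gcongr

theorem shifted_toDom (β : ℝ) (f g : 𝓔.FormSpace) : 𝓔.shifted β (𝓔.toDom f) (𝓔.toDom g) =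
    𝓔.form (𝓔.toDom f) (𝓔.toDom g) + β * inner ℝ (𝓔.incl f) (𝓔.incl g) := rfl

/-- The shifted form as a bounded bilinear map. -/
noncomputable def shiftedL (β : ℝ) : 𝓔.FormSpace →L[ℝ] 𝓔.FormSpace →L[ℝ] ℝ :=
  LinearMap.mkContinuous₂ (LinearMap.mk₂ ℝ
    (fun f g : 𝓔.FormSpace => 𝓔.shifted β (𝓔.toDom f) (𝓔.toDom g))
    (fun f g h => by simp only [map_add, shifted_add_left])
    (fun c f g => by simp only [map_smul, shifted_smul_left, smul_eq_mul])
    (fun f g h => by simp only [map_add, shifted_add_right])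
    (fun c f g => by simp only [map_smul, shifted_smul_right, smul_eq_mul]))
    (𝓔.sectorConst + |β|)
    (fun f g => by
      rw [LinearMap.mk₂_apply, shifted_toDom, Real.norm_eq_abs]
      refine (abs_add_le _ _).trans ?_
      have h1 := 𝓔.abs_form_le f g
      have h2 : |inner ℝ (𝓔.incl f) (𝓔.incl g)| ≤ ‖f‖ * ‖g‖ :=
        (abs_real_inner_le_norm _ _).trans (mul_le_mul (𝓔.norm_incl_le _) (𝓔.norm_incl_le _)
          (norm_nonneg _) (norm_nonneg _))
      have h3 := mul_le_mul_of_nonneg_left h2 (abs_nonneg β)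
      rw [abs_mul]
      linarith)

theorem shiftedL_apply (β : ℝ) (f g : 𝓔.FormSpace) :
    𝓔.shiftedL β f g = 𝓔.shifted β (𝓔.toDom f) (𝓔.toDom g) := rfl

/-- The coercivity constant of `𝓔_β`. -/
noncomputable def coerc (β : ℝ) : ℝ := min 1 (β - 𝓔.β₀)

theorem coerc_pos {β : ℝ} (hβ : 𝓔.β₀ < β) : 0 < 𝓔.coerc β :=
  lt_min one_pos (sub_pos.mpr hβ)

theorem coerc_mul_le (β : ℝ) (f : 𝓔.FormSpace) :
    𝓔.coerc β * ‖f‖ ^ 2 ≤ 𝓔.shiftedL β f f := by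
  rw [shiftedL_apply, shifted_self, FormSpace.norm_sq_eq, mul_add]
  have h0 := 𝓔.shifted_bound_nonneg (𝓔.toDom f)
  have h1 : 𝓔.coerc β ≤ 1 := min_le_left _ _
  have h2 : 𝓔.coerc β ≤ β - 𝓔.β₀ := min_le_right _ _
  have h3 := sq_nonneg ‖(𝓔.toDom f : Lp ℝ 2 μ)‖
  exact add_le_add (by nlinarith) (mul_le_mul_of_nonneg_right h2 h3)

end Hilbert

/-! ### Truncations and positive parts in the form domain -/

section Contraction

variable {E : Type*} [MeasurableSpace E] {μ : Measure E} (𝓔 : LowerBoundedSemiDirichletForm μ)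

/-- The norm bound of the normal contractions `f ↦ f⁺ ∧ λ` on the form domain. -/
noncomputable def contrConst : ℝ := 𝓔.sectorConst + 𝓔.β₀ + 1

theorem one_le_contrConst : 1 ≤ 𝓔.contrConst := by
  have := 𝓔.one_le_sectorConst
  have := 𝓔.β₀_nonneg
  unfold contrConst; linarith

theorem contrConst_pos : 0 < 𝓔.contrConst := one_pos.trans_le 𝓔.one_le_contrConst

/-- With $G=f^+\wedge1$, both $\mathcal E(G,f-G)$ and the pointwise product $G(f-G)$ are
nonnegative. So $\|G\|^2\le\mathcal E_{\beta_0+1}(G,f)$, and the sector condition bounds the right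
side by a multiple of $\|f\|\|G\|$. -/
theorem exists_unitContraction (f : 𝓔.FormSpace) : ∃ g : 𝓔.FormSpace,
    𝓔.incl g =ᵐ[μ] (fun x => min (max (𝓔.incl f x) 0) 1) ∧ ‖g‖ ≤ 𝓔.contrConst * ‖f‖ := by
  obtain ⟨g, hg, hfg⟩ := 𝓔.markov (𝓔.toDom f)
  obtain ⟨G, rfl⟩ := 𝓔.toDom.surjective g
  rw [← map_sub] at hfg
  refine ⟨G, hg, ?_⟩
  have h1 : 0 ≤ inner ℝ (𝓔.incl G) (𝓔.incl (f - G)) := by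
    rw [L2.inner_def]
    refine integral_nonneg_of_ae ?_
    have hsub : 𝓔.incl (f - G) =ᵐ[μ] fun x => 𝓔.incl f x - 𝓔.incl G x := by
      rw [map_sub]; exact Lp.coeFn_sub _ _
    filter_upwards [hg, hsub] with x hx hx2
    change 𝓔.incl G x = min (max (𝓔.incl f x) 0) 1 at hx
    simp only [Pi.zero_apply, hx2, hx, RCLike.inner_apply, conj_trivial]
    rcases le_total (𝓔.incl f x) 0 with h | h
    · simp [h]
    · rw [max_eq_left h]
      exact mul_nonneg (sub_nonneg.mpr (min_le_left _ _)) (le_min h zero_le_one)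
  have h2 : ‖G‖ ^ 2 ≤ 𝓔.shiftedL (𝓔.β₀ + 1) G f := by
    have h3 : 𝓔.shiftedL (𝓔.β₀ + 1) G (f - G) =
      𝓔.form (𝓔.toDom G) (𝓔.toDom (f - G)) + (𝓔.β₀ + 1) * inner ℝ (𝓔.incl G) (𝓔.incl (f - G)) := rfl
    have h4 : 𝓔.shiftedL (𝓔.β₀ + 1) G (f - G) = 𝓔.shiftedL (𝓔.β₀ + 1) G f - ‖G‖ ^ 2 := by
      rw [FormSpace.norm_sq, map_sub, shiftedL_apply, shiftedL_apply]
    have := mul_nonneg (add_nonneg 𝓔.β₀_nonneg zero_le_one) h1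
    linarith
  have h5 : 𝓔.shiftedL (𝓔.β₀ + 1) G f ≤ 𝓔.contrConst * ‖f‖ * ‖G‖ := by
    have h6 := (le_abs_self _).trans (𝓔.abs_form_le G f)
    have h7 : inner ℝ (𝓔.incl G) (𝓔.incl f) ≤ ‖G‖ * ‖f‖ :=
      (real_inner_le_norm _ _).trans (mul_le_mul (𝓔.norm_incl_le _) (𝓔.norm_incl_le _)
        (norm_nonneg _) (norm_nonneg _))
    have h8 : 𝓔.shiftedL (𝓔.β₀ + 1) G f = 𝓔.form (𝓔.toDom G) (𝓔.toDom f) + (𝓔.β₀ + 1) *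
      inner ℝ (𝓔.incl G) (𝓔.incl f) := rfl
    have := mul_le_mul_of_nonneg_left h7 (add_nonneg 𝓔.β₀_nonneg zero_le_one)
    unfold contrConst
    linarith
  have h9 := mul_nonneg 𝓔.contrConst_pos.le (norm_nonneg f)
  rcases (norm_nonneg G).eq_or_lt with h0 | h0
  · rwa [← h0]
  · nlinarith

theorem incl_add (f g : 𝓔.FormSpace) : 𝓔.incl (f + g) =ᵐ[μ] fun x => 𝓔.incl f x + 𝓔.incl g x := by
  rw [map_add]; exact Lp.coeFn_add _ _

theorem incl_sub (f g : 𝓔.FormSpace) : 𝓔.incl (f - g) =ᵐ[μ] fun x => 𝓔.incl f x - 𝓔.incl g x := by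
  rw [map_sub]; exact Lp.coeFn_sub _ _

theorem incl_smul (c : ℝ) (f : 𝓔.FormSpace) : 𝓔.incl (c • f) =ᵐ[μ] fun x => c * 𝓔.incl f x := by
  rw [map_smul]; exact Lp.coeFn_smul _ _

/-- By scaling, $f^+\wedge r=r((f/r)^+\wedge1)$. The constant does not depend on $r$, which allows
both $r\to\infty$ (positive parts) and $r\to0$ (spectral synthesis). -/
theorem exists_truncation (f : 𝓔.FormSpace) {r : ℝ} (hr : 0 < r) : ∃ g : 𝓔.FormSpace,
    𝓔.incl g =ᵐ[μ] (fun x => min (max (𝓔.incl f x) 0) r) ∧ ‖g‖ ≤ 𝓔.contrConst * ‖f‖ := by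
  obtain ⟨g, hg, hn⟩ := 𝓔.exists_unitContraction (r⁻¹ • f)
  refine ⟨r • g, ?_, ?_⟩
  · filter_upwards [hg, 𝓔.incl_smul r g, 𝓔.incl_smul r⁻¹ f] with x h1 h2 h3
    rw [h2, h1, h3, mul_min_of_nonneg _ _ hr.le, mul_max_of_nonneg _ _ hr.le]
    simp [hr.ne']
  · rw [norm_smul, Real.norm_of_nonneg hr.le]
    rw [norm_smul, Real.norm_of_nonneg (inv_nonneg.mpr hr.le)] at hn
    calc r * ‖g‖ ≤ r * (𝓔.contrConst * (r⁻¹ * ‖f‖)) := by gcongr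
      _ = _ := by field_simp

/-- The truncations $f^+\wedge(n+1)$ are bounded in norm and converge in $L^2$ to $f^+$, which is
therefore their weak limit in the form domain. -/
theorem exists_posPart (f : 𝓔.FormSpace) : ∃ g : 𝓔.FormSpace,
    𝓔.incl g = Lp.posPart (𝓔.incl f) ∧ ‖g‖ ≤ 𝓔.contrConst * ‖f‖ := by
  choose g hg hn using fun n : ℕ => 𝓔.exists_truncation f (r := n + 1) (by positivity)
  obtain ⟨y, hy, hlim⟩ := exists_lp_limit_of_dominated (f := fun n => 𝓔.incl (g n))
    (g := Lp.posPart (𝓔.incl f)) (v := fun x => max (𝓔.incl f x) 0)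
    (fun n => by
      filter_upwards [hg n, Lp.coeFn_posPart (𝓔.incl f)] with x h1 h2
      rw [h1, h2, abs_of_nonneg (le_min (le_max_right _ _) (by positivity))]
      exact min_le_left _ _)
    (by
      filter_upwards [ae_all_iff.mpr hg] with x hx
      simp_rw [hx]
      obtain ⟨N, hN⟩ := exists_nat_ge (max (𝓔.incl f x) 0)
      refine tendsto_const_nhds.congr' ?_
      filter_upwards [eventually_ge_atTop N] with n hn
      rw [min_eq_left]
      have : (N : ℝ) ≤ n := by exact_mod_cast hn
      linarith)
  obtain ⟨z, hz, hzn, -⟩ := exists_weak_limit 𝓔.incl 𝓔.incl_injective g hn hlim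
  refine ⟨z, ?_, hzn⟩
  rw [hz]
  exact Lp.ext (hy.trans (Lp.coeFn_posPart _).symm)

end Contraction

end LowerBoundedSemiDirichletForm

/-! ### Capacity, polar sets and quasi-continuity -/

namespace LowerBoundedSemiDirichletForm

section Capacity

variable {E : Type*} [TopologicalSpace E] [MeasurableSpace E] {μ : Measure E}
  (𝓔 : LowerBoundedSemiDirichletForm μ)

/-- The set has an open neighbourhood on which some nonnegative element of the form domain of norm
at most `r` is at least `1`. -/
def IsSmall (r : ℝ) (A : Set E) : Prop :=
  ∃ G : Set E, IsOpen G ∧ A ⊆ G ∧ ∃ e : 𝓔.FormSpace, 0 ≤ᵐ[μ] 𝓔.incl e ∧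
    (∀ᵐ x ∂μ, x ∈ G → 1 ≤ 𝓔.incl e x) ∧ ‖e‖ ≤ r

/-- Polar sets: the sets of capacity zero. -/
def IsPolar (A : Set E) : Prop := ∀ r : ℝ, 0 < r → 𝓔.IsSmall r A

variable {𝓔}

theorem IsSmall.mono {r : ℝ} {A B : Set E} (h : 𝓔.IsSmall r A) (hBA : B ⊆ A) :
    𝓔.IsSmall r B := by
  obtain ⟨G, hG, hAG, e, he⟩ := h
  exact ⟨G, hG, hBA.trans hAG, e, he⟩

theorem IsSmall.mono_radius {r s : ℝ} {A : Set E} (h : 𝓔.IsSmall r A) (hrs : r ≤ s) :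
    𝓔.IsSmall s A := by
  obtain ⟨G, hG, hAG, e, he1, he2, he3⟩ := h
  exact ⟨G, hG, hAG, e, he1, he2, he3.trans hrs⟩

theorem IsSmall.exists_isOpen {r : ℝ} {A : Set E} (h : 𝓔.IsSmall r A) :
    ∃ G, IsOpen G ∧ A ⊆ G ∧ 𝓔.IsSmall r G := by
  obtain ⟨G, hG, hAG, he⟩ := h
  exact ⟨G, hG, hAG, G, hG, Subset.rfl, he⟩

/-- Smallness is measured by a norm instead of its square, so countable subadditivity is the
triangle inequality: the sum of nonnegative elements dominates each of them. -/
theorem IsSmall.iUnion {r : ℕ → ℝ} (hr : Summable r) {A : ℕ → Set E}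
    (h : ∀ n, 𝓔.IsSmall (r n) (A n)) : 𝓔.IsSmall (∑' n, r n) (⋃ n, A n) := by
  choose G hG hAG e he1 he2 he3 using h
  have hs : Summable e := Summable.of_norm_bounded hr he3
  have hsL : HasSum (fun n => 𝓔.incl (e n)) (𝓔.incl (∑' n, e n)) := 𝓔.incl.hasSum hs.hasSum
  have h0 : ∀ n, 0 ≤ 𝓔.incl (e n) := fun n => by
    rw [← Lp.coeFn_nonneg]; exact he1 n
  have hle : ∀ n, 𝓔.incl (e n) ≤ 𝓔.incl (∑' n, e n) := fun n =>
    le_hasSum hsL n fun m _ => h0 m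
  refine ⟨⋃ n, G n, isOpen_iUnion hG, iUnion_mono hAG, ∑' n, e n, ?_, ?_, ?_⟩
  · rw [Lp.coeFn_nonneg]
    exact (h0 0).trans (hle 0)
  · filter_upwards [ae_all_iff.mpr he2, ae_all_iff.mpr fun n => (Lp.coeFn_le _ _).mpr (hle n)]
      with x h1 h2 hx
    obtain ⟨n, hn⟩ := mem_iUnion.mp hx
    exact (h1 n hn).trans (h2 n)
  · exact tsum_of_norm_bounded hr.hasSum he3

theorem IsSmall.union {r s : ℝ} {A B : Set E} (hA : 𝓔.IsSmall r A) (hB : 𝓔.IsSmall s B) :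
    𝓔.IsSmall (r + s) (A ∪ B) := by
  obtain ⟨G, hG, hAG, e, he1, he2, he3⟩ := hA
  obtain ⟨G', hG', hAG', e', he1', he2', he3'⟩ := hB
  refine ⟨G ∪ G', hG.union hG', union_subset_union hAG hAG', e + e', ?_, ?_,
    (norm_add_le _ _).trans (add_le_add he3 he3')⟩
  · filter_upwards [he1, he1', 𝓔.incl_add e e'] with x h1 h2 h3
    rw [h3]; exact add_nonneg h1 h2
  · filter_upwards [he1, he1', he2, he2', 𝓔.incl_add e e'] with x h1 h2 h3 h4 h5 hx
    simp only [Pi.zero_apply] at h1 h2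
    rw [h5]
    rcases hx with hx | hx
    · linarith [h3 hx]
    · linarith [h4 hx]

theorem IsSmall.cap_le {r : ℝ} {A : Set E} (h : 𝓔.IsSmall r A) :
    𝓔.cap A ≤ ENNReal.ofReal (r ^ 2) := by
  obtain ⟨G, hG, hAG, e, he1, he2, he3⟩ := h
  refine iInf_le_of_le G (iInf_le_of_le hG (iInf_le_of_le hAG (iInf_le_of_le (𝓔.toDom e)
    (iInf_le_of_le he2 ?_))))
  rw [← FormSpace.norm_sq]
  exact ENNReal.ofReal_le_ofReal (pow_le_pow_left₀ (norm_nonneg _) he3 2)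

/-- Competitors for `cap` may change sign; their unit contractions do not and are still at least $1$
on the open set, at the price of the factor `contrConst`. -/
theorem isSmall_of_cap_lt {r : ℝ} (hr : 0 < r) {A : Set E}
    (h : 𝓔.cap A < ENNReal.ofReal (r ^ 2)) : 𝓔.IsSmall (𝓔.contrConst * r) A := by
  simp only [cap, iInf_lt_iff] at h
  obtain ⟨G, hG, hAG, f, hf, hlt⟩ := h
  obtain ⟨f, rfl⟩ := 𝓔.toDom.surjective f
  rw [← FormSpace.norm_sq, ENNReal.ofReal_lt_ofReal_iff (by positivity)] at hlt
  have hfr : ‖f‖ ≤ r := (lt_of_pow_lt_pow_left₀ 2 hr.le hlt).le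
  obtain ⟨g, hg, hgn⟩ := 𝓔.exists_unitContraction f
  refine ⟨G, hG, hAG, g, ?_, ?_,
    hgn.trans (mul_le_mul_of_nonneg_left hfr 𝓔.contrConst_pos.le)⟩
  · filter_upwards [hg] with x hx
    rw [hx]; exact le_min (le_max_right _ _) zero_le_one
  · filter_upwards [hg, hf] with x hx h1 hxG
    rw [hx]
    exact le_min ((h1 hxG).trans (le_max_left _ _)) le_rfl

theorem isSmall_of_cap_lt' {r : ℝ} (hr : 0 < r) {A : Set E}
    (h : 𝓔.cap A < ENNReal.ofReal ((r / 𝓔.contrConst) ^ 2)) : 𝓔.IsSmall r A := by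
  have := isSmall_of_cap_lt (div_pos hr 𝓔.contrConst_pos) h
  rwa [mul_div_cancel₀ _ 𝓔.contrConst_pos.ne'] at this

theorem cap_eq_zero_iff {A : Set E} : 𝓔.cap A = 0 ↔ 𝓔.IsPolar A := by
  constructor
  · intro h r hr
    refine isSmall_of_cap_lt' hr ?_
    rw [h, ENNReal.ofReal_pos]
    have := div_pos hr 𝓔.contrConst_pos
    positivity
  · intro h
    refine le_antisymm (le_of_forall_gt_imp_ge_of_dense fun ε hε => ?_) zero_le
    obtain ⟨r, hr, hrε⟩ := ENNReal.lt_iff_exists_real_btwn.mp hε |>.imp fun r h => h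
    have hr' : 0 < r := ENNReal.ofReal_pos.mp hrε.1
    refine ((h (√r) (Real.sqrt_pos.mpr hr')).cap_le).trans ?_
    rw [Real.sq_sqrt hr'.le]
    exact hrε.2.le

theorem quasiContinuous_iff {f : E → ℝ} : 𝓔.QuasiContinuous f ↔
    ∀ r : ℝ, 0 < r → ∃ G, IsOpen G ∧ 𝓔.IsSmall r G ∧ ContinuousOn f Gᶜ := by
  constructor
  · intro h r hr
    obtain ⟨G, hG, hcap, hc⟩ := h (ENNReal.ofReal ((r / 𝓔.contrConst) ^ 2)) (by
      have := div_pos hr 𝓔.contrConst_pos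
      rw [ENNReal.ofReal_pos]; positivity)
    exact ⟨G, hG, isSmall_of_cap_lt' hr hcap, hc⟩
  · intro h ε hε
    obtain ⟨r, hr, hrε⟩ := ENNReal.lt_iff_exists_real_btwn.mp hε |>.imp fun r h => h
    have hr' : 0 < r := ENNReal.ofReal_pos.mp hrε.1
    obtain ⟨G, hG, hs, hc⟩ := h (√r) (Real.sqrt_pos.mpr hr')
    refine ⟨G, hG, hs.cap_le.trans_lt ?_, hc⟩
    rw [Real.sq_sqrt hr'.le]
    exact hrε.2

theorem IsPolar.mono {A B : Set E} (h : 𝓔.IsPolar A) (hBA : B ⊆ A) : 𝓔.IsPolar B :=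
  fun r hr => (h r hr).mono hBA

theorem IsPolar.union {A B : Set E} (hA : 𝓔.IsPolar A) (hB : 𝓔.IsPolar B) :
    𝓔.IsPolar (A ∪ B) := fun r hr => by
  have := (hA (r / 2) (half_pos hr)).union (hB (r / 2) (half_pos hr))
  rwa [add_halves] at this

theorem summable_half_pow : Summable fun n : ℕ => (1 / 2 : ℝ) ^ n :=
  summable_geometric_of_lt_one (by norm_num) (by norm_num)

theorem IsPolar.iUnion {A : ℕ → Set E} (hA : ∀ n, 𝓔.IsPolar (A n)) :
    𝓔.IsPolar (⋃ n, A n) := fun r hr => by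
  have := IsSmall.iUnion ((summable_half_pow).mul_left (r / 2))
    fun n => hA n (r / 2 * (1 / 2) ^ n) (by positivity)
  rwa [tsum_mul_left, tsum_geometric_of_lt_one (by norm_num) (by norm_num),
    show r / 2 * (1 - 1 / 2)⁻¹ = r by ring] at this

theorem isPolar_empty : 𝓔.IsPolar (∅ : Set E) := fun r hr =>
  ⟨∅, isOpen_empty, Subset.rfl, 0, by
    rw [map_zero]; exact (Lp.coeFn_zero ℝ 2 μ).symm.le, by simp, by simpa using hr.le⟩

/-- Chebyshev's inequality in $L^2$, the form norm dominating the $L^2$ norm. -/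
theorem IsPolar.measure_eq_zero {A : Set E} (hA : 𝓔.IsPolar A) : μ A = 0 := by
  have key : ∀ r : ℝ, 0 < r → μ A ≤ ENNReal.ofReal r ^ 2 := fun r hr => by
    obtain ⟨G, hG, hAG, e, he1, he2, he3⟩ := hA r hr
    have h1 := mul_meas_ge_le_pow_eLpNorm' μ (p := 2) (by norm_num) (by norm_num)
      (Lp.aestronglyMeasurable (𝓔.incl e)) 1
    simp only [ENNReal.toReal_ofNat, one_pow, one_mul, ENNReal.rpow_ofNat] at h1
    have h2 : μ A ≤ μ {x | 1 ≤ ‖𝓔.incl e x‖ₑ} := by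
      refine measure_mono_ae ?_
      filter_upwards [he2] with x hx hxA
      have := hx (hAG hxA)
      change 1 ≤ ‖𝓔.incl e x‖ₑ
      rw [Real.enorm_eq_ofReal_abs, ← ENNReal.ofReal_one]
      exact ENNReal.ofReal_le_ofReal (this.trans (le_abs_self _))
    refine h2.trans (h1.trans ?_)
    gcongr
    rw [← ENNReal.ofReal_toReal (Lp.eLpNorm_ne_top (𝓔.incl e)), ← Lp.norm_def]
    exact ENNReal.ofReal_le_ofReal ((𝓔.norm_incl_le e).trans he3)
  refine le_antisymm (ge_of_tendsto (x := 𝓝[>] (0 : ℝ)) (f := fun r => ENNReal.ofReal r ^ 2) ?_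
    (eventually_mem_nhdsWithin.mono fun r hr => key r hr)) zero_le
  have : Continuous fun r : ℝ => ENNReal.ofReal r ^ 2 :=
    (ENNReal.continuous_pow 2).comp ENNReal.continuous_ofReal
  simpa using (this.tendsto 0).mono_left nhdsWithin_le_nhds

theorem QuasiContinuous.comp₂ {f g : E → ℝ} (hf : 𝓔.QuasiContinuous f)
    (hg : 𝓔.QuasiContinuous g) {F : ℝ → ℝ → ℝ} (hF : Continuous fun p : ℝ × ℝ => F p.1 p.2) :
    𝓔.QuasiContinuous fun x => F (f x) (g x) := by
  rw [quasiContinuous_iff] at *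
  intro r hr
  obtain ⟨G, hG, hs, hc⟩ := hf (r / 2) (half_pos hr)
  obtain ⟨G', hG', hs', hc'⟩ := hg (r / 2) (half_pos hr)
  refine ⟨G ∪ G', hG.union hG', by simpa using hs.union hs', ?_⟩
  rw [compl_union]
  exact hF.comp_continuousOn ((hc.mono inter_subset_left).prodMk (hc'.mono inter_subset_right))

theorem QuasiContinuous.of_continuous {f : E → ℝ} (hf : Continuous f) :
    𝓔.QuasiContinuous f := by
  rw [quasiContinuous_iff]
  exact fun r hr => ⟨∅, isOpen_empty, isPolar_empty r hr, hf.continuousOn⟩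

/-- The preimage is open only relative to $G^c$; adjoining $G$ restores openness. This supplies the
open neighbourhoods that the definition of capacity demands. -/
theorem exists_isOpen_union_eq {f : E → ℝ} {G : Set E} (hG : IsOpen G) (hf : ContinuousOn f Gᶜ)
    {O : Set E} (hO : IsOpen O) {U : Set ℝ} (hU : IsOpen U) :
    IsOpen ((O ∩ f ⁻¹' U) ∪ G) := by
  obtain ⟨V, hV, hVeq⟩ := continuousOn_iff'.mp hf U hU
  have : (O ∩ f ⁻¹' U) ∪ G = (O ∩ V) ∪ G := by
    ext x
    have := Set.ext_iff.mp hVeq x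
    simp only [mem_inter_iff, mem_compl_iff, mem_union] at *
    tauto
  rw [this]
  exact (hO.inter hV).union hG

/-- Chebyshev's inequality for the capacity. -/
theorem QuasiContinuous.isSmall_lt_abs {f : 𝓔.FormSpace} {f' : E → ℝ}
    (hf' : 𝓔.QuasiContinuous f') (hff' : f' =ᵐ[μ] 𝓔.incl f) {l r : ℝ} (hl : 0 < l)
    (hr : 0 < r) : 𝓔.IsSmall (2 * 𝓔.contrConst * ‖f‖ / l + r) {x | l < |f' x|} := by
  obtain ⟨G, hG, ⟨G₁, -, hGG₁, e, he1, he2, he3⟩, hc⟩ := quasiContinuous_iff.mp hf' r hr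
  -- $p$ and $q$ are the unit contractions of $f/l$ and $-f/l$: one of them equals $1$ a.e. where
  -- $|f'|>l$, while $e$ takes care of the set where $f'$ may fail to be continuous.
  obtain ⟨p, hp, hpn⟩ := 𝓔.exists_unitContraction (l⁻¹ • f)
  obtain ⟨q, hq, hqn⟩ := 𝓔.exists_unitContraction ((-l⁻¹) • f)
  refine ⟨(univ ∩ f' ⁻¹' {t | l < |t|}) ∪ G, exists_isOpen_union_eq hG hc isOpen_univ
    (isOpen_lt continuous_const continuous_abs), fun x hx => Or.inl ⟨mem_univ _, hx⟩,
    p + q + e, ?_, ?_, ?_⟩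
  · filter_upwards [hp, hq, he1, 𝓔.incl_add p q, 𝓔.incl_add (p + q) e] with x h1 h2 h3 h4 h5
    rw [h5, h4, h1, h2]
    simp only [Pi.zero_apply] at *
    positivity
  · filter_upwards [hp, hq, he1, he2, 𝓔.incl_add p q, 𝓔.incl_add (p + q) e, hff',
      𝓔.incl_smul l⁻¹ f, 𝓔.incl_smul (-l⁻¹) f] with x h1 h2 h3 h3' h4 h5 h6 h7 h8 hx
    rw [h5, h4, h1, h2, h7, h8, ← h6]
    simp only [Pi.zero_apply] at h3
    rcases hx with ⟨-, hx⟩ | hx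
    · simp only [mem_preimage, mem_ofPred_eq] at hx
      rcases lt_abs.mp hx with hx | hx
      · have h9 : 1 ≤ l⁻¹ * f' x := by
          rw [inv_mul_eq_div, one_le_div hl]; exact hx.le
        have : min (max (l⁻¹ * f' x) 0) 1 = 1 := min_eq_right (h9.trans (le_max_left _ _))
        rw [this]
        have : 0 ≤ min (max (-l⁻¹ * f' x) 0) 1 := by positivity
        linarith
      · have h9 : 1 ≤ -l⁻¹ * f' x := by
          rw [neg_mul, ← mul_neg, inv_mul_eq_div, one_le_div hl]; exact hx.le
        have : min (max (-l⁻¹ * f' x) 0) 1 = 1 := min_eq_right (h9.trans (le_max_left _ _))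
        rw [this]
        have : 0 ≤ min (max (l⁻¹ * f' x) 0) 1 := by positivity
        linarith
    · have := h3' (hGG₁ hx)
      have : 0 ≤ min (max (-l⁻¹ * f' x) 0) 1 := by positivity
      have : 0 ≤ min (max (l⁻¹ * f' x) 0) 1 := by positivity
      linarith
  · refine (norm_add₃_le).trans ?_
    rw [norm_smul, Real.norm_of_nonneg (by positivity)] at hpn
    rw [norm_smul, norm_neg, Real.norm_of_nonneg (by positivity)] at hqn
    have : 2 * 𝓔.contrConst * ‖f‖ / l
      = 𝓔.contrConst * (l⁻¹ * ‖f‖) + 𝓔.contrConst * (l⁻¹ * ‖f‖) := by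
      field_simp; ring
    rw [this]
    gcongr

/-- A quasi-continuous function that vanishes a.e. on an open set vanishes q.e. there. -/
theorem QuasiContinuous.isPolar_of_ae_eq_zero {f' : E → ℝ} (hf' : 𝓔.QuasiContinuous f')
    {O : Set E} (hO : IsOpen O) (h0 : ∀ᵐ x ∂μ, x ∈ O → f' x = 0) :
    𝓔.IsPolar {x | x ∈ O ∧ f' x ≠ 0} := by
  intro r hr
  obtain ⟨G, hG, ⟨G₁, -, hGG₁, e, he1, he2, he3⟩, hc⟩ := quasiContinuous_iff.mp hf' r hr
  refine ⟨(O ∩ f' ⁻¹' {0}ᶜ) ∪ G, exists_isOpen_union_eq hG hc hO isOpen_compl_singleton,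
    fun x hx => Or.inl hx, e, he1, ?_, he3⟩
  filter_upwards [he2, h0] with x h1 h2 hx
  rcases hx with hx | hx
  · exact absurd (h2 hx.1) hx.2
  · exact h1 (hGG₁ hx)

/-- Quasi-continuous versions converge q.e. along rapidly convergent sequences. -/
theorem exists_quasiContinuous_limit {f : ℕ → 𝓔.FormSpace} {f' : ℕ → E → ℝ}
    (hf' : ∀ n, 𝓔.QuasiContinuous (f' n)) (hff' : ∀ n, f' n =ᵐ[μ] 𝓔.incl (f n))
    {g : 𝓔.FormSpace} (hg : ∀ n, ‖f n - g‖ ≤ (1 / 8) ^ n) :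
    ∃ g' : E → ℝ, 𝓔.QuasiContinuous g' ∧ g' =ᵐ[μ] 𝓔.incl g ∧
      ∃ N, 𝓔.IsPolar N ∧ ∀ x ∉ N, Tendsto (fun n => f' n x) atTop (𝓝 (g' x)) := by
  -- Chebyshev at level $2^{-n}$ for a difference of norm at most $2\cdot8^{-n}$ costs
  -- $4\,$`contrConst`$\,\cdot4^{-n}$. The remaining $2\cdot4^{-n}$ pays for the error term $r$
  -- there and for `G n`.
  set c : ℝ := 4 * 𝓔.contrConst + 2 with hcdef
  have hc : 0 < c := by have := 𝓔.contrConst_pos; positivity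
  choose G hGo hGs hGc using fun n => quasiContinuous_iff.mp (hf' n) ((1 / 4) ^ n) (by positivity)
  let D : ℕ → Set E := fun n => {x | (1 / 2) ^ n < |f' (n + 1) x - f' n x|} ∪ G n
  have hD : ∀ n, 𝓔.IsSmall (c * (1 / 4) ^ n) (D n) := by
    intro n
    have hq : 𝓔.QuasiContinuous fun x => f' (n + 1) x - f' n x :=
      (hf' (n + 1)).comp₂ (hf' n) (F := fun a b => a - b) (by fun_prop)
    have hv : (fun x => f' (n + 1) x - f' n x) =ᵐ[μ] 𝓔.incl (f (n + 1) - f n) := by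
      filter_upwards [hff' (n + 1), hff' n, 𝓔.incl_sub (f (n + 1)) (f n)] with x h1 h2 h3
      rw [h1, h2, h3]
    have h1 := hq.isSmall_lt_abs hv (l := (1 / 2) ^ n) (r := (1 / 4) ^ n) (by positivity)
      (by positivity)
    refine (h1.union (hGs n)).mono_radius ?_
    have h2 : ‖f (n + 1) - f n‖ ≤ 2 * (1 / 8) ^ n := by
      have h3 : f (n + 1) - f n = (f (n + 1) - g) - (f n - g) := by abel
      rw [h3]
      refine (norm_sub_le _ _).trans ?_
      have h4 := hg (n + 1)
      have h5 := hg n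
      have h6 : (1 / 8 : ℝ) ^ (n + 1) ≤ (1 / 8) ^ n :=
        pow_le_pow_of_le_one (by norm_num) (by norm_num) (Nat.le_succ n)
      linarith
    have h7 : 2 * 𝓔.contrConst * ‖f (n + 1) - f n‖ / (1 / 2) ^ n
        ≤ 4 * 𝓔.contrConst * (1 / 4) ^ n := by
      rw [div_le_iff₀ (by positivity)]
      have h8 : (1 / 4 : ℝ) ^ n * (1 / 2) ^ n = (1 / 8) ^ n := by
        rw [← mul_pow]; norm_num
      rw [mul_assoc (4 * 𝓔.contrConst), h8]
      have := mul_le_mul_of_nonneg_left h2 (mul_nonneg zero_le_two 𝓔.contrConst_pos.le)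
      linarith
    rw [hcdef]
    linarith
  -- The factor $2$ is a rounded bound for the geometric sum $4/3$.
  have hT : ∀ k, 𝓔.IsSmall (c * (1 / 4) ^ k * 2) (⋃ n, D (n + k)) := by
    intro k
    have h1 : Summable fun n : ℕ => c * (1 / 4 : ℝ) ^ (n + k) := by
      refine Summable.mul_left c ?_
      simp_rw [pow_add]
      exact (summable_geometric_of_lt_one (by norm_num) (by norm_num)).mul_right _
    refine (IsSmall.iUnion h1 fun n => hD (n + k)).mono_radius ?_
    simp_rw [pow_add, ← mul_assoc]
    rw [tsum_mul_right, tsum_mul_left, tsum_geometric_of_lt_one (by norm_num) (by norm_num)]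
    have : 0 < c * (1 / 4 : ℝ) ^ k := by positivity
    linarith
  choose O hO hDO hOs using fun k => (hT k).exists_isOpen
  have hgeo : ∀ k, ∀ x ∉ O k, ∀ n,
      dist (f' (n + k) x) (f' (n + 1 + k) x) ≤ (1 / 2) ^ k * (1 / 2) ^ n := by
    intro k x hx n
    have h1 : x ∉ D (n + k) := fun h => hx (hDO k (mem_iUnion.mpr ⟨n, h⟩))
    have h2 : |f' (n + k + 1) x - f' (n + k) x| ≤ (1 / 2) ^ (n + k) :=
      not_lt.mp fun h => h1 (Or.inl h)
    rw [dist_comm, Real.dist_eq, ← pow_add, add_comm k n, show n + 1 + k = n + k + 1 by ring]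
    exact h2
  -- On the polar set $\bigcap_k O_k$ the limit may not exist, and `limUnder` then takes an
  -- irrelevant value. Off each $O_k$ the convergence is geometric, hence uniform.
  let g' : E → ℝ := fun x => limUnder atTop fun n => f' n x
  have hlim : ∀ k, ∀ x ∉ O k, Tendsto (fun n => f' n x) atTop (𝓝 (g' x)) := by
    intro k x hx
    obtain ⟨a, ha⟩ := cauchySeq_tendsto_of_complete
      (cauchySeq_of_le_geometric (1 / 2) ((1 / 2) ^ k) (by norm_num) (hgeo k x hx))
    exact tendsto_nhds_limUnder ⟨a, (tendsto_add_atTop_iff_nat k).mp ha⟩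
  have hpol : 𝓔.IsPolar (⋂ k, O k) := by
    intro r hr
    have h1 : Tendsto (fun k : ℕ => c * (1 / 4 : ℝ) ^ k * 2) atTop (𝓝 0) := by
      have := (tendsto_pow_atTop_nhds_zero_of_lt_one (r := (1 / 4 : ℝ)) (by norm_num)
        (by norm_num)).const_mul c |>.mul_const 2
      simpa using this
    obtain ⟨k, hk⟩ := (h1.eventually (gt_mem_nhds hr)).exists
    exact ((hOs k).mono (iInter_subset _ k)).mono_radius hk.le
  have hcontOn : ∀ k, ContinuousOn g' (O k)ᶜ := by
    intro k
    have hu : TendstoUniformlyOn (fun n x => f' (n + k) x) g' atTop (O k)ᶜ := by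
      rw [Metric.tendstoUniformlyOn_iff]
      intro ε hε
      have h1 : Tendsto (fun n : ℕ => (1 / 2 : ℝ) ^ k * (1 / 2) ^ n / (1 - 1 / 2)) atTop (𝓝 0) := by
        have := (tendsto_pow_atTop_nhds_zero_of_lt_one (r := (1 / 2 : ℝ)) (by norm_num)
          (by norm_num)).const_mul ((1 / 2 : ℝ) ^ k) |>.div_const (1 - 1 / 2)
        simpa using this
      filter_upwards [h1.eventually (gt_mem_nhds hε)] with n hn x hx
      rw [dist_comm]
      exact (dist_le_of_le_geometric_of_tendsto (1 / 2) ((1 / 2) ^ k) (by norm_num)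
        (hgeo k x hx) ((tendsto_add_atTop_iff_nat k).mpr (hlim k x hx)) n).trans_lt hn
    refine hu.continuousOn (Eventually.of_forall fun n => ?_).frequently
    refine (hGc (n + k)).mono (compl_subset_compl.mpr fun x hx => ?_)
    exact hDO k (mem_iUnion.mpr ⟨n, Or.inr hx⟩)
  have hlimN : ∀ x ∉ ⋂ k, O k, Tendsto (fun n => f' n x) atTop (𝓝 (g' x)) := by
    intro x hx
    obtain ⟨k, hk⟩ := not_forall.mp (fun h => hx (mem_iInter.mpr h))
    exact hlim k x hk
  refine ⟨g', ?_, ?_, ⋂ k, O k, hpol, hlimN⟩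
  · rw [quasiContinuous_iff]
    intro r hr
    have h1 : Tendsto (fun k : ℕ => c * (1 / 4 : ℝ) ^ k * 2) atTop (𝓝 0) := by
      have := (tendsto_pow_atTop_nhds_zero_of_lt_one (r := (1 / 4 : ℝ)) (by norm_num)
        (by norm_num)).const_mul c |>.mul_const 2
      simpa using this
    obtain ⟨k, hk⟩ := (h1.eventually (gt_mem_nhds hr)).exists
    exact ⟨O k, hO k, (hOs k).mono_radius hk.le, hcontOn k⟩
  · have hfg : Tendsto f atTop (𝓝 g) := by
      rw [tendsto_iff_norm_sub_tendsto_zero]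
      exact squeeze_zero (fun n => norm_nonneg _) hg
        (tendsto_pow_atTop_nhds_zero_of_lt_one (by norm_num) (by norm_num))
    refine (ae_eq_of_tendsto_lp ((𝓔.incl.continuous.tendsto g).comp hfg) ?_).symm
    have hN : ∀ᵐ x ∂μ, x ∉ ⋂ k, O k := measure_eq_zero_iff_ae_notMem.mp hpol.measure_eq_zero
    filter_upwards [hN, ae_all_iff.mpr hff'] with x hx h1
    exact (hlimN x hx).congr h1

end Capacity

end LowerBoundedSemiDirichletForm

/-! ### The part of the form on $\Omega$ and spectral synthesis -/

namespace LowerBoundedSemiDirichletForm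

section Part

variable {E : Type*} [TopologicalSpace E] [MeasurableSpace E] {μ : Measure E}
  (𝓔 : LowerBoundedSemiDirichletForm μ)

/-- The part `𝓕^Ω` of the form domain as a subspace of the Hilbert space. -/
def partSub (Ω : Set E) : Submodule ℝ 𝓔.FormSpace where
  carrier := {f | ∃ f' : E → ℝ, f' =ᵐ[μ] 𝓔.incl f ∧ 𝓔.QuasiContinuous f' ∧
    𝓔.IsPolar {x | x ∈ Ωᶜ ∧ f' x ≠ 0}}
  add_mem' := by
    rintro f g ⟨f', h1, h2, h3⟩ ⟨g', k1, k2, k3⟩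
    refine ⟨fun x => f' x + g' x, ?_, h2.comp₂ k2 (F := fun a b => a + b) (by fun_prop),
      (h3.union k3).mono ?_⟩
    · filter_upwards [h1, k1, 𝓔.incl_add f g] with x e1 e2 e3
      rw [e1, e2, e3]
    · rintro x ⟨hx, hne⟩
      by_contra hcon
      simp only [mem_union, mem_ofPred_eq, hx, true_and, not_or, not_not] at hcon
      exact hne (by simp [hcon.1, hcon.2])
  zero_mem' := ⟨fun _ => 0, by rw [map_zero]; exact (Lp.coeFn_zero ℝ 2 μ).symm,
    QuasiContinuous.of_continuous continuous_const, isPolar_empty.mono (by simp)⟩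
  smul_mem' := by
    rintro c f ⟨f', h1, h2, h3⟩
    refine ⟨fun x => c * f' x, ?_, h2.comp₂ h2 (F := fun a _ => c * a) (by fun_prop),
      h3.mono ?_⟩
    · filter_upwards [h1, 𝓔.incl_smul c f] with x e1 e2
      rw [e1, e2]
    · rintro x ⟨hx, hne⟩
      exact ⟨hx, fun h => hne (by simp [h])⟩

variable {𝓔}

theorem mem_partSub_iff {Ω : Set E} {f : 𝓔.FormSpace} :
    f ∈ 𝓔.partSub Ω ↔ 𝓔.toDom f ∈ 𝓔.partDom Ω := by
  simp only [partDom, mem_ofPred_eq, cap_eq_zero_iff]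
  exact Iff.rfl

theorem exists_seq_of_mem_closure {S : Set 𝓔.FormSpace} {g : 𝓔.FormSpace} (hg : g ∈ closure S) :
    ∃ f : ℕ → 𝓔.FormSpace, (∀ n, f n ∈ S) ∧ ∀ n, ‖f n - g‖ ≤ (1 / 8) ^ n := by
  rw [Metric.mem_closure_iff] at hg
  choose f hf hd using fun n : ℕ => hg ((1 / 8) ^ n) (by positivity)
  exact ⟨f, hf, fun n => by rw [← dist_eq_norm, dist_comm]; exact (hd n).le⟩

/-- Points of the closure are approached at rate $8^{-n}$, so versions converge q.e. and the value
$0$ on $\Omega^c$ survives outside a countable union of polar sets. -/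
theorem isClosed_partSub (Ω : Set E) : IsClosed (𝓔.partSub Ω : Set 𝓔.FormSpace) := by
  refine isClosed_of_closure_subset fun g hg => ?_
  obtain ⟨f, hf, hd⟩ := exists_seq_of_mem_closure hg
  choose f' h1 h2 h3 using hf
  obtain ⟨g', hq, hv, N, hN, hlim⟩ := exists_quasiContinuous_limit h2 h1 hd
  refine ⟨g', hv, hq, (hN.union (IsPolar.iUnion h3)).mono ?_⟩
  rintro x ⟨hx, hne⟩
  by_contra hcon
  simp only [mem_union, mem_iUnion, mem_ofPred_eq, hx, true_and, not_or, not_exists,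
    not_not] at hcon
  refine hne (tendsto_nhds_unique (hlim x hcon.1) ?_)
  simp_rw [hcon.2]
  exact tendsto_const_nhds

theorem IsRegular.exists_core_seq (h𝓔 : 𝓔.IsRegular) (f : 𝓔.FormSpace) :
    ∃ (φ : ℕ → E → ℝ) (g : ℕ → 𝓔.FormSpace), (∀ n, Continuous (φ n)) ∧
      (∀ n, HasCompactSupport (φ n)) ∧ (∀ n, φ n =ᵐ[μ] 𝓔.incl (g n)) ∧
      ∀ n, ‖g n - f‖ ≤ (1 / 8) ^ n := by
  choose φ hφ g hg hlt using fun n : ℕ => h𝓔.2 (𝓔.β₀ + 1) (by linarith) (𝓔.toDom f)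
    (((1 / 8) ^ n) ^ 2) (by positivity)
  refine ⟨φ, fun n => 𝓔.toDom.symm (g n), fun n => (hφ n).1, fun n => (hφ n).2.1, fun n => ?_,
    fun n => ?_⟩
  · rw [incl_apply, LinearEquiv.apply_symm_apply]
    exact (hg n).symm
  · have h1 := hlt n
    rw [← LinearEquiv.apply_symm_apply 𝓔.toDom (g n), ← map_sub, ← FormSpace.norm_sq] at h1
    rw [norm_sub_rev]
    exact (lt_of_pow_lt_pow_left₀ 2 (by positivity) h1).le

theorem IsRegular.exists_quasiContinuous_version (h𝓔 : 𝓔.IsRegular) (f : 𝓔.FormSpace) :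
    ∃ f' : E → ℝ, 𝓔.QuasiContinuous f' ∧ f' =ᵐ[μ] 𝓔.incl f := by
  obtain ⟨φ, g, hc, -, hv, hd⟩ := h𝓔.exists_core_seq f
  obtain ⟨f', h1, h2, -⟩ := exists_quasiContinuous_limit
    (fun n => QuasiContinuous.of_continuous (hc n)) hv hd
  exact ⟨f', h1, h2⟩

variable (𝓔) in
/-- The elements of the form domain that vanish a.e. on a given set. -/
def vanishing (A : Set E) : Set 𝓔.FormSpace := {f | ∀ᵐ x ∂μ, x ∈ A → 𝓔.incl f x = 0}

/-- On an open set, vanishing a.e. upgrades to vanishing q.e. This is how functions known only a.e.,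
such as occupation integrals, are recognized as elements of $\mathcal F^\Omega$. -/
theorem IsRegular.mem_partSub_of_vanishing (h𝓔 : 𝓔.IsRegular) {Ω O : Set E} (hO : IsOpen O)
    (hΩO : Ωᶜ ⊆ O) {f : 𝓔.FormSpace} (hf : f ∈ 𝓔.vanishing O) : f ∈ 𝓔.partSub Ω := by
  obtain ⟨f', h1, h2⟩ := h𝓔.exists_quasiContinuous_version f
  refine ⟨f', h2, h1, (h1.isPolar_of_ae_eq_zero hO ?_).mono fun x hx => ⟨hΩO hx.1, hx.2⟩⟩
  filter_upwards [h2, hf] with x e1 e2 hx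
  rw [e1, e2 hx]

theorem posPart_eq_self {f : Lp ℝ 2 μ} (hf : 0 ≤ᵐ[μ] f) : Lp.posPart f = f := by
  refine Lp.ext ?_
  filter_upwards [hf, Lp.coeFn_posPart f] with x h1 h2
  rw [h2]; exact max_eq_left h1

section Density

variable {Ω : Set E} {D : Submodule ℝ 𝓔.FormSpace}

/-- Approximate $f$ by $h_n=(f-f\wedge l_n-Me_n)^+$, where $l_n\to0$ and $e_n\ge1$ a.e. on an open
$O_n$ containing the set of possible discontinuities $G_n$ and the exceptional part of $\Omega^c$.
Then $h_n$ vanishes a.e. on $O_n$ and where $f'<l_n$, so it lives on the compact set $\{f'\ge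
l_n\}\setminus O_n\subseteq\Omega$. Bounded norms and $L^2$ convergence give weak convergence to
$f$. -/
theorem mem_of_bounded_of_compactSupport (hD : IsClosed (D : Set 𝓔.FormSpace))
    (hKD : ∀ K : Set E, IsCompact K → K ⊆ Ω → 𝓔.vanishing Kᶜ ⊆ D) {f : 𝓔.FormSpace} {f' : E → ℝ}
    (hff' : f' =ᵐ[μ] 𝓔.incl f) (hf' : 𝓔.QuasiContinuous f')
    (hpol : 𝓔.IsPolar {x | x ∈ Ωᶜ ∧ f' x ≠ 0}) (h0 : ∀ x, 0 ≤ f' x) {M : ℝ} (hM : ∀ x, f' x ≤ M)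
    {K₀ : Set E} (hK₀ : IsCompact K₀) (hfK : ∀ x ∉ K₀, f' x = 0) : f ∈ D := by
  rcases isEmpty_or_nonempty E with hE | ⟨⟨x₀⟩⟩
  · have : f = 0 := 𝓔.incl_injective (Lp.ext (Eventually.of_forall fun x => (hE.false x).elim))
    rw [this]; exact D.zero_mem
  have hM0 : 0 ≤ M := (h0 x₀).trans (hM x₀)
  let l : ℕ → ℝ := fun n => 1 / ((n : ℝ) + 1)
  have hl : ∀ n, 0 < l n := fun n => by positivity
  have hl1 : ∀ n, l n ≤ 1 := fun n => by
    rw [div_le_one (by positivity)]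
    have : (0 : ℝ) ≤ n := n.cast_nonneg
    linarith
  have hl0 : Tendsto l atTop (𝓝 0) := tendsto_one_div_add_atTop_nhds_zero_nat
  choose G hGo hGs hGc using fun n => quasiContinuous_iff.mp hf' (l n) (hl n)
  choose O hOo hsub e he1 he2 he3 using fun n => (hGs n).union (hpol (l n) (hl n))
  choose t ht htn using fun n => 𝓔.exists_truncation f (hl n)
  choose h hh hhn using fun n => 𝓔.exists_posPart (f - t n - M • e n)
  have hlt : Tendsto (fun n => 𝓔.incl (t n)) atTop (𝓝 0) := by
    obtain ⟨y, hy, hlim⟩ := exists_lp_limit_of_dominated (f := fun n => 𝓔.incl (t n))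
      (g := 𝓔.incl f) (v := fun _ => 0)
      (fun n => by
        filter_upwards [ht n, hff'] with x e1 e2
        have hx : 0 ≤ 𝓔.incl f x := e2 ▸ h0 x
        rw [e1, max_eq_left hx, abs_of_nonneg (le_min hx (hl n).le)]
        exact min_le_left _ _)
      (by
        filter_upwards [ae_all_iff.mpr ht] with x e1
        simp_rw [e1]
        exact squeeze_zero (fun n => le_min (le_max_right _ _) (hl n).le)
          (fun n => min_le_right _ _) hl0)
    have : y = 0 := Lp.ext (hy.trans (Lp.coeFn_zero ℝ 2 μ).symm)
    rwa [this] at hlim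
  have hle : Tendsto (fun n => 𝓔.incl (e n)) atTop (𝓝 0) := by
    refine squeeze_zero_norm (fun n => (𝓔.norm_incl_le _).trans (he3 n)) ?_
    simpa using hl0.add hl0
  have hlim : Tendsto (fun n => 𝓔.incl (h n)) atTop (𝓝 (𝓔.incl f)) := by
    have h1 : Tendsto (fun n => 𝓔.incl (f - t n - M • e n)) atTop (𝓝 (𝓔.incl f)) := by
      simp_rw [map_sub, map_smul]
      simpa using (tendsto_const_nhds (x := 𝓔.incl f)).sub hlt |>.sub (hle.const_smul M)
    have h2 := ((Lp.continuous_posPart (μ := μ) (p := 2)).tendsto _).comp h1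
    rw [posPart_eq_self (f := 𝓔.incl f) (by
      filter_upwards [hff'] with x e2
      rw [← e2]; exact h0 x)] at h2
    exact h2.congr fun n => (hh n).symm
  obtain ⟨z, hz, -, hw⟩ := exists_weak_limit 𝓔.incl 𝓔.incl_injective h
    (M := 𝓔.contrConst * (‖f‖ + 𝓔.contrConst * ‖f‖ + M * 2)) (fun n => by
      refine (hhn n).trans (mul_le_mul_of_nonneg_left ?_ 𝓔.contrConst_pos.le)
      refine (norm_sub_le _ _).trans (add_le_add ((norm_sub_le _ _).trans
        (add_le_add_right (htn n) _)) ?_)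
      rw [norm_smul, Real.norm_of_nonneg hM0]
      refine mul_le_mul_of_nonneg_left ((he3 n).trans ?_) hM0
      linarith [hl1 n]) hlim
  rw [← 𝓔.incl_injective hz]
  refine mem_of_weak_limit hD (fun n => ?_) hw
  -- The factor $(G_n)^c$ is redundant as a set, since $G_n\subseteq O_n$, but it is where $f'$ is
  -- continuous and the superlevel set therefore closed.
  refine hKD ((G n)ᶜ ∩ f' ⁻¹' Ici (l n) ∩ (O n)ᶜ) ?_ ?_ ?_
  · refine hK₀.of_isClosed_subset
      (((hGc n).preimage_isClosed_of_isClosed (hGo n).isClosed_compl isClosed_Ici).inter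
        (hOo n).isClosed_compl) fun x hx => ?_
    by_contra hcon
    have h1 : l n ≤ f' x := hx.1.2
    rw [hfK x hcon] at h1
    exact (hl n).not_ge h1
  · rintro x ⟨⟨-, h1⟩, h2⟩
    by_contra hcon
    refine h2 (hsub n (Or.inr ⟨hcon, ?_⟩))
    exact ((hl n).trans_le h1).ne'
  · filter_upwards [Lp.coeFn_posPart (𝓔.incl (f - t n - M • e n)), 𝓔.incl_sub (f - t n) (M • e n),
      𝓔.incl_sub f (t n), 𝓔.incl_smul M (e n), ht n, he1 n, he2 n, hff'] with
      x e1 e2 e3 e4 e5 e6 e7 e8 hx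
    rw [hh n, e1, e2, e3, e4, e5, ← e8, max_eq_left (h0 x)]
    simp only [Pi.zero_apply] at e6
    refine max_eq_right ?_
    by_cases hxO : x ∈ O n
    · have h1 := mul_le_mul_of_nonneg_left (e7 hxO) hM0
      have h2 : 0 ≤ min (f' x) (l n) := le_min (h0 x) (hl n).le
      linarith [hM x]
    · have h1 : f' x < l n := by
        by_contra hcon
        refine hx ⟨⟨fun hG => hxO (hsub n (Or.inl hG)), not_lt.mp hcon⟩, hxO⟩
      rw [min_eq_left h1.le]
      have := mul_nonneg hM0 e6
      linarith

/-- Let core functions $\varphi_n$ approximate $f$. Then $\varphi_n^+\wedge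
f=\varphi_n^+-(\varphi_n^+-f)^+$ is bounded with compact support and, lying below $f$, vanishes q.e.
off $\Omega$. Norms stay bounded, so these functions converge weakly to $f$. -/
theorem IsRegular.mem_of_nonneg (h𝓔 : 𝓔.IsRegular) (hD : IsClosed (D : Set 𝓔.FormSpace))
    (hKD : ∀ K : Set E, IsCompact K → K ⊆ Ω → 𝓔.vanishing Kᶜ ⊆ D) {f : 𝓔.FormSpace}
    (hf : f ∈ 𝓔.partSub Ω) (h0 : 0 ≤ᵐ[μ] 𝓔.incl f) : f ∈ D := by
  obtain ⟨f', hff', hf', hpol⟩ := hf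
  obtain ⟨φ, g, hφc, hφs, hφg, hd⟩ := h𝓔.exists_core_seq f
  choose p hp hpn using fun n => 𝓔.exists_posPart (g n)
  choose k hk hkn using fun n => 𝓔.exists_posPart (p n - f)
  have hgn : ∀ n, ‖g n‖ ≤ ‖f‖ + 1 := fun n => by
    have h1 : g n = f + (g n - f) := by abel
    rw [h1]
    refine (norm_add_le _ _).trans (add_le_add_right ((hd n).trans ?_) _)
    exact pow_le_one₀ (by norm_num) (by norm_num)
  have hpn' : ∀ n, ‖p n‖ ≤ 𝓔.contrConst * (‖f‖ + 1) := fun n =>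
    (hpn n).trans (mul_le_mul_of_nonneg_left (hgn n) 𝓔.contrConst_pos.le)
  have hg : Tendsto (fun n => 𝓔.incl (g n)) atTop (𝓝 (𝓔.incl f)) := by
    refine (𝓔.incl.continuous.tendsto f).comp ?_
    rw [tendsto_iff_norm_sub_tendsto_zero]
    exact squeeze_zero (fun n => norm_nonneg _) hd
      (tendsto_pow_atTop_nhds_zero_of_lt_one (by norm_num) (by norm_num))
  have hpl : Tendsto (fun n => 𝓔.incl (p n)) atTop (𝓝 (𝓔.incl f)) := by
    have h2 := ((Lp.continuous_posPart (μ := μ) (p := 2)).tendsto _).comp hg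
    rw [posPart_eq_self h0] at h2
    exact h2.congr fun n => (hp n).symm
  have hkl : Tendsto (fun n => 𝓔.incl (k n)) atTop (𝓝 0) := by
    have h1 : Tendsto (fun n => 𝓔.incl (p n - f)) atTop (𝓝 0) := by
      simp_rw [map_sub]
      simpa using hpl.sub_const (𝓔.incl f)
    have h2 := ((Lp.continuous_posPart (μ := μ) (p := 2)).tendsto _).comp h1
    rw [posPart_eq_self (f := (0 : Lp ℝ 2 μ)) (Lp.coeFn_zero ℝ 2 μ).symm.le] at h2
    exact h2.congr fun n => (hk n).symm
  have hlim : Tendsto (fun n => 𝓔.incl (p n - k n)) atTop (𝓝 (𝓔.incl f)) := by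
    simp_rw [map_sub]
    simpa using hpl.sub hkl
  obtain ⟨z, hz, -, hw⟩ := exists_weak_limit 𝓔.incl 𝓔.incl_injective (fun n => p n - k n)
    (M := 𝓔.contrConst * (‖f‖ + 1) + 𝓔.contrConst * (𝓔.contrConst * (‖f‖ + 1) + ‖f‖))
    (fun n => (norm_sub_le _ _).trans (add_le_add (hpn' n) ((hkn n).trans
      (mul_le_mul_of_nonneg_left ((norm_sub_le _ _).trans (add_le_add_left (hpn' n) _))
        𝓔.contrConst_pos.le)))) hlim
  rw [← 𝓔.incl_injective hz]
  refine mem_of_weak_limit hD (fun n => ?_) hw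
  obtain ⟨C, hC⟩ := (hφc n).bounded_above_of_compact_support (hφs n)
  refine mem_of_bounded_of_compactSupport hD hKD (M := C) (K₀ := tsupport (φ n))
    (f' := fun x => min (max (φ n x) 0) (max (f' x) 0)) ?_ ?_ (hpol.mono ?_) ?_ ?_ (hφs n) ?_
  · filter_upwards [hφg n, hff', 𝓔.incl_sub (p n) (k n), 𝓔.incl_sub (p n) f,
      Lp.coeFn_posPart (𝓔.incl (g n)), Lp.coeFn_posPart (𝓔.incl (p n - f)), h0] with
      x e1 e2 e3 e4 e5 e6 e7
    simp only [Pi.zero_apply] at e7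
    rw [e3, hk n, e6, e4, hp n, e5, e1, e2, max_eq_left e7]
    rcases le_total (max (𝓔.incl (g n) x) 0) (𝓔.incl f x) with h | h
    · rw [min_eq_left h, max_eq_right (sub_nonpos.mpr h), sub_zero]
    · rw [min_eq_right h, max_eq_left (sub_nonneg.mpr h), sub_sub_cancel]
  · exact (QuasiContinuous.of_continuous (hφc n)).comp₂ hf'
      (F := fun a b => min (max a 0) (max b 0)) (by fun_prop)
  · rintro x ⟨hx, hne⟩
    refine ⟨hx, fun h => hne ?_⟩
    rw [h, max_self, min_eq_right (le_max_right _ _)]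
  · exact fun x => le_min (le_max_right _ _) (le_max_right _ _)
  · exact fun x => (min_le_left _ _).trans
      (max_le ((le_abs_self _).trans (hC x)) ((norm_nonneg _).trans (hC x)))
  · intro x hx
    simp only [image_eq_zero_of_notMem_tsupport hx, max_self]
    exact min_eq_left (le_max_right _ _)

/-- Spectral synthesis: a closed subspace containing the elements with compact support in `Ω`
contains the part of the form domain on `Ω`. -/
theorem IsRegular.partSub_le (h𝓔 : 𝓔.IsRegular) (hD : IsClosed (D : Set 𝓔.FormSpace))
    (hKD : ∀ K : Set E, IsCompact K → K ⊆ Ω → 𝓔.vanishing Kᶜ ⊆ D) : 𝓔.partSub Ω ≤ D := by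
  have key : ∀ f ∈ 𝓔.partSub Ω, ∃ p ∈ D, 𝓔.incl p = Lp.posPart (𝓔.incl f) := by
    rintro f ⟨f', hff', hf', hpol⟩
    obtain ⟨p, hp, -⟩ := 𝓔.exists_posPart f
    refine ⟨p, h𝓔.mem_of_nonneg hD hKD ⟨fun x => max (f' x) 0, ?_, ?_, hpol.mono ?_⟩ ?_, hp⟩
    · filter_upwards [hff', Lp.coeFn_posPart (𝓔.incl f)] with x e1 e2
      rw [hp, e2, e1]
    · exact hf'.comp₂ hf' (F := fun a _ => max a 0) (by fun_prop)
    · rintro x ⟨hx, hne⟩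
      exact ⟨hx, fun h => hne (by simp [h])⟩
    · filter_upwards [Lp.coeFn_posPart (𝓔.incl f)] with x e2
      rw [hp, e2]
      exact le_max_right _ _
  intro f hf
  obtain ⟨p, hp, hp'⟩ := key f hf
  obtain ⟨q, hq, hq'⟩ := key (-f) ((𝓔.partSub Ω).neg_mem hf)
  have : f = p - q := by
    refine 𝓔.incl_injective (Lp.ext ?_)
    filter_upwards [𝓔.incl_sub p q, Lp.coeFn_posPart (𝓔.incl f), Lp.coeFn_posPart (𝓔.incl (-f)),
      𝓔.incl_smul (-1) f] with x e1 e2 e3 e4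
    rw [neg_one_smul] at e4
    rw [e1, hp', hq', e2, e3, e4]
    rcases le_total (𝓔.incl f x) 0 with h | h
    · rw [max_eq_right h, max_eq_left (by linarith)]; ring
    · rw [max_eq_left h, max_eq_right (by linarith)]; ring
  rw [this]
  exact D.sub_mem hp hq

end Density

end Part

end LowerBoundedSemiDirichletForm

/-! ### The saddle point identity -/

section Variational

variable {H : Type*} [NormedAddCommGroup H] [InnerProductSpace ℝ H] [CompleteSpace H]

/-- The saddle point identity for the capacity-like quantity `1 / ℓ u`. -/
theorem extendedRecip_eq_iInf_iSup (B : H →L[ℝ] H →L[ℝ] ℝ) {c : ℝ} (hc : 0 < c)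
    (hB : ∀ f, c * ‖f‖ ^ 2 ≤ B f f) (W : Submodule ℝ H) (hW : IsClosed (W : Set H))
    (ℓ : H →L[ℝ] ℝ) {u : H} (huW : u ∈ W) (hu : ∀ g ∈ W, B u g = ℓ g) :
    extendedRecip (ℓ u) = (⨅ f ∈ {f | f ∈ W ∧ ℓ f = 1}, ⨆ g ∈ {g | g ∈ W ∧ ℓ g = 0},
      ((B (f + g) (f - g) : ℝ) : EReal)) ∧
    ((∀ f g, B f g = B g f) →
      extendedRecip (ℓ u) = ⨅ f ∈ {f | f ∈ W ∧ ℓ f = 1}, ((B f f : ℝ) : EReal)) := by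
  have hnn : ∀ f, 0 ≤ B f f := fun f => (by positivity : 0 ≤ c * ‖f‖ ^ 2).trans (hB f)
  -- In the degenerate case coercivity forces $u=0$, so $\ell$ vanishes on $W$: no $f$ satisfies
  -- $\ell f=1$, and both infima are empty.
  by_cases ha : ℓ u = 0
  · have hu0 : u = 0 := by
      have h1 := hB u
      rw [hu u huW, ha] at h1
      have h2 : ‖u‖ ^ 2 ≤ 0 := by
        by_contra h
        have := mul_pos hc (not_le.mp h)
        linarith
      exact norm_eq_zero.mp (pow_eq_zero_iff two_ne_zero |>.mp (le_antisymm h2 (sq_nonneg _)))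
    have hempty : ∀ f, f ∉ {f | f ∈ W ∧ ℓ f = 1} := by
      rintro f ⟨hf, h1⟩
      have := hu f hf
      rw [hu0, map_zero, zero_apply, h1] at this
      exact zero_ne_one this
    have hr : extendedRecip (ℓ u) = ⊤ := if_pos ha
    rw [hr]
    constructor
    · exact (iInf₂_eq_top.mpr fun f hf => (hempty f hf).elim).symm
    · intro _
      exact (iInf₂_eq_top.mpr fun f hf => (hempty f hf).elim).symm
  · have hr : extendedRecip (ℓ u) = ((1 / ℓ u : ℝ) : EReal) := if_neg ha
    rw [hr]
    -- $v$ solves the adjoint problem $B(g,v)=\ell g$; testing each equation with the other solution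
    -- gives $\ell v=\ell u$.
    obtain ⟨v, ⟨hvW, hv⟩, -⟩ := existsUnique_of_coercive B.flip hc hB W hW ℓ
    simp only [ContinuousLinearMap.flip_apply] at hv
    have hvu : ℓ v = ℓ u := by rw [← hu v hvW, hv u huW]
    set a := ℓ u with hadef
    constructor
    · refine le_antisymm (le_iInf₂ fun f hf => ?_) ?_
      · obtain ⟨hfW, hf1⟩ := hf
        -- This $g$ makes $f+g=u/a$ and $f-g=2f-u/a$, with value $2/a-1/a$.
        refine le_iSup₂_of_le (a⁻¹ • u - f) ⟨W.sub_mem (W.smul_mem _ huW) hfW, ?_⟩ ?_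
        · rw [map_sub, map_smul, hf1, ← hadef, smul_eq_mul, inv_mul_cancel₀ ha, sub_self]
        · rw [EReal.coe_le_coe_iff]
          rw [add_sub_cancel, show f - (a⁻¹ • u - f) = (2 : ℝ) • f - a⁻¹ • u by
            rw [two_smul]; abel]
          simp only [map_smul, map_sub, smul_apply, smul_eq_mul]
          rw [hu f hfW, hu u huW, hf1, ← hadef]
          field_simp
          norm_num
      · refine iInf₂_le_of_le ((2 * a)⁻¹ • (u + v)) ⟨W.smul_mem _ (W.add_mem huW hvW), ?_⟩ ?_
        · rw [map_smul, map_add, hvu, ← hadef, smul_eq_mul]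
          field_simp
          ring
        · refine iSup₂_le fun g hg => ?_
          obtain ⟨hgW, hg0⟩ := hg
          rw [EReal.coe_le_coe_iff]
          -- Completing the square: the terms linear in $g$ cancel because $\ell g=0$, and what is
          -- left below $1/a$ is this nonnegative quantity.
          have hk := hnn (g - (2 * a)⁻¹ • (u - v))
          have key : B ((2 * a)⁻¹ • (u + v) + g) ((2 * a)⁻¹ • (u + v) - g)
              + B (g - (2 * a)⁻¹ • (u - v)) (g - (2 * a)⁻¹ • (u - v)) = 1 / a := by
            simp only [map_smul, map_sub, map_add, sub_apply, add_apply, smul_apply, smul_eq_mul]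
            rw [hu g hgW, hv g hgW, hg0, hu u huW, hu v hvW, hv v hvW, hvu, ← hadef]
            field_simp
            ring
          linarith
    · intro hsymm
      refine le_antisymm (le_iInf₂ fun f hf => ?_) ?_
      · obtain ⟨hfW, hf1⟩ := hf
        rw [EReal.coe_le_coe_iff]
        -- By symmetry $B(f-u/a,f-u/a)=B(f,f)-1/a$ whenever $\ell f=1$.
        have hk := hnn (f - a⁻¹ • u)
        simp only [map_smul, map_sub, sub_apply, smul_apply, smul_eq_mul] at hk
        rw [hsymm f u, hu f hfW, hf1, hu u huW, ← hadef] at hk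
        have : a⁻¹ * a = 1 := inv_mul_cancel₀ ha
        rw [this] at hk
        rw [one_div]
        linarith
      · refine iInf₂_le_of_le (a⁻¹ • u) ⟨W.smul_mem _ huW, ?_⟩ ?_
        · rw [map_smul, ← hadef, smul_eq_mul, inv_mul_cancel₀ ha]
        · rw [EReal.coe_le_coe_iff]
          simp only [map_smul, smul_apply, smul_eq_mul]
          rw [hu u huW, ← hadef]
          field_simp
          exact le_rfl

end Variational

theorem MeasureTheory.Lp.inner_eq_integral {E : Type*} [MeasurableSpace E] {μ : Measure E}
    (h f : Lp ℝ 2 μ) : inner ℝ h f = ∫ x, h x * f x ∂μ := by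
  rw [L2.inner_def]
  refine integral_congr_ae (Eventually.of_forall fun x => ?_)
  simp [mul_comm]

/-! ### Weak solutions in Hilbert space terms -/

namespace LowerBoundedSemiDirichletForm

variable {E : Type*} [TopologicalSpace E] [MeasurableSpace E] {μ : Measure E}
  {𝓔 : LowerBoundedSemiDirichletForm μ}

variable (𝓔) in
/-- The functional `f ↦ ⟨h, f⟩` on the form domain. -/
noncomputable def innerFunctional (h : Lp ℝ 2 μ) : 𝓔.FormSpace →L[ℝ] ℝ :=
  (innerSL ℝ h).comp 𝓔.incl

theorem innerFunctional_apply (h : Lp ℝ 2 μ) (f : 𝓔.FormSpace) :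
    𝓔.innerFunctional h f = inner ℝ h (𝓔.incl f) := rfl

theorem pairing_eq_innerFunctional {Ω : Set E} (hΩ : MeasurableSet Ω) {ξ : E → ℝ}
    {h : Lp ℝ 2 μ} (hh : h =ᵐ[μ] Ω.indicator ξ) (f : 𝓔.FormSpace) :
    𝓔.pairing Ω ξ (𝓔.toDom f) = 𝓔.innerFunctional h f := by
  rw [innerFunctional_apply, Lp.inner_eq_integral, pairing, ← integral_indicator hΩ]
  refine integral_congr_ae ?_
  filter_upwards [hh] with x hx
  rw [hx, indicator_mul_left]
  rfl

theorem isWeakSolution_toDom_iff {Ω : Set E} (hΩ : MeasurableSet Ω) {β : ℝ} {ξ : E → ℝ}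
    {h : Lp ℝ 2 μ} (hh : h =ᵐ[μ] Ω.indicator ξ) {u : 𝓔.FormSpace} :
    𝓔.IsWeakSolution Ω β ξ (𝓔.toDom u) ↔
      u ∈ 𝓔.partSub Ω ∧ ∀ g ∈ 𝓔.partSub Ω, 𝓔.shiftedL β u g = 𝓔.innerFunctional h g := by
  rw [IsWeakSolution, mem_partSub_iff]
  refine and_congr_right fun _ => ⟨fun H g hg => ?_, fun H f hf => ?_⟩
  · rw [← pairing_eq_innerFunctional hΩ hh]
    exact H _ (mem_partSub_iff.mp hg)
  · obtain ⟨f, rfl⟩ := 𝓔.toDom.surjective f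
    rw [pairing_eq_innerFunctional hΩ hh]
    exact H _ (mem_partSub_iff.mpr hf)

theorem existsUnique_isWeakSolution {Ω : Set E} (hΩ : MeasurableSet Ω) {β : ℝ} (hβ : 𝓔.β₀ < β)
    {ξ : E → ℝ} {h : Lp ℝ 2 μ} (hh : h =ᵐ[μ] Ω.indicator ξ) :
    ∃! u : 𝓔.dom, 𝓔.IsWeakSolution Ω β ξ u := by
  obtain ⟨u, hu, huniq⟩ := existsUnique_of_coercive (𝓔.shiftedL β) (𝓔.coerc_pos hβ)
    (𝓔.coerc_mul_le β) (𝓔.partSub Ω) (isClosed_partSub Ω) (𝓔.innerFunctional h)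
  refine ⟨𝓔.toDom u, (isWeakSolution_toDom_iff hΩ hh).mpr hu, fun v hv => ?_⟩
  obtain ⟨v, rfl⟩ := 𝓔.toDom.surjective v
  rw [huniq v ((isWeakSolution_toDom_iff hΩ hh).mp hv)]

theorem toDom_mem_constraintSet_iff {Ω : Set E} (hΩ : MeasurableSet Ω) {ξ : E → ℝ}
    {h : Lp ℝ 2 μ} (hh : h =ᵐ[μ] Ω.indicator ξ) {δ : ℝ} {f : 𝓔.FormSpace} :
    𝓔.toDom f ∈ 𝓔.constraintSet Ω ξ δ ↔
      f ∈ {f | f ∈ 𝓔.partSub Ω ∧ 𝓔.innerFunctional h f = δ} := by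
  rw [constraintSet, mem_ofPred_eq, mem_ofPred_eq, mem_partSub_iff,
    pairing_eq_innerFunctional hΩ hh]

theorem extendedRecip_pairing_eq {Ω : Set E} (hΩ : MeasurableSet Ω) {β : ℝ} (hβ : 𝓔.β₀ < β)
    {ξ : E → ℝ} {h : Lp ℝ 2 μ} (hh : h =ᵐ[μ] Ω.indicator ξ) {u : 𝓔.dom}
    (hu : 𝓔.IsWeakSolution Ω β ξ u) :
    extendedRecip (𝓔.pairing Ω ξ u) =
        (⨅ f ∈ 𝓔.constraintSet Ω ξ 1, ⨆ g ∈ 𝓔.constraintSet Ω ξ 0,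
          ((𝓔.shifted β (f + g) (f - g) : ℝ) : EReal)) ∧
      (𝓔.IsSymmetric → extendedRecip (𝓔.pairing Ω ξ u) =
          ⨅ f ∈ 𝓔.constraintSet Ω ξ 1, ((𝓔.shifted β f f : ℝ) : EReal)) := by
  obtain ⟨u, rfl⟩ := 𝓔.toDom.surjective u
  obtain ⟨huW, hu⟩ := (isWeakSolution_toDom_iff hΩ hh).mp hu
  obtain ⟨h1, h2⟩ := extendedRecip_eq_iInf_iSup (𝓔.shiftedL β) (𝓔.coerc_pos hβ)
    (𝓔.coerc_mul_le β) (𝓔.partSub Ω) (isClosed_partSub Ω) (𝓔.innerFunctional h) huW hu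
  rw [pairing_eq_innerFunctional hΩ hh]
  refine ⟨h1.trans ?_, fun hsymm => (h2 fun f g => ?_).trans ?_⟩
  · rw [← 𝓔.toDom.surjective.iInf_comp]
    refine iInf_congr fun f => iInf_congr_Prop (toDom_mem_constraintSet_iff hΩ hh).symm
      fun _ => ?_
    rw [← 𝓔.toDom.surjective.iSup_comp]
    refine iSup_congr fun g => iSup_congr_Prop (toDom_mem_constraintSet_iff hΩ hh).symm
      fun _ => ?_
    rw [shiftedL_apply, map_add, map_sub]
  · rw [shiftedL_apply, shiftedL_apply, shifted, shifted, hsymm, real_inner_comm]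
  · rw [← 𝓔.toDom.surjective.iInf_comp]
    refine iInf_congr fun f => iInf_congr_Prop (toDom_mem_constraintSet_iff hΩ hh).symm
      fun _ => ?_
    rw [shiftedL_apply]

end LowerBoundedSemiDirichletForm

/-! ### Exhaustion of $\Omega$ by cutoff functions -/

section Exhaustion

variable {E : Type*} [MetricSpace E] [LocallyCompactSpace E] [TopologicalSpace.SeparableSpace E]

/-- Urysohn functions between consecutive members of a compact exhaustion of $\Omega$, equal to $1$
on the $m$-th set and to $0$ off the interior of the next one. The nesting also makes the sequence
increasing. -/
theorem exists_exhausting_functions {Ω : Set E} (hΩ : IsOpen Ω) :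
    ∃ φ : ℕ → E → ℝ, (∀ m, Continuous (φ m)) ∧ (∀ m, HasCompactSupport (φ m)) ∧
      (∀ m x, φ m x ∈ Icc (0 : ℝ) 1) ∧ (∀ m, ∀ x ∉ Ω, φ m x = 0) ∧
      (∀ m x, φ m x ≠ 0 → φ (m + 1) x = 1) ∧
      ∀ K : Set E, IsCompact K → K ⊆ Ω → ∃ m, ∀ x ∈ K, φ m x = 1 := by
  have : SecondCountableTopology E := UniformSpace.secondCountable_of_separable E
  have : LocallyCompactSpace Ω := hΩ.locallyCompactSpace
  let C : CompactExhaustion Ω := default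
  have hop : ∀ m, IsOpen (((↑) : Ω → E) '' interior (C m)) := fun m =>
    hΩ.isOpenMap_subtype_val _ isOpen_interior
  choose φ h1 h0 hs hI using fun m => exists_continuous_one_zero_of_isCompact
    (s := ((↑) : Ω → E) '' C m) (t := (((↑) : Ω → E) '' interior (C (m + 1)))ᶜ)
    ((C.isCompact m).image continuous_subtype_val) (hop (m + 1)).isClosed_compl
    (disjoint_compl_right_iff_subset.mpr (image_mono (C.subset_interior_succ m)))
  refine ⟨fun m => φ m, fun m => (φ m).continuous, hs, hI, fun m x hx => ?_, fun m x hx => ?_,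
    fun K hK hKΩ => ?_⟩
  · refine h0 m fun ⟨y, _, hy⟩ => hx (hy ▸ y.2)
  · have hx' : x ∈ ((↑) : Ω → E) '' interior (C (m + 1)) := by
      by_contra h
      exact hx (h0 m h)
    exact h1 (m + 1) (image_mono interior_subset hx')
  · have hK' : IsCompact (((↑) : Ω → E) ⁻¹' K) :=
      hΩ.isOpenEmbedding_subtypeVal.isInducing.isCompact_preimage_iff
        (by rwa [Subtype.range_coe]) |>.mpr hK
    obtain ⟨m, hm⟩ := C.exists_superset_of_isCompact hK'
    exact ⟨m, fun x hx => h1 m ⟨⟨x, hKΩ hx⟩, hm hx, rfl⟩⟩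

end Exhaustion

/-! ### Extension to the cemetery and joint measurability -/

section Extension

variable {E : Type*} [TopologicalSpace E]

/-- Extension of a function on `E` by zero at the cemetery. -/
def cemeteryExt {α : Type*} [Zero α] (f : E → α) (z : OnePoint E) : α := z.elim 0 f

@[simp] theorem cemeteryExt_coe {α : Type*} [Zero α] (f : E → α) (x : E) :
    cemeteryExt f (x : OnePoint E) = f x := rfl

@[simp] theorem cemeteryExt_infty {α : Type*} [Zero α] (f : E → α) :
    cemeteryExt f (OnePoint.infty : OnePoint E) = 0 := rfl

/-- Compact support makes the extension vanish near $\partial$. Hence $\varphi(X_t)$ inherits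
right-continuity even through the lifetime. -/
theorem continuous_cemeteryExt {φ : E → ℝ} (hφ : Continuous φ) (hs : HasCompactSupport φ) :
    Continuous (cemeteryExt φ) := by
  rw [continuous_iff_continuousAt]
  intro z
  induction z with
  | infty =>
    rw [OnePoint.continuousAt_infty']
    refine tendsto_const_nhds.congr' ?_
    filter_upwards [hasCompactSupport_iff_eventuallyEq.mp hs] with x hx
    exact hx.symm
  | coe x =>
    rw [OnePoint.continuousAt_coe]
    exact hφ.continuousAt

variable [MeasurableSpace E] [BorelSpace E]

theorem measurableEmbedding_onePoint_coe : MeasurableEmbedding ((↑) : E → OnePoint E) :=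
  OnePoint.isOpenEmbedding_coe.measurableEmbedding

theorem measurable_cemeteryExt {α : Type*} [Zero α] [MeasurableSpace α] {f : E → α}
    (hf : Measurable f) : Measurable (cemeteryExt f) := by
  have h := measurableEmbedding_onePoint_coe.measurable_extend hf
    (measurable_const : Measurable fun _ : OnePoint E => (0 : α))
  convert h using 1
  ext z
  induction z with
  | infty =>
    rw [Function.extend_apply']
    · rfl
    · rintro ⟨x, hx⟩
      exact OnePoint.coe_ne_infty x hx
  | coe x => rw [OnePoint.coe_injective.extend_apply]; rfl

end Extension

section JointMeasurability

/-- Right-continuous real processes are jointly measurable. -/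
theorem measurable_uncurry_of_rightContinuous {S : Type*} [MeasurableSpace S] {f : ℝ → S → ℝ}
    (hf : ∀ t, Measurable (f t))
    (hc : ∀ ω t, ContinuousWithinAt (fun s => f s ω) (Ici t) t) :
    Measurable fun p : S × ℝ => f p.2 p.1 := by
  -- The next grid point strictly to the right of $t$, at distance at most $1/(k+1)$. The
  -- discretized process is a countable gluing of the maps `f t`.
  let ρ : ℕ → ℝ → ℝ := fun k t => (⌊t * (k + 1)⌋ + 1) / (k + 1)
  have hρ : ∀ t, Tendsto (fun k => ρ k t) atTop (𝓝[Ici t] t) := by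
    intro t
    have hle : ∀ k, t ≤ ρ k t := fun k => by
      have hk : (0 : ℝ) < k + 1 := by positivity
      rw [le_div_iff₀ hk]
      exact (Int.lt_floor_add_one _).le
    refine tendsto_nhdsWithin_iff.mpr ⟨?_, Eventually.of_forall hle⟩
    have h1 : Tendsto (fun k : ℕ => t + 1 / ((k : ℝ) + 1)) atTop (𝓝 t) := by
      simpa using tendsto_one_div_add_atTop_nhds_zero_nat.const_add t
    refine tendsto_of_tendsto_of_tendsto_of_le_of_le tendsto_const_nhds h1 hle fun k => ?_
    have hk : (0 : ℝ) < k + 1 := by positivity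
    change ρ k t ≤ t + 1 / ((k : ℝ) + 1)
    rw [div_le_iff₀ hk, add_mul, one_div_mul_cancel hk.ne']
    have := Int.floor_le (t * (k + 1))
    linarith
  refine measurable_of_tendsto_metrizable (f := fun k (p : S × ℝ) => f (ρ k p.2) p.1)
    (fun k => ?_) ?_
  · have h1 : Measurable fun p : S × ℤ => f ((p.2 + 1) / (k + 1)) p.1 :=
      measurable_from_prod_countable_left fun n => (hf (((n : ℝ) + 1) / (k + 1)) :)
    have h2 : Measurable fun p : S × ℝ => (p.1, ⌊p.2 * ((k : ℝ) + 1)⌋) :=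
      measurable_fst.prodMk (Int.measurable_floor.comp (measurable_snd.mul_const _))
    exact h1.comp h2
  · rw [tendsto_pi_nhds]
    exact fun p => (hc p.1 p.2).tendsto.comp (hρ p.2)

variable {E : Type*} [MetricSpace E] [LocallyCompactSpace E] [TopologicalSpace.SeparableSpace E]

/-- Compactly supported continuous functions generate the Borel sets of $E\cup\{\partial\}$: an open
subset of $E$ is a union of sets where a cutoff is positive, and $\{\partial\}$ is the complement of
$E$. -/
theorem measurable_of_measurable_cemeteryExt {T : Type*} [MeasurableSpace T]
    {Y : T → OnePoint E} (hY : ∀ φ : E → ℝ, Continuous φ → HasCompactSupport φ →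
      Measurable fun p => cemeteryExt φ (Y p)) : Measurable Y := by
  have key : ∀ U : Set E, IsOpen U → MeasurableSet (Y ⁻¹' ((↑) '' U)) := by
    intro U hU
    obtain ⟨φ, hc, hs, hI, h0, -, h1⟩ := exists_exhausting_functions hU
    have : Y ⁻¹' ((↑) '' U) = ⋃ m, {p | 0 < cemeteryExt (φ m) (Y p)} := by
      ext p
      simp only [mem_preimage, mem_iUnion, mem_ofPred_eq]
      constructor
      · rintro ⟨x, hx, hxp⟩
        obtain ⟨m, hm⟩ := h1 {x} isCompact_singleton (singleton_subset_iff.mpr hx)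
        refine ⟨m, ?_⟩
        rw [← hxp, cemeteryExt_coe, hm x rfl]
        exact one_pos
      · rintro ⟨m, hm⟩
        generalize Y p = z at hm ⊢
        induction z with
        | infty => exact (lt_irrefl _ hm).elim
        | coe x =>
          refine ⟨x, ?_, rfl⟩
          by_contra hx
          rw [cemeteryExt_coe, h0 m x hx] at hm
          exact lt_irrefl _ hm
    rw [this]
    exact MeasurableSet.iUnion fun m => measurableSet_lt measurable_const (hY _ (hc m) (hs m))
  refine measurable_of_isOpen fun V hV => ?_
  have hVE : IsOpen (((↑) : E → OnePoint E) ⁻¹' V) := hV.preimage OnePoint.continuous_coe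
  by_cases hinf : OnePoint.infty ∈ V
  · have : V = (↑) '' (((↑) : E → OnePoint E) ⁻¹' V) ∪ ((↑) '' (univ : Set E))ᶜ := by
      ext z
      induction z with
      | infty => simp [hinf]
      | coe x => simp
    rw [this, preimage_union, preimage_compl]
    exact (key _ hVE).union (key _ isOpen_univ).compl
  · have : V = (↑) '' (((↑) : E → OnePoint E) ⁻¹' V) := by
      ext z
      induction z with
      | infty => simp [hinf]
      | coe x => simp
    rw [this]
    exact key _ hVE

/-- Right-continuous processes in the one-point compactification are jointly measurable. -/
theorem measurable_uncurry_onePoint {S : Type*} [MeasurableSpace S] {Y : ℝ → S → OnePoint E}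
    (hY : ∀ t, Measurable (Y t))
    (hc : ∀ ω t, ContinuousWithinAt (fun s => Y s ω) (Ici t) t) :
    Measurable fun p : S × ℝ => Y p.2 p.1 := by
  refine measurable_of_measurable_cemeteryExt fun φ hφ hs => ?_
  refine measurable_uncurry_of_rightContinuous (f := fun t ω => cemeteryExt φ (Y t ω))
    (fun t => (continuous_cemeteryExt hφ hs).measurable.comp (hY t)) fun ω t => ?_
  exact (continuous_cemeteryExt hφ hs).continuousAt.comp_continuousWithinAt (hc ω t)

end JointMeasurability

/-! ### The Markov property and occupation measures -/

namespace HuntProcess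

variable {E : Type*} [MetricSpace E] [LocallyCompactSpace E] [TopologicalSpace.SeparableSpace E]
  {S : Type*} [MeasurableSpace S] (X : HuntProcess E S)

/-- The position of the process as a function of the path and the real time. -/
def pos (p : S × ℝ) : OnePoint E := X.X p.2.toNNReal p.1

theorem measurable_pos : Measurable X.pos := by
  refine measurable_uncurry_onePoint (Y := fun t ω => X.X t.toNNReal ω)
    (fun t => (X.adapted _).mono (X.filt.le _) le_rfl) fun ω t => ?_
  exact ContinuousWithinAt.comp (t := Ici t.toNNReal) (X.rightCont ω t.toNNReal)
    continuous_real_toNNReal.continuousWithinAt fun s hs => Real.toNNReal_mono hs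

/-- Progressive measurability: freezing time at $T$ keeps the path measurable with respect to the
information up to $T$. It makes the clock adapted. -/
theorem measurable_pos_min (T : ℝ≥0) :
    @Measurable _ _ (@Prod.instMeasurableSpace _ _ (X.filt T) _) _
      (fun p : S × ℝ => X.X (min p.2.toNNReal T) p.1) := by
  refine @measurable_uncurry_onePoint E _ _ _ S (X.filt T)
    (fun t ω => X.X (min t.toNNReal T) ω)
    (fun t => (X.adapted _).mono (X.filt.mono (min_le_right _ _)) le_rfl) fun ω t => ?_
  exact ContinuousWithinAt.comp (t := Ici (min t.toNNReal T)) (f := fun s : ℝ => min s.toNNReal T)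
    (g := fun s => X.X s ω)
    (X.rightCont ω (min t.toNNReal T))
    (continuous_real_toNNReal.min continuous_const).continuousWithinAt
    fun s hs => min_le_min_right _ (Real.toNNReal_mono hs)

end HuntProcess

namespace HuntProcess

variable {E : Type*} [MetricSpace E] [LocallyCompactSpace E] [TopologicalSpace.SeparableSpace E]
  {S : Type*} [MeasurableSpace S] (X : HuntProcess E S)

instance : IsMarkovKernel X.P := X.isMarkov

/-- The measure `P_x ⊗ dt` on paths and times `t ≥ 0`. -/
noncomputable def pathMeasure (x : OnePoint E) : Measure (S × ℝ) :=
  (X.P x).prod (volume.restrict (Ici 0))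

theorem lintegral_pathMeasure (x : OnePoint E) {F : S × ℝ → ℝ≥0∞} (hF : Measurable F) :
    ∫⁻ p, F p ∂(X.pathMeasure x) = ∫⁻ ω, (∫⁻ t in Ici (0 : ℝ), F (ω, t)) ∂(X.P x) :=
  lintegral_prod _ hF.aemeasurable

section Markov

variable {X}

theorem measurable_X (t : ℝ≥0) : Measurable (X.X t) := (X.adapted t).mono (X.filt.le t) le_rfl

/-- The strong Markov property at a constant time; no other case of it enters the proof. -/
theorem markov_set (t s : ℝ≥0) {A : Set S} (hA : MeasurableSet[X.filt t] A)
    {B : Set (OnePoint E)} (hB : MeasurableSet B) (x : OnePoint E) :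
    X.P x (A ∩ X.X (t + s) ⁻¹' B) = ∫⁻ ω in A, X.P (X.X t ω) (X.X s ⁻¹' B) ∂(X.P x) := by
  have hσ := isStoppingTime_const X.filt t
  have h := X.strongMarkov (fun _ => (t : WithTop ℝ≥0)) hσ s B hB A
    (by rw [IsStoppingTime.measurableSpace_const]; exact hA) x
  have h1 : {ω : S | (t : WithTop ℝ≥0) ≠ ⊤ ∧ X.X (t + s) ω ∈ B} = X.X (t + s) ⁻¹' B := by
    ext ω; exact and_iff_right WithTop.coe_ne_top
  have h2 : A ∩ {ω : S | (t : WithTop ℝ≥0) ≠ ⊤} = A := by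
    ext ω; exact and_iff_left WithTop.coe_ne_top
  rw [← h1]
  refine h.trans ?_
  change ∫⁻ ω in A ∩ {ω : S | (t : WithTop ℝ≥0) ≠ ⊤}, X.P (X.X t ω) (X.X s ⁻¹' B) ∂(X.P x) = _
  rw [h2]

theorem markov_setLIntegral (t s : ℝ≥0) {A : Set S} (hA : MeasurableSet[X.filt t] A)
    {F : OnePoint E → ℝ≥0∞} (hF : Measurable F) (x : OnePoint E) :
    ∫⁻ ω in A, F (X.X (t + s) ω) ∂(X.P x) =
      ∫⁻ ω in A, ∫⁻ ω', F (X.X s ω') ∂(X.P (X.X t ω)) ∂(X.P x) := by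
  have hK : Measurable fun z => (X.P z).map (X.X s) :=
    (Measure.measurable_map _ (measurable_X s)).comp X.P.measurable
  have key : ((X.P x).restrict A).map (X.X (t + s)) =
      (((X.P x).restrict A).map (X.X t)).bind fun z => (X.P z).map (X.X s) := by
    ext B hB
    rw [Measure.map_apply (measurable_X _) hB, Measure.bind_apply hB hK.aemeasurable,
      lintegral_map (f := fun z => (X.P z).map (X.X s) B)
        ((Measure.measurable_coe hB).comp hK) (measurable_X t),
      Measure.restrict_apply ((measurable_X _) hB), inter_comm, markov_set t s hA hB x]
    simp_rw [Measure.map_apply (measurable_X s) hB]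
  rw [← lintegral_map hF (measurable_X _), key,
    Measure.lintegral_bind hK.aemeasurable hF.aemeasurable,
    lintegral_map (f := fun z => ∫⁻ y, F y ∂((X.P z).map (X.X s)))
      ((Measure.measurable_lintegral hF).comp hK) (measurable_X t)]
  simp_rw [lintegral_map hF (measurable_X s)]

/-- The Markov property at a fixed time. -/
theorem markov_lintegral (t s : ℝ≥0) {H : S → ℝ≥0∞} (hH : Measurable[X.filt t] H)
    {F : OnePoint E → ℝ≥0∞} (hF : Measurable F) (x : OnePoint E) :
    ∫⁻ ω, H ω * F (X.X (t + s) ω) ∂(X.P x) =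
      ∫⁻ ω, H ω * ∫⁻ ω', F (X.X s ω') ∂(X.P (X.X t ω)) ∂(X.P x) := by
  have hle := X.filt.le t
  have hg₁ : Measurable fun ω => F (X.X (t + s) ω) := hF.comp (measurable_X _)
  have hg₂ : Measurable fun ω => ∫⁻ ω', F (X.X s ω') ∂(X.P (X.X t ω)) :=
    ((hF.comp (measurable_X s)).lintegral_kernel (κ := X.P)).comp (measurable_X t)
  -- The two densities define the same measure on the $\sigma$-algebra at time $t$, so they
  -- integrate every $H\ge0$ measurable there equally, with no finiteness condition.
  have key : ((X.P x).withDensity fun ω => F (X.X (t + s) ω)).trim hle =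
      ((X.P x).withDensity fun ω => ∫⁻ ω', F (X.X s ω') ∂(X.P (X.X t ω))).trim hle := by
    refine @Measure.ext _ (X.filt t) _ _ fun A hA => ?_
    rw [trim_measurableSet_eq hle hA, trim_measurableSet_eq hle hA,
      withDensity_apply _ (hle A hA), withDensity_apply _ (hle A hA),
      markov_setLIntegral t s hA hF x]
  have h : ∀ g : S → ℝ≥0∞, Measurable g → ∫⁻ ω, H ω * g ω ∂(X.P x) =
      ∫⁻ ω, H ω ∂(((X.P x).withDensity g).trim hle) := fun g hg => by
    rw [lintegral_trim hle hH, lintegral_withDensity_eq_lintegral_mul _ hg (hH.mono hle le_rfl)]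
    simp_rw [Pi.mul_apply, mul_comm]
  rw [h _ hg₁, h _ hg₂, key]

end Markov

variable [MeasurableSpace E] [BorelSpace E]

/-- The occupation measure with weight `Z`: its integrals are `E_x ∫ Z_t f(X_t) dt`. -/
noncomputable def occ (Z : S × ℝ → ℝ) (x : OnePoint E) : Measure E :=
  (((X.pathMeasure x).withDensity fun p => ENNReal.ofReal (Z p)).map X.pos).comap (↑)

variable {X}

theorem range_coe_compl_eq {z : OnePoint E} (hz : z ∉ range ((↑) : E → OnePoint E)) :
    z = OnePoint.infty := by
  induction z with
  | infty => rfl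
  | coe x => exact (hz ⟨x, rfl⟩).elim

theorem lintegral_occ {Z : S × ℝ → ℝ} (hZ : Measurable Z) (x : OnePoint E) {f : E → ℝ≥0∞}
    (hf : Measurable f) : ∫⁻ y, f y ∂(X.occ Z x) =
      ∫⁻ p, ENNReal.ofReal (Z p) * cemeteryExt f (X.pos p) ∂(X.pathMeasure x) := by
  set ν := ((X.pathMeasure x).withDensity fun p => ENNReal.ofReal (Z p)).map X.pos with hν
  have hF := measurable_cemeteryExt hf
  have h1 : ∫⁻ y, f y ∂(X.occ Z x) = ∫⁻ z in range ((↑) : E → OnePoint E), cemeteryExt f z ∂ν := by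
    rw [← measurableEmbedding_onePoint_coe.map_comap,
      measurableEmbedding_onePoint_coe.lintegral_map]
    rfl
  rw [h1, ← lintegral_indicator measurableEmbedding_onePoint_coe.measurableSet_range]
  have h2 : (range ((↑) : E → OnePoint E)).indicator (cemeteryExt f) = cemeteryExt f := by
    ext z
    by_cases hz : z ∈ range ((↑) : E → OnePoint E)
    · rw [indicator_of_mem hz]
    · rw [indicator_of_notMem hz, range_coe_compl_eq hz, cemeteryExt_infty]
  rw [h2, hν, lintegral_map hF X.measurable_pos,
    lintegral_withDensity_eq_lintegral_mul _ hZ.ennreal_ofReal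
      (g := fun p => cemeteryExt f (X.pos p)) (hF.comp X.measurable_pos)]
  rfl

theorem integral_occ {Z : S × ℝ → ℝ} (hZ : Measurable Z) (hZ0 : ∀ p, 0 ≤ Z p) (x : OnePoint E)
    {f : E → ℝ} (hf : Measurable f) : ∫ y, f y ∂(X.occ Z x) =
      ∫ p, Z p * cemeteryExt f (X.pos p) ∂(X.pathMeasure x) := by
  set ν := ((X.pathMeasure x).withDensity fun p => ENNReal.ofReal (Z p)).map X.pos with hν
  have hF := measurable_cemeteryExt hf
  have h1 : ∫ y, f y ∂(X.occ Z x) = ∫ z in range ((↑) : E → OnePoint E), cemeteryExt f z ∂ν := by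
    rw [← measurableEmbedding_onePoint_coe.map_comap,
      measurableEmbedding_onePoint_coe.integral_map]
    rfl
  rw [h1, setIntegral_eq_integral_of_forall_compl_eq_zero, hν,
    integral_map X.measurable_pos.aemeasurable hF.aestronglyMeasurable,
    integral_withDensity_eq_integral_toReal_smul hZ.ennreal_ofReal
      (Eventually.of_forall fun p => ENNReal.ofReal_lt_top)]
  · simp_rw [ENNReal.toReal_ofReal (hZ0 _), smul_eq_mul]
  · intro z hz
    rw [range_coe_compl_eq hz, cemeteryExt_infty]

theorem integrable_occ_iff {Z : S × ℝ → ℝ} (hZ : Measurable Z) (hZ0 : ∀ p, 0 ≤ Z p)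
    (x : OnePoint E) {f : E → ℝ} (hf : Measurable f) : Integrable f (X.occ Z x) ↔
      Integrable (fun p => Z p * cemeteryExt f (X.pos p)) (X.pathMeasure x) := by
  have hm : Measurable fun p => Z p * cemeteryExt f (X.pos p) :=
    hZ.mul ((measurable_cemeteryExt hf).comp X.measurable_pos)
  rw [Integrable, Integrable, and_iff_right hf.aestronglyMeasurable,
    and_iff_right hm.aestronglyMeasurable, hasFiniteIntegral_def, hasFiniteIntegral_def,
    lintegral_occ hZ x hf.enorm]
  have : ∀ p, ENNReal.ofReal (Z p) * cemeteryExt (fun y => ‖f y‖ₑ) (X.pos p)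
      = ‖Z p * cemeteryExt f (X.pos p)‖ₑ := fun p => by
    rw [enorm_mul, Real.enorm_of_nonneg (hZ0 p)]
    generalize X.pos p = z
    induction z with
    | infty => simp
    | coe x => rfl
  simp_rw [this]

theorem measurable_occ {Z : S × ℝ → ℝ} (hZ : Measurable Z) : Measurable fun x => X.occ Z x := by
  refine Measure.measurable_of_measurable_coe _ fun B hB => ?_
  have hm : Measurable fun p => ENNReal.ofReal (Z p) *
      cemeteryExt (B.indicator fun _ => (1 : ℝ≥0∞)) (X.pos p) :=
    hZ.ennreal_ofReal.mul ((measurable_cemeteryExt (measurable_const.indicator hB)).comp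
      X.measurable_pos)
  have : ∀ x, X.occ Z x B = ∫⁻ ω, (∫⁻ t in Ici (0 : ℝ),
      ENNReal.ofReal (Z (ω, t)) *
      cemeteryExt (B.indicator fun _ => (1 : ℝ≥0∞)) (X.pos (ω, t))) ∂(X.P x) := fun x => by
    rw [← lintegral_indicator_one hB]
    exact (lintegral_occ hZ x (measurable_const.indicator hB)).trans
      (lintegral_pathMeasure X x hm)
  simp_rw [this]
  exact (hm.lintegral_prod_right' (ν := volume.restrict (Ici 0))).lintegral_kernel

theorem lintegral_exp_neg_lt_top {β : ℝ} (hβ : 0 < β) :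
    ∫⁻ t in Ici 0, ENNReal.ofReal (Real.exp (-β * t)) < ∞ := by
  have h := (integrableOn_Ici_iff_integrableOn_Ioi (μ := volume)).mpr
    (exp_neg_integrableOn_Ioi 0 hβ)
  exact (hasFiniteIntegral_iff_ofReal (Eventually.of_forall fun t => (Real.exp_pos _).le)).mp h.2

variable (X) in
/-- The resolvent kernel `R_β(x, ·) = E_x ∫ e^{-β t} 1(X_t ∈ ·) dt` on `E`. -/
noncomputable def resolventKernel (β : ℝ) : Kernel E E where
  toFun x := X.occ (fun p => Real.exp (-β * p.2)) (x : OnePoint E)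
  measurable' := (measurable_occ (by fun_prop)).comp OnePoint.continuous_coe.measurable

theorem resolventKernel_apply (β : ℝ) (x : E) :
    X.resolventKernel β x = X.occ (fun p => Real.exp (-β * p.2)) (x : OnePoint E) := rfl

theorem occ_mono {Z Z' : S × ℝ → ℝ} (hZ : Measurable Z) (hZ' : Measurable Z')
    (h : ∀ p : S × ℝ, 0 ≤ p.2 → Z p ≤ Z' p) (x : OnePoint E) : X.occ Z x ≤ X.occ Z' x := by
  refine Measure.le_iff.mpr fun B hB => ?_
  rw [← lintegral_indicator_one hB, ← lintegral_indicator_one hB]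
  have hi : Measurable (B.indicator (1 : E → ℝ≥0∞)) := measurable_one.indicator hB
  have hm : ∀ W : S × ℝ → ℝ, Measurable W → Measurable fun p =>
      ENNReal.ofReal (W p) * cemeteryExt (B.indicator (1 : E → ℝ≥0∞)) (X.pos p) := fun W hW =>
    hW.ennreal_ofReal.mul ((measurable_cemeteryExt hi).comp X.measurable_pos)
  rw [lintegral_occ hZ x hi, lintegral_occ hZ' x hi, lintegral_pathMeasure _ _ (hm Z hZ),
    lintegral_pathMeasure _ _ (hm Z' hZ')]
  refine lintegral_mono fun ω => setLIntegral_mono' measurableSet_Ici fun t ht => ?_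
  gcongr
  exact h _ ht

theorem occ_univ_le (β : ℝ) (x : OnePoint E) :
    X.occ (fun p => Real.exp (-β * p.2)) x univ ≤
      ∫⁻ t in Ici 0, ENNReal.ofReal (Real.exp (-β * t)) := by
  rw [← lintegral_one, lintegral_occ (by fun_prop) x measurable_const, lintegral_pathMeasure]
  · calc _ ≤ ∫⁻ _, (∫⁻ t in Ici (0 : ℝ), ENNReal.ofReal (Real.exp (-β * t))) ∂(X.P x) := by
          refine lintegral_mono fun ω => lintegral_mono fun t => ?_
          have : cemeteryExt (fun _ : E => (1 : ℝ≥0∞)) (X.pos (ω, t)) ≤ 1 := by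
            generalize X.pos (ω, t) = z
            induction z with
            | infty => simp
            | coe x => simp
          exact mul_le_of_le_one_right' this
      _ = _ := by simp
  · exact Measurable.mul (by fun_prop)
      ((measurable_cemeteryExt measurable_const).comp X.measurable_pos)

theorem isFiniteKernel_resolventKernel {β : ℝ} (hβ : 0 < β) :
    IsFiniteKernel (X.resolventKernel β) :=
  ⟨_, lintegral_exp_neg_lt_top hβ, fun x => occ_univ_le β (x : OnePoint E)⟩

end HuntProcess

/-! ### Killing at rate $n(1-\varphi)$ and the resolvent equation -/

section Aux

theorem measurable_intervalIntegral_param {S : Type*} [MeasurableSpace S] {f : S × ℝ → ℝ}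
    (hf : Measurable f) (a b : ℝ) : Measurable fun ω => ∫ s in a..b, f (ω, s) := by
  simp_rw [intervalIntegral]
  exact (hf.stronglyMeasurable.integral_prod_right'.measurable).sub
    (hf.stronglyMeasurable.integral_prod_right'.measurable)

theorem setLIntegral_Ici_eq_add (g : ℝ → ℝ≥0∞) (t : ℝ) :
    ∫⁻ s in Ici t, g s = ∫⁻ r in Ici 0, g (t + r) := by
  rw [← lintegral_indicator measurableSet_Ici, ← lintegral_indicator measurableSet_Ici,
    ← lintegral_add_left_eq_self _ t]
  refine lintegral_congr fun r => ?_
  by_cases hr : 0 ≤ r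
  · rw [indicator_of_mem (show t + r ∈ Ici t by simpa using hr),
      indicator_of_mem (show r ∈ Ici 0 from hr)]
  · rw [indicator_of_notMem (show t + r ∉ Ici t by simpa using hr),
      indicator_of_notMem (show r ∉ Ici 0 from hr)]

/-- Integration over the triangle `0 ≤ t ≤ s`. -/
theorem lintegral_triangle {c g : ℝ → ℝ≥0∞} (hc : Measurable c) (hg : Measurable g) :
    ∫⁻ s in Ici 0, (∫⁻ t in Icc 0 s, c t) * g s =
      ∫⁻ t in Ici 0, ∫⁻ r in Ici 0, c t * g (t + r) := by
  have h1 : ∀ s, (∫⁻ t in Icc 0 s, c t) * g s =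
      ∫⁻ t in Ici 0, (Iic s).indicator c t * g s := fun s => by
    rw [lintegral_mul_const'' _ ((hc.indicator measurableSet_Iic).aemeasurable),
      lintegral_indicator measurableSet_Iic, Measure.restrict_restrict measurableSet_Iic,
      inter_comm, Ici_inter_Iic]
  simp_rw [h1]
  rw [lintegral_lintegral_swap]
  · refine setLIntegral_congr_fun measurableSet_Ici fun t ht => ?_
    have h2 : ∀ s, (Iic s).indicator c t * g s = (Ici t).indicator (fun s => c t * g s) s := by
      intro s
      by_cases hs : t ≤ s
      · rw [indicator_of_mem (show t ∈ Iic s from hs), indicator_of_mem (show s ∈ Ici t from hs)]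
      · rw [indicator_of_notMem (show t ∉ Iic s from hs),
          indicator_of_notMem (show s ∉ Ici t from hs), zero_mul]
    simp_rw [h2]
    rw [lintegral_indicator measurableSet_Ici, Measure.restrict_restrict measurableSet_Ici,
      Ici_inter_Ici, sup_eq_left.mpr (show (0 : ℝ) ≤ t from ht), setLIntegral_Ici_eq_add]
  · have h3 : (Function.uncurry fun s t => (Iic s).indicator c t * g s) =
        fun p : ℝ × ℝ => {p : ℝ × ℝ | p.2 ≤ p.1}.indicator (fun p => c p.2) p * g p.1 := by
      ext p
      rfl
    rw [h3]
    exact (((hc.comp measurable_snd).indicator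
      (measurableSet_le measurable_snd measurable_fst)).mul (hg.comp measurable_fst)).aemeasurable

end Aux

namespace HuntProcess

variable {E : Type*} [MetricSpace E] [LocallyCompactSpace E] [TopologicalSpace.SeparableSpace E]
  {S : Type*} [MeasurableSpace S] (X : HuntProcess E S)

/-- The killing rate `1 - φ(X_t)`, equal to `1` at the cemetery. -/
noncomputable def rate (φ : E → ℝ) (p : S × ℝ) : ℝ := 1 - cemeteryExt φ (X.pos p)

/-- The additive functional `∫_0^t (1 - φ(X_s)) ds`. -/
noncomputable def clock (φ : E → ℝ) (p : S × ℝ) : ℝ := ∫ s in (0 : ℝ)..p.2, X.rate φ (p.1, s)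

/-- The discount factor with killing, `e^{-β t - n ∫_0^t (1 - φ(X_s)) ds}`. -/
noncomputable def killedWeight (β : ℝ) (φ : E → ℝ) (n : ℝ) (p : S × ℝ) : ℝ :=
  Real.exp (-β * p.2) * Real.exp (-n * X.clock φ p)

variable {X} {φ : E → ℝ}

theorem measurable_rate (hφ : Continuous φ) (hs : HasCompactSupport φ) :
    Measurable (X.rate φ) :=
  measurable_const.sub ((continuous_cemeteryExt hφ hs).measurable.comp X.measurable_pos)

theorem rate_mem (hI : ∀ x, φ x ∈ Icc (0 : ℝ) 1) (p : S × ℝ) : X.rate φ p ∈ Icc (0 : ℝ) 1 := by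
  unfold rate
  generalize X.pos p = z
  induction z with
  | infty => simp
  | coe x => exact ⟨sub_nonneg.mpr (hI x).2, sub_le_self _ (hI x).1⟩

theorem rate_rightCont (hφ : Continuous φ) (hs : HasCompactSupport φ) (ω : S) (t : ℝ) :
    ContinuousWithinAt (fun s => X.rate φ (ω, s)) (Ici t) t := by
  refine continuousWithinAt_const.sub
    ((continuous_cemeteryExt hφ hs).continuousAt.comp_continuousWithinAt ?_)
  exact ContinuousWithinAt.comp (t := Ici t.toNNReal) (f := fun s : ℝ => s.toNNReal)
    (g := fun s => X.X s ω) (X.rightCont ω t.toNNReal)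
    continuous_real_toNNReal.continuousWithinAt fun s hs => Real.toNNReal_mono hs

theorem measurable_rate_path (hφ : Continuous φ) (hs : HasCompactSupport φ) (ω : S) :
    Measurable fun s => X.rate φ (ω, s) :=
  (measurable_rate hφ hs).comp measurable_prodMk_left

theorem intervalIntegrable_rate (hφ : Continuous φ) (hs : HasCompactSupport φ)
    (hI : ∀ x, φ x ∈ Icc (0 : ℝ) 1) (ω : S) (a b : ℝ) :
    IntervalIntegrable (fun s => X.rate φ (ω, s)) volume a b := by
  refine (intervalIntegrable_const (c := (1 : ℝ))).mono_fun
    (measurable_rate_path hφ hs ω).aestronglyMeasurable (Eventually.of_forall fun s => ?_)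
  have h := rate_mem (X := X) hI (ω, s)
  change ‖X.rate φ (ω, s)‖ ≤ ‖(1 : ℝ)‖
  rw [Real.norm_of_nonneg h.1, norm_one]
  exact h.2

theorem continuous_clock_path (hφ : Continuous φ) (hs : HasCompactSupport φ)
    (hI : ∀ x, φ x ∈ Icc (0 : ℝ) 1) (ω : S) : Continuous fun t => X.clock φ (ω, t) :=
  intervalIntegral.continuous_primitive (fun a b => intervalIntegrable_rate hφ hs hI ω a b) 0

theorem clock_nonneg (hI : ∀ x, φ x ∈ Icc (0 : ℝ) 1) {p : S × ℝ} (hp : 0 ≤ p.2) :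
    0 ≤ X.clock φ p :=
  intervalIntegral.integral_nonneg hp fun s _ => (rate_mem (X := X) hI (p.1, s)).1

/-- Paths are only right-continuous, so only the right derivative is available at every time. It
suffices to integrate `killDensity` and to deduce that the rate vanishes where the clock does. -/
theorem clock_hasDerivWithinAt (hφ : Continuous φ) (hs : HasCompactSupport φ)
    (hI : ∀ x, φ x ∈ Icc (0 : ℝ) 1) (ω : S) (t : ℝ) :
    HasDerivWithinAt (fun t => X.clock φ (ω, t)) (X.rate φ (ω, t)) (Ici t) t :=
  intervalIntegral.integral_hasDerivWithinAt_right (intervalIntegrable_rate hφ hs hI ω 0 t)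
    ((measurable_rate_path hφ hs ω).stronglyMeasurable.stronglyMeasurableAtFilter)
    ((rate_rightCont hφ hs ω t).mono Ioi_subset_Ici_self)

theorem measurable_clock_filt (hφ : Continuous φ) (hs : HasCompactSupport φ) (t : ℝ≥0) :
    Measurable[X.filt t] fun ω => X.clock φ (ω, (t : ℝ)) := by
  have h1 : @Measurable _ _ (@Prod.instMeasurableSpace _ _ (X.filt t) _) _
      fun p : S × ℝ => 1 - cemeteryExt φ (X.X (min p.2.toNNReal t) p.1) :=
    measurable_const.sub ((continuous_cemeteryExt hφ hs).measurable.comp (X.measurable_pos_min t))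
  have h2 := @measurable_intervalIntegral_param S (X.filt t) _ h1 0 t
  convert h2 using 2 with ω
  refine intervalIntegral.integral_congr fun s hs => ?_
  rw [uIcc_of_le (show (0 : ℝ) ≤ (ω, (t : ℝ)).2 from t.2)] at hs
  have : s.toNNReal ≤ t := Real.toNNReal_le_iff_le_coe.mpr hs.2
  simp only [rate, pos, min_eq_left this]

theorem measurable_clock (hφ : Continuous φ) (hs : HasCompactSupport φ)
    (hI : ∀ x, φ x ∈ Icc (0 : ℝ) 1) : Measurable (X.clock φ) :=
  measurable_uncurry_of_rightContinuous (f := fun t ω => X.clock φ (ω, t))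
    (fun t => measurable_intervalIntegral_param (measurable_rate hφ hs) 0 t)
    fun ω _ => (continuous_clock_path hφ hs hI ω).continuousWithinAt

theorem measurable_killedWeight (hφ : Continuous φ) (hs : HasCompactSupport φ)
    (hI : ∀ x, φ x ∈ Icc (0 : ℝ) 1) (β n : ℝ) : Measurable (X.killedWeight β φ n) := by
  have := measurable_clock (X := X) hφ hs hI
  unfold killedWeight
  fun_prop

/-- The density of the killing time. -/
noncomputable def killDensity (X : HuntProcess E S) (φ : E → ℝ) (n : ℝ) (p : S × ℝ) : ℝ :=
  n * X.rate φ p * Real.exp (-n * X.clock φ p)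

theorem measurable_killDensity (hφ : Continuous φ) (hs : HasCompactSupport φ)
    (hI : ∀ x, φ x ∈ Icc (0 : ℝ) 1) (n : ℝ) : Measurable (X.killDensity φ n) := by
  have := measurable_clock (X := X) hφ hs hI
  have := measurable_rate (X := X) hφ hs
  unfold killDensity
  fun_prop

theorem killDensity_nonneg (hI : ∀ x, φ x ∈ Icc (0 : ℝ) 1) {n : ℝ} (hn : 0 ≤ n) (p : S × ℝ) :
    0 ≤ X.killDensity φ n p := by
  have := (rate_mem (X := X) hI p).1
  unfold killDensity; positivity

/-- `killDensity` is minus the right derivative of $e^{-n\,\mathrm{clock}}$, which starts at $1$: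
the probabilities of surviving to time $s$ and of being killed before add up to $1$. -/
theorem lintegral_killDensity (hφ : Continuous φ) (hs : HasCompactSupport φ)
    (hI : ∀ x, φ x ∈ Icc (0 : ℝ) 1) {n : ℝ} (hn : 0 ≤ n) (ω : S) {s : ℝ} (h0 : 0 ≤ s) :
    ENNReal.ofReal (Real.exp (-n * X.clock φ (ω, s))) +
      ∫⁻ t in Icc 0 s, ENNReal.ofReal (X.killDensity φ n (ω, t)) = 1 := by
  have hint : IntervalIntegrable (fun t => X.killDensity φ n (ω, t)) volume 0 s := by
    have h1 : IntervalIntegrable (fun t => n * X.rate φ (ω, t)) volume 0 s :=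
      (intervalIntegrable_rate hφ hs hI ω 0 s).const_mul n
    refine h1.mul_continuousOn (g := fun t => Real.exp (-n * X.clock φ (ω, t))) ?_
    exact (Real.continuous_exp.comp
      ((continuous_clock_path hφ hs hI ω).const_mul (-n))).continuousOn
  have hftc : ∫ t in (0 : ℝ)..s, X.killDensity φ n (ω, t) =
      1 - Real.exp (-n * X.clock φ (ω, s)) := by
    rw [intervalIntegral.integral_eq_sub_of_hasDeriv_right_of_le h0
      (f := fun t => -Real.exp (-n * X.clock φ (ω, t))) _ _ hint]
    · simp [clock]; ring
    · exact (Real.continuous_exp.comp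
        ((continuous_clock_path hφ hs hI ω).const_mul (-n))).neg.continuousOn
    · intro t _
      have h2 := (((clock_hasDerivWithinAt (X := X) hφ hs hI ω t).mono Ioi_subset_Ici_self).const_mul
        (-n)).exp.neg
      refine h2.congr_deriv ?_
      unfold killDensity; ring
  rw [← restrict_Ioc_eq_restrict_Icc, ← ofReal_integral_eq_lintegral_ofReal
    ((intervalIntegrable_iff_integrableOn_Ioc_of_le h0).mp hint)
    (Eventually.of_forall fun t => killDensity_nonneg hI hn _),
    ← intervalIntegral.integral_of_le h0, hftc, ← ENNReal.ofReal_add (Real.exp_pos _).le]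
  · simp
  · rw [sub_nonneg, Real.exp_le_one_iff]
    have := clock_nonneg (X := X) hI (p := (ω, s)) h0
    nlinarith

end HuntProcess

namespace HuntProcess

variable {E : Type*} [MetricSpace E] [LocallyCompactSpace E] [TopologicalSpace.SeparableSpace E]
  {S : Type*} [MeasurableSpace S] {X : HuntProcess E S}

theorem lintegral_path_swap (x : OnePoint E) {K : S × ℝ × ℝ → ℝ≥0∞} (hK : Measurable K) :
    ∫⁻ ω, (∫⁻ t in Ici (0 : ℝ), ∫⁻ r in Ici (0 : ℝ), K (ω, t, r)) ∂(X.P x) =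
      ∫⁻ t in Ici (0 : ℝ), ∫⁻ r in Ici (0 : ℝ), ∫⁻ ω, K (ω, t, r) ∂(X.P x) := by
  have h1 : Measurable fun p : (S × ℝ) × ℝ => K (p.1.1, p.1.2, p.2) :=
    hK.comp ((measurable_fst.comp measurable_fst).prodMk
      ((measurable_snd.comp measurable_fst).prodMk measurable_snd))
  rw [lintegral_lintegral_swap]
  · refine lintegral_congr fun t => ?_
    rw [lintegral_lintegral_swap]
    exact (hK.comp (measurable_fst.prodMk (measurable_const.prodMk measurable_snd))).aemeasurable
  · exact (h1.lintegral_prod_right' (ν := volume.restrict (Ici (0 : ℝ)))).aemeasurable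

theorem ae_infty_absorbed : ∀ᵐ ω ∂(X.P OnePoint.infty), ∀ t, X.X t ω = OnePoint.infty := by
  filter_upwards [X.start OnePoint.infty] with ω hω t
  exact X.absorbing ω 0 t zero_le hω

variable [MeasurableSpace E] [BorelSpace E]

/-- The `β`-potential of `F` as a function on `E ∪ {∂}`, written with the transition semigroup. -/
theorem lintegral_semigroup_eq (β : ℝ) {f : E → ℝ≥0∞} (hf : Measurable f) (z : OnePoint E) :
    ∫⁻ r in Ici (0 : ℝ), ENNReal.ofReal (Real.exp (-β * r)) *
      ∫⁻ ω, cemeteryExt f (X.pos (ω, r)) ∂(X.P z) =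
    cemeteryExt (fun y => ∫⁻ x, f x ∂(X.resolventKernel β y)) z := by
  have hF : Measurable fun p => cemeteryExt f (X.pos p) :=
    (measurable_cemeteryExt hf).comp X.measurable_pos
  have hm : Measurable fun p : S × ℝ => ENNReal.ofReal (Real.exp (-β * p.2)) *
      cemeteryExt f (X.pos p) := Measurable.mul (by fun_prop) hF
  have hFr : ∀ r, Measurable fun ω => cemeteryExt f (X.pos (ω, r)) := fun r =>
    hF.comp measurable_prodMk_right
  induction z with
  | infty =>
    have h0 : ∀ r, ∫⁻ ω, cemeteryExt f (X.pos (ω, r)) ∂(X.P OnePoint.infty) = 0 := fun r => by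
      rw [lintegral_eq_zero_iff (hFr r)]
      filter_upwards [ae_infty_absorbed (X := X)] with ω hω
      change cemeteryExt f (X.X _ ω) = 0
      rw [hω, cemeteryExt_infty]
    simp [h0]
  | coe y =>
    rw [cemeteryExt_coe, resolventKernel_apply, lintegral_occ (by fun_prop) _ hf,
      lintegral_pathMeasure _ _ hm, lintegral_lintegral_swap hm.aemeasurable]
    refine lintegral_congr fun r => ?_
    exact (lintegral_const_mul _ (hFr r)).symm

/-- The resolvent equation for killing with rate `n (1 - φ)`. -/
theorem lintegral_resolvent_eq {φ : E → ℝ} (hφ : Continuous φ) (hs : HasCompactSupport φ)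
    (hI : ∀ x, φ x ∈ Icc (0 : ℝ) 1) (β : ℝ) {n : ℝ} (hn : 0 ≤ n) {f : E → ℝ≥0∞}
    (hf : Measurable f) (x : E) :
    ∫⁻ y, f y ∂(X.resolventKernel β x) =
      ∫⁻ y, f y ∂(X.occ (X.killedWeight β φ n) (x : OnePoint E)) +
      ∫⁻ y, ENNReal.ofReal (n * (1 - φ y)) * ∫⁻ z, f z ∂(X.resolventKernel β y)
        ∂(X.occ (X.killedWeight β φ n) (x : OnePoint E)) := by
  set c : S × ℝ → ℝ≥0∞ := fun p => ENNReal.ofReal (X.killDensity φ n p) with hc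
  have hcm : Measurable c := (measurable_killDensity hφ hs hI n).ennreal_ofReal
  have hkm := measurable_killedWeight (X := X) hφ hs hI β n
  have hFm : Measurable (cemeteryExt f) := measurable_cemeteryExt hf
  have hF : Measurable fun p => cemeteryExt f (X.pos p) := hFm.comp X.measurable_pos
  have hm : Measurable fun p : S × ℝ => ENNReal.ofReal (Real.exp (-β * p.2)) *
      cemeteryExt f (X.pos p) := Measurable.mul (by fun_prop) hF
  have hm' : Measurable fun p : S × ℝ => ENNReal.ofReal (X.killedWeight β φ n p) *
      cemeteryExt f (X.pos p) := hkm.ennreal_ofReal.mul hF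
  have hRm : Measurable fun y => ∫⁻ z, f z ∂(X.resolventKernel β y) := hf.lintegral_kernel
  have hQm : Measurable fun y => ENNReal.ofReal (n * (1 - φ y)) *
      ∫⁻ z, f z ∂(X.resolventKernel β y) :=
    Measurable.mul (by have := hφ.measurable; fun_prop) hRm
  have hQm' : Measurable fun p : S × ℝ => ENNReal.ofReal (X.killedWeight β φ n p) *
      cemeteryExt (fun y => ENNReal.ofReal (n * (1 - φ y)) *
      ∫⁻ z, f z ∂(X.resolventKernel β y)) (X.pos p) :=
    hkm.ennreal_ofReal.mul ((measurable_cemeteryExt hQm).comp X.measurable_pos)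
  rw [resolventKernel_apply, lintegral_occ (by fun_prop) _ hf, lintegral_pathMeasure _ _ hm,
    lintegral_occ hkm _ hf, lintegral_pathMeasure _ _ hm', lintegral_occ hkm _ hQm,
    lintegral_pathMeasure _ _ hQm']
  -- Insert $1$ as survival plus killing before time $s$. In the second term $t$ is the killing time
  -- and $s=t+r$. Working in $[0,\infty]$ makes every exchange of integrals Tonelli.
  have hsplit : ∀ ω, ∫⁻ s in Ici (0 : ℝ), ENNReal.ofReal (Real.exp (-β * s)) *
        cemeteryExt f (X.pos (ω, s)) =
      (∫⁻ s in Ici (0 : ℝ), ENNReal.ofReal (X.killedWeight β φ n (ω, s)) *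
        cemeteryExt f (X.pos (ω, s))) +
      ∫⁻ t in Ici (0 : ℝ), ∫⁻ r in Ici (0 : ℝ), c (ω, t) *
        (ENNReal.ofReal (Real.exp (-β * (t + r))) * cemeteryExt f (X.pos (ω, t + r))) := by
    intro ω
    have hmω : Measurable fun s => ENNReal.ofReal (X.killedWeight β φ n (ω, s)) *
        cemeteryExt f (X.pos (ω, s)) := hm'.comp measurable_prodMk_left
    rw [← lintegral_triangle (c := fun t => c (ω, t))
      (g := fun s => ENNReal.ofReal (Real.exp (-β * s)) * cemeteryExt f (X.pos (ω, s)))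
      (hcm.comp measurable_prodMk_left) (hm.comp measurable_prodMk_left),
      ← lintegral_add_left hmω]
    refine setLIntegral_congr_fun measurableSet_Ici fun s h0 => ?_
    have h1 := lintegral_killDensity (X := X) hφ hs hI hn ω (s := s) h0
    simp only [killedWeight, ENNReal.ofReal_mul (Real.exp_pos _).le]
    conv_lhs => rw [← one_mul (_ * _), ← h1]
    ring
  simp_rw [hsplit]
  rw [lintegral_add_left (hm'.lintegral_prod_right' (ν := volume.restrict (Ici (0 : ℝ))))]
  congr 1
  have hK : Measurable fun q : S × ℝ × ℝ => c (q.1, q.2.1) *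
      (ENNReal.ofReal (Real.exp (-β * (q.2.1 + q.2.2))) *
        cemeteryExt f (X.pos (q.1, q.2.1 + q.2.2))) := by
    refine (hcm.comp (by fun_prop)).mul (Measurable.mul (by fun_prop) ?_)
    exact hF.comp (f := fun q : S × ℝ × ℝ => (q.1, q.2.1 + q.2.2)) (by fun_prop)
  rw [lintegral_path_swap (X := X) x hK]
  have hGm : Measurable fun q : OnePoint E × ℝ =>
      ∫⁻ ω', cemeteryExt f (X.pos (ω', q.2)) ∂(X.P q.1) := by
    refine Measurable.lintegral_kernel_prod_right
      (κ := X.P.comap (Prod.fst : OnePoint E × ℝ → OnePoint E) measurable_fst)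
      (f := fun q ω' => cemeteryExt f (X.pos (ω', q.2))) ?_
    exact hF.comp (f := fun q : (OnePoint E × ℝ) × S => (q.2, q.1.2)) (by fun_prop)
  have hK' : Measurable fun q : S × ℝ × ℝ => c (q.1, q.2.1) *
      (ENNReal.ofReal (Real.exp (-β * (q.2.1 + q.2.2))) *
        ∫⁻ ω', cemeteryExt f (X.pos (ω', q.2.2)) ∂(X.P (X.pos (q.1, q.2.1)))) := by
    refine (hcm.comp (by fun_prop)).mul (Measurable.mul (by fun_prop) ?_)
    refine hGm.comp (f := fun q : S × ℝ × ℝ => (X.pos (q.1, q.2.1), q.2.2)) ?_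
    exact (X.measurable_pos.comp (by fun_prop)).prodMk (by fun_prop)
  -- The killing density at time $t$ depends only on the path up to $t$, so the Markov property
  -- restarts the process from $X_t$; the integral over $r$ then becomes $R_\beta f(X_t)$.
  have hmarkov : ∀ t ∈ Ici (0 : ℝ), ∀ r ∈ Ici (0 : ℝ), ∫⁻ ω, c (ω, t) *
      (ENNReal.ofReal (Real.exp (-β * (t + r))) * cemeteryExt f (X.pos (ω, t + r))) ∂(X.P x) =
      ∫⁻ ω, c (ω, t) * (ENNReal.ofReal (Real.exp (-β * (t + r))) *
        ∫⁻ ω', cemeteryExt f (X.pos (ω', r)) ∂(X.P (X.pos (ω, t)))) ∂(X.P x) := by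
    intro t ht r hr
    lift t to ℝ≥0 using ht
    lift r to ℝ≥0 using hr
    have hcf : Measurable[X.filt t] fun ω => c (ω, (t : ℝ)) *
        ENNReal.ofReal (Real.exp (-β * ((t : ℝ) + r))) := by
      have h1 := measurable_clock_filt (X := X) hφ hs t
      have h2 : Measurable[X.filt t] fun ω => X.rate φ (ω, (t : ℝ)) := by
        refine measurable_const.sub ((continuous_cemeteryExt hφ hs).measurable.comp ?_)
        simp only [pos, Real.toNNReal_coe]
        exact X.adapted t
      refine Measurable.mul_const ?_ _
      exact ((h2.const_mul n).mul (Real.measurable_exp.comp (h1.const_mul (-n)))).ennreal_ofReal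
    have h3 := markov_lintegral (X := X) t r hcf hFm x
    simp only [mul_assoc] at h3
    convert h3 using 6
    · simp only [pos, ← NNReal.coe_add, Real.toNNReal_coe]
    · simp only [pos, Real.toNNReal_coe]
    · simp only [pos, Real.toNNReal_coe]
  rw [setLIntegral_congr_fun measurableSet_Ici fun t ht =>
    setLIntegral_congr_fun measurableSet_Ici fun r hr => hmarkov t ht r hr,
    ← lintegral_path_swap (X := X) x hK']
  refine lintegral_congr fun ω => lintegral_congr fun t => ?_
  have hexp : ∀ r, Real.exp (-β * (t + r)) = Real.exp (-β * t) * Real.exp (-β * r) := fun r => by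
    rw [← Real.exp_add]; ring_nf
  simp_rw [hexp, ENNReal.ofReal_mul (Real.exp_pos _).le, mul_assoc]
  rw [lintegral_const_mul, lintegral_const_mul, lintegral_semigroup_eq β hf]
  · simp only [hc, killDensity, killedWeight, rate]
    rw [ENNReal.ofReal_mul (Real.exp_pos _).le, ENNReal.ofReal_mul' (Real.exp_pos _).le]
    generalize X.pos (ω, t) = z
    induction z with
    | infty => simp
    | coe y => simp only [cemeteryExt_coe]; ring
  · refine Measurable.mul (by fun_prop) ?_
    exact hGm.comp (measurable_const.prodMk measurable_id)
  · refine Measurable.mul (by fun_prop) (Measurable.mul (by fun_prop) ?_)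
    exact hGm.comp (measurable_const.prodMk measurable_id)

end HuntProcess

/-! ### Agreement of the probabilistic and form resolvents -/

namespace HuntProcess

variable {E : Type*} [MetricSpace E] [LocallyCompactSpace E] [TopologicalSpace.SeparableSpace E]
  [MeasurableSpace E] [BorelSpace E]
  {S : Type*} [MeasurableSpace S] {X : HuntProcess E S}

theorem timeInterval_top : timeInterval ⊤ = Ici 0 := by
  ext t; simp [timeInterval]

theorem discounted_eq (β : ℝ) (f : E → ℝ) (ω : S) (t : ℝ) :
    X.discounted β f ω t = Real.exp (-β * t) * cemeteryExt f (X.pos (ω, t)) := rfl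

theorem resolvent_eq_integral {β : ℝ} {f : E → ℝ} (hf : Measurable f) {x : E}
    (hi : Integrable f (X.resolventKernel β x)) :
    X.resolvent β f x = ∫ y, f y ∂(X.resolventKernel β x) := by
  rw [resolventKernel_apply] at hi ⊢
  have hZ : Measurable fun p : S × ℝ => Real.exp (-β * p.2) := by fun_prop
  have hZ0 : ∀ p : S × ℝ, 0 ≤ Real.exp (-β * p.2) := fun p => (Real.exp_pos _).le
  rw [integrable_occ_iff hZ hZ0 _ hf] at hi
  rw [integral_occ hZ hZ0 _ hf, pathMeasure, integral_prod _ hi, resolvent, timeInterval_top]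
  rfl

/-- The resolvent equation for signed functions. -/
theorem integral_resolvent_eq {φ : E → ℝ} (hφ : Continuous φ) (hs : HasCompactSupport φ)
    (hI : ∀ x, φ x ∈ Icc (0 : ℝ) 1) (β : ℝ) {n : ℝ} (hn : 0 ≤ n) {f : E → ℝ}
    {x : E} (hf : Integrable f (X.resolventKernel β x)) :
    ∫ y, f y ∂(X.resolventKernel β x) =
      ∫ y, f y ∂(X.occ (X.killedWeight β φ n) (x : OnePoint E)) +
      ∫ y, n * (1 - φ y) * ∫ z, f z ∂(X.resolventKernel β y)
        ∂(X.occ (X.killedWeight β φ n) (x : OnePoint E)) := by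
  set U := X.occ (X.killedWeight β φ n) (x : OnePoint E)
  have hq : Measurable fun y => ENNReal.ofReal (n * (1 - φ y)) := by
    have := hφ.measurable; fun_prop
  have hR := (X.resolventKernel β).measurable.aemeasurable
    (μ := U.withDensity fun y => ENNReal.ofReal (n * (1 - φ y)))
  -- Stated for measures, the identity passes to signed functions with one integrability hypothesis.
  have key : X.resolventKernel β x =
      U + (U.withDensity fun y => ENNReal.ofReal (n * (1 - φ y))).bind (X.resolventKernel β) := by
    ext B hB
    have h1 : Measurable (B.indicator (1 : E → ℝ≥0∞)) := measurable_one.indicator hB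
    rw [← lintegral_indicator_one hB, lintegral_resolvent_eq hφ hs hI β hn h1 x,
      Measure.add_apply, Measure.bind_apply hB hR,
      lintegral_withDensity_eq_lintegral_mul _ hq
        (Kernel.measurable_coe (X.resolventKernel β) hB)]
    simp_rw [lintegral_indicator_one hB]
    rfl
  have hf' := hf
  rw [key, integrable_add_measure] at hf'
  rw [key, integral_add_measure hf'.1 hf'.2, Measure.comp_eq_comp_const_apply,
    Kernel.integral_comp (by rw [← Measure.comp_eq_comp_const_apply]; exact hf'.2),
    Kernel.const_apply, integral_withDensity_eq_integral_toReal_smul hq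
      (Eventually.of_forall fun p => ENNReal.ofReal_lt_top)]
  congr 1
  refine integral_congr_ae (Eventually.of_forall fun y => ?_)
  simp only [smul_eq_mul]
  rw [ENNReal.toReal_ofReal (mul_nonneg hn (sub_nonneg.mpr (hI y).2))]

section Generated

variable {μ : Measure E} {𝓔 : LowerBoundedSemiDirichletForm μ} {β : ℝ}

theorem IsGeneratedBy.exists_integral_eq (hX : X.IsGeneratedBy 𝓔) (hβ : 𝓔.β₀ < β) {f : E → ℝ}
    (hf : Measurable f) (hb : ∃ C, ∀ x, |f x| ≤ C) {h : Lp ℝ 2 μ} (hh : h =ᵐ[μ] f) :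
    ∃ u : 𝓔.FormSpace, (𝓔.incl u =ᵐ[μ] fun x => ∫ y, f y ∂(X.resolventKernel β x)) ∧
      ∀ g, 𝓔.shiftedL β u g = 𝓔.innerFunctional h g := by
  have := isFiniteKernel_resolventKernel (X := X) (𝓔.β₀_nonneg.trans_lt hβ)
  obtain ⟨u, hu, hg⟩ := hX β hβ f hf hb ((memLp_congr_ae hh).mp (Lp.memLp h))
  obtain ⟨u, rfl⟩ := 𝓔.toDom.surjective u
  obtain ⟨C, hC⟩ := hb
  refine ⟨u, hu.trans (Eventually.of_forall fun x => resolvent_eq_integral hf ?_), fun g => ?_⟩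
  · exact Integrable.of_bound hf.aestronglyMeasurable C (Eventually.of_forall hC)
  · rw [𝓔.innerFunctional_apply, Lp.inner_eq_integral, 𝓔.shiftedL_apply, hg]
    refine integral_congr_ae ?_
    filter_upwards [hh] with x hx
    rw [hx]; rfl

theorem eq_of_shiftedL_eq (hβ : 𝓔.β₀ < β) {u v : 𝓔.FormSpace}
    (h : ∀ g, 𝓔.shiftedL β u g = 𝓔.shiftedL β v g) : u = v := by
  have h1 := 𝓔.coerc_mul_le β (u - v)
  rw [map_sub (𝓔.shiftedL β) u v, sub_apply, h, sub_self] at h1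
  have h2 : ‖u - v‖ ^ 2 = 0 := by nlinarith [𝓔.coerc_pos hβ, sq_nonneg ‖u - v‖]
  exact sub_eq_zero.mp (norm_eq_zero.mp (by simpa using h2))

/-- The resolvent kernel charges no `μ`-null set, for almost every starting point. -/
theorem IsGeneratedBy.ae_ae (hX : X.IsGeneratedBy 𝓔) (hβ : 𝓔.β₀ < β) {p : E → Prop}
    (hp : ∀ᵐ x ∂μ, p x) : ∀ᵐ x ∂μ, ∀ᵐ y ∂(X.resolventKernel β x), p y := by
  have := isFiniteKernel_resolventKernel (X := X) (𝓔.β₀_nonneg.trans_lt hβ)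
  -- The indicator of a Borel null hull is a bounded Borel function representing $0$ in $L^2$, so
  -- its resolvent is the zero element.
  set N := toMeasurable μ {x | ¬ p x} with hN
  have hNm : MeasurableSet N := measurableSet_toMeasurable _ _
  have hN0 : μ N = 0 := (measure_toMeasurable _).trans hp
  obtain ⟨u, hu, hg⟩ := hX.exists_integral_eq hβ (f := N.indicator 1) (h := 0)
    (measurable_one.indicator hNm) ⟨1, fun x => by
      by_cases hx : x ∈ N <;> simp [hx]⟩ (by
      filter_upwards [Lp.coeFn_zero ℝ 2 μ, measure_eq_zero_iff_ae_notMem.mp hN0] with x h1 h2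
      rw [h1, indicator_of_notMem h2]; rfl)
  have hu0 : u = 0 := eq_of_shiftedL_eq hβ fun g => by
    rw [hg, 𝓔.innerFunctional_apply, inner_zero_left, map_zero, zero_apply]
  rw [hu0, map_zero] at hu
  filter_upwards [hu, Lp.coeFn_zero ℝ 2 μ] with x h1 h2
  rw [h2, integral_indicator_one hNm] at h1
  have h3 : X.resolventKernel β x N = 0 := by
    have h4 : (X.resolventKernel β x).real N = 0 := h1.symm
    rwa [measureReal_eq_zero_iff] at h4
  exact measure_mono_null (subset_toMeasurable μ _) h3

theorem norm_le_of_shiftedL_eq (hβ : 𝓔.β₀ < β) {u : 𝓔.FormSpace} {h : Lp ℝ 2 μ}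
    (hu : 𝓔.shiftedL β u u ≤ 𝓔.innerFunctional h u) : ‖u‖ ≤ ‖h‖ / 𝓔.coerc β := by
  refine norm_le_of_coercive (𝓔.shiftedL β) (𝓔.coerc_pos hβ) (𝓔.coerc_mul_le β) (norm_nonneg h)
    (hu.trans ?_)
  rw [𝓔.innerFunctional_apply]
  exact (real_inner_le_norm _ _).trans (by gcongr; exact 𝓔.norm_incl_le u)

/-- `IsGeneratedBy` speaks of bounded functions only. For the truncations $f\wedge n$ the form
resolvents converge by coercivity and the kernel integrals by monotone convergence; the limit being
finite a.e., $f$ is integrable. -/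
theorem IsGeneratedBy.ae_integrable_of_nonneg (hX : X.IsGeneratedBy 𝓔) (hβ : 𝓔.β₀ < β)
    {f : E → ℝ} (hf : Measurable f) (hf0 : ∀ x, 0 ≤ f x) {h : Lp ℝ 2 μ} (hh : h =ᵐ[μ] f)
    {w : 𝓔.FormSpace} (hw : ∀ g, 𝓔.shiftedL β w g = 𝓔.innerFunctional h g) :
    ∀ᵐ x ∂μ, Integrable f (X.resolventKernel β x) ∧
      𝓔.incl w x = ∫ y, f y ∂(X.resolventKernel β x) := by
  have := isFiniteKernel_resolventKernel (X := X) (𝓔.β₀_nonneg.trans_lt hβ)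
  have hmem : MemLp f 2 μ := (memLp_congr_ae hh).mp (Lp.memLp h)
  have hfnm : ∀ n : ℕ, Measurable fun x => min (f x) n := fun n => hf.min measurable_const
  have hfn0 : ∀ (n : ℕ) x, 0 ≤ min (f x) n := fun n x => le_min (hf0 x) n.cast_nonneg
  have hmemn : ∀ n : ℕ, MemLp (fun x => min (f x) n) 2 μ := fun n =>
    hmem.of_le (hfnm n).aestronglyMeasurable (Eventually.of_forall fun x => by
      rw [Real.norm_of_nonneg (hfn0 n x), Real.norm_of_nonneg (hf0 x)]; exact min_le_left _ _)
  have hlimf : ∀ x, Tendsto (fun n : ℕ => min (f x) n) atTop (𝓝 (f x)) := fun x => by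
    obtain ⟨N, hN⟩ := exists_nat_ge (f x)
    refine tendsto_const_nhds.congr' ?_
    filter_upwards [eventually_ge_atTop N] with n hn
    rw [min_eq_left (hN.trans (by exact_mod_cast hn))]
  obtain ⟨y, hy, hlim⟩ := exists_lp_limit_of_dominated (f := fun n => (hmemn n).toLp) (g := h)
    (v := f) (fun n => by
      filter_upwards [(hmemn n).coeFn_toLp, hh] with x h1 h2
      rw [h1, h2, abs_of_nonneg (hfn0 n x)]; exact min_le_left _ _) (by
      filter_upwards [ae_all_iff.mpr fun n => (hmemn n).coeFn_toLp] with x hx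
      exact (hlimf x).congr fun n => (hx n).symm)
  obtain rfl : y = h := Lp.ext (hy.trans hh.symm)
  choose u hu hug using fun n : ℕ => hX.exists_integral_eq hβ (hfnm n) ⟨n, fun x => by
    rw [abs_of_nonneg (hfn0 n x)]; exact min_le_right _ _⟩ (hmemn n).coeFn_toLp
  have hlimu : Tendsto u atTop (𝓝 w) := by
    rw [tendsto_iff_norm_sub_tendsto_zero]
    have h1 : Tendsto (fun n => ‖(hmemn n).toLp - y‖ / 𝓔.coerc β) atTop (𝓝 0) := by
      simpa using (tendsto_iff_norm_sub_tendsto_zero.mp hlim).div_const (𝓔.coerc β)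
    refine squeeze_zero (fun n => norm_nonneg _) (fun n => ?_) h1
    refine norm_le_of_shiftedL_eq hβ (le_of_eq ?_)
    rw [𝓔.innerFunctional_apply, inner_sub_left, ← 𝓔.innerFunctional_apply,
      ← 𝓔.innerFunctional_apply, ← hug, ← hw, ← sub_apply, ← map_sub]
  obtain ⟨ns, hns, hae⟩ := exists_subseq_tendsto_ae
    ((𝓔.incl.continuous.tendsto w).comp hlimu)
  filter_upwards [hae, ae_all_iff.mpr hu] with x h1 h2
  simp only [Function.comp_apply, h2] at h1
  have hbint : ∀ n : ℕ, Integrable (fun y => min (f y) n) (X.resolventKernel β x) := fun n =>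
    Integrable.of_bound (hfnm n).aestronglyMeasurable n (Eventually.of_forall fun y => by
      rw [Real.norm_of_nonneg (hfn0 n y)]; exact min_le_right _ _)
  have h3 : Tendsto (fun i => ∫⁻ y, ENNReal.ofReal (min (f y) (ns i)) ∂(X.resolventKernel β x))
      atTop (𝓝 (∫⁻ y, ENNReal.ofReal (f y) ∂(X.resolventKernel β x))) := by
    refine lintegral_tendsto_of_tendsto_of_monotone
      (fun i => (hfnm (ns i)).ennreal_ofReal.aemeasurable)
      (Eventually.of_forall fun y i j hij => ENNReal.ofReal_le_ofReal ?_)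
      (Eventually.of_forall fun y => ENNReal.tendsto_ofReal ?_)
    · exact min_le_min le_rfl (by exact_mod_cast hns.monotone hij)
    · exact (hlimf y).comp hns.tendsto_atTop
  have h4 : ∫⁻ y, ENNReal.ofReal (f y) ∂(X.resolventKernel β x) =
      ENNReal.ofReal (𝓔.incl w x) := by
    refine tendsto_nhds_unique h3 ((ENNReal.tendsto_ofReal h1).congr fun i => ?_)
    exact ofReal_integral_eq_lintegral_ofReal (hbint _) (Eventually.of_forall (hfn0 _))
  have h5 : 0 ≤ 𝓔.incl w x :=
    ge_of_tendsto' h1 fun i => integral_nonneg (hfn0 _)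
  refine ⟨⟨hf.aestronglyMeasurable, ?_⟩, ?_⟩
  · rw [hasFiniteIntegral_iff_ofReal (Eventually.of_forall hf0), h4]
    exact ENNReal.ofReal_lt_top
  · rw [integral_eq_lintegral_of_nonneg_ae (Eventually.of_forall hf0) hf.aestronglyMeasurable,
      h4, ENNReal.toReal_ofReal h5]

theorem exists_shiftedL_eq (hβ : 𝓔.β₀ < β) (h : Lp ℝ 2 μ) :
    ∃ w : 𝓔.FormSpace, ∀ g, 𝓔.shiftedL β w g = 𝓔.innerFunctional h g := by
  obtain ⟨w, hw, -⟩ := existsUnique_of_coercive (𝓔.shiftedL β) (𝓔.coerc_pos hβ)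
    (𝓔.coerc_mul_le β) ⊤ isClosed_univ (𝓔.innerFunctional h)
  exact ⟨w, fun g => hw.2 g trivial⟩

/-- The probabilistic resolvent agrees with the resolvent of the form on all of `L²`. -/
theorem IsGeneratedBy.ae_integrable (hX : X.IsGeneratedBy 𝓔) (hβ : 𝓔.β₀ < β) (h : Lp ℝ 2 μ)
    {w : 𝓔.FormSpace} (hw : ∀ g, 𝓔.shiftedL β w g = 𝓔.innerFunctional h g) :
    ∀ᵐ x ∂μ, Integrable h (X.resolventKernel β x) ∧
      𝓔.incl w x = ∫ y, h y ∂(X.resolventKernel β x) := by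
  have hm : Measurable h := (Lp.stronglyMeasurable h).measurable
  obtain ⟨w₁, h₁⟩ := exists_shiftedL_eq hβ (Lp.posPart h)
  obtain ⟨w₂, h₂⟩ := exists_shiftedL_eq hβ (Lp.negPart h)
  have hww : w = w₁ - w₂ := eq_of_shiftedL_eq hβ fun g => by
    rw [hw, map_sub, sub_apply, h₁, h₂, 𝓔.innerFunctional_apply,
      𝓔.innerFunctional_apply, 𝓔.innerFunctional_apply, ← inner_sub_left]
    congr 1
    refine Lp.ext ?_
    filter_upwards [Lp.coeFn_sub (Lp.posPart h) (Lp.negPart h), Lp.coeFn_posPart h,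
      Lp.coeFn_negPart_eq_max h] with x a b c
    rw [a, Pi.sub_apply, b, c]
    rcases le_total (h x) 0 with d | d <;> simp [d]
  filter_upwards [hX.ae_integrable_of_nonneg hβ (hm.max measurable_const)
      (fun x => le_max_right _ _) (Lp.coeFn_posPart h) h₁,
    hX.ae_integrable_of_nonneg hβ (hm.neg.max measurable_const)
      (fun x => le_max_right _ _) (Lp.coeFn_negPart_eq_max h) h₂, 𝓔.incl_sub w₁ w₂]
      with x a b c
  have hd : ∀ y, h y = max (h y) 0 - max (-h y) 0 := fun y => by
    rcases le_total (h y) 0 with d | d <;> simp [d]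
  have hi := a.1.sub b.1
  refine ⟨hi.congr (Eventually.of_forall fun y => (hd y).symm), ?_⟩
  rw [hww, c, a.2, b.2, ← integral_sub a.1 b.1]
  exact integral_congr_ae (Eventually.of_forall fun y => (hd y).symm)

end Generated

end HuntProcess

/-! ### The penalized form and its killed resolvent -/

section MulBounded

variable {E : Type*} [MeasurableSpace E] {μ : Measure E}

theorem MeasureTheory.MemLp.unitInterval_mul {q : E → ℝ} (hq : Measurable q)
    (hI : ∀ x, q x ∈ Icc (0 : ℝ) 1) (f : Lp ℝ 2 μ) : MemLp (fun x => q x * f x) 2 μ :=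
  (Lp.memLp f).of_le (hq.aestronglyMeasurable.mul (Lp.aestronglyMeasurable f))
    (Eventually.of_forall fun x => by
      rw [norm_mul, Real.norm_of_nonneg (hI x).1]
      exact mul_le_of_le_one_left (norm_nonneg _) (hI x).2)

/-- Multiplication by a function with values in `[0, 1]` as an operator on `L²`. -/
noncomputable def mulLp (μ : Measure E) {q : E → ℝ} (hq : Measurable q)
    (hI : ∀ x, q x ∈ Icc (0 : ℝ) 1) : Lp ℝ 2 μ →L[ℝ] Lp ℝ 2 μ :=
  LinearMap.mkContinuous
    { toFun := fun f => (MemLp.unitInterval_mul hq hI f).toLp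
      map_add' := fun f g => Lp.ext (by
        filter_upwards [(MemLp.unitInterval_mul hq hI (f + g)).coeFn_toLp,
          Lp.coeFn_add (MemLp.unitInterval_mul hq hI f).toLp (MemLp.unitInterval_mul hq hI g).toLp,
          (MemLp.unitInterval_mul hq hI f).coeFn_toLp, (MemLp.unitInterval_mul hq hI g).coeFn_toLp,
          Lp.coeFn_add f g] with x h1 h2 h3 h4 h5
        rw [h1, h2, Pi.add_apply, h3, h4, h5, Pi.add_apply, mul_add])
      map_smul' := fun c f => Lp.ext (by
        filter_upwards [(MemLp.unitInterval_mul hq hI (c • f)).coeFn_toLp,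
          Lp.coeFn_smul c (MemLp.unitInterval_mul hq hI f).toLp,
          (MemLp.unitInterval_mul hq hI f).coeFn_toLp, Lp.coeFn_smul c f] with x h1 h2 h3 h4
        simp only [RingHom.id_apply]
        rw [h1, h2, Pi.smul_apply, h3, h4, Pi.smul_apply, smul_eq_mul, smul_eq_mul]
        ring) } 1 fun f => by
    rw [one_mul]
    refine Lp.norm_le_norm_of_ae_le ?_
    filter_upwards [(MemLp.unitInterval_mul hq hI f).coeFn_toLp] with x h1
    refine (congrArg norm h1).trans_le ?_
    rw [norm_mul, Real.norm_of_nonneg (hI x).1]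
    exact mul_le_of_le_one_left (norm_nonneg _) (hI x).2

variable {q : E → ℝ} (hq : Measurable q) (hI : ∀ x, q x ∈ Icc (0 : ℝ) 1)

theorem coeFn_mulLp (f : Lp ℝ 2 μ) : mulLp μ hq hI f =ᵐ[μ] fun x => q x * f x :=
  (MemLp.unitInterval_mul hq hI f).coeFn_toLp

theorem inner_mulLp_nonneg (f : Lp ℝ 2 μ) : 0 ≤ inner ℝ (mulLp μ hq hI f) f := by
  rw [Lp.inner_eq_integral]
  refine integral_nonneg_of_ae ?_
  filter_upwards [coeFn_mulLp hq hI f] with x hx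
  rw [hx, mul_assoc]
  exact mul_nonneg (hI x).1 (mul_self_nonneg _)

theorem inner_mulLp_eq_zero (f : Lp ℝ 2 μ) {g : Lp ℝ 2 μ} (hg : ∀ᵐ x ∂μ, q x ≠ 0 → g x = 0) :
    inner ℝ (mulLp μ hq hI f) g = 0 := by
  rw [Lp.inner_eq_integral]
  refine integral_eq_zero_of_ae ?_
  filter_upwards [coeFn_mulLp hq hI f, hg] with x hx h
  by_cases h0 : q x = 0
  · simp [hx, h0]
  · simp [h h0]

end MulBounded

namespace LowerBoundedSemiDirichletForm

variable {E : Type*} [MeasurableSpace E] {μ : Measure E} (𝓔 : LowerBoundedSemiDirichletForm μ)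
  {q : E → ℝ} (hq : Measurable q) (hI : ∀ x, q x ∈ Icc (0 : ℝ) 1)

/-- The penalized form `𝓔_β(f, g) + n ⟨q f, g⟩`. -/
noncomputable def penalizedL (β n : ℝ) : 𝓔.FormSpace →L[ℝ] 𝓔.FormSpace →L[ℝ] ℝ :=
  𝓔.shiftedL β + n • (ContinuousLinearMap.compL ℝ 𝓔.FormSpace (Lp ℝ 2 μ) ℝ).flip 𝓔.incl ∘L
    (innerSL ℝ ∘L (mulLp μ hq hI ∘L 𝓔.incl))

theorem penalizedL_apply (β n : ℝ) (f g : 𝓔.FormSpace) : 𝓔.penalizedL hq hI β n f g =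
    𝓔.shiftedL β f g + n * inner ℝ (mulLp μ hq hI (𝓔.incl f)) (𝓔.incl g) := rfl

end LowerBoundedSemiDirichletForm

namespace HuntProcess

variable {E : Type*} [MetricSpace E] [LocallyCompactSpace E] [TopologicalSpace.SeparableSpace E]
  [MeasurableSpace E] [BorelSpace E]
  {S : Type*} [MeasurableSpace S] {X : HuntProcess E S} {φ : E → ℝ}

theorem killedWeight_nonneg (β n : ℝ) (p : S × ℝ) : 0 ≤ X.killedWeight β φ n p := by
  unfold killedWeight; positivity

theorem killedWeight_le (hI : ∀ x, φ x ∈ Icc (0 : ℝ) 1) (β : ℝ) {n : ℝ} (hn : 0 ≤ n) (p : S × ℝ)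
    (hp : 0 ≤ p.2) : X.killedWeight β φ n p ≤ Real.exp (-β * p.2) := by
  refine mul_le_of_le_one_right (Real.exp_pos _).le (Real.exp_le_one_iff.mpr ?_)
  have := clock_nonneg (X := X) hI hp
  nlinarith

theorem occ_killedWeight_le (hφ : Continuous φ) (hs : HasCompactSupport φ)
    (hI : ∀ x, φ x ∈ Icc (0 : ℝ) 1) (β : ℝ) {n : ℝ} (hn : 0 ≤ n) (x : E) :
    X.occ (X.killedWeight β φ n) (x : OnePoint E) ≤ X.resolventKernel β x :=
  occ_mono (measurable_killedWeight hφ hs hI β n) (by fun_prop) (killedWeight_le hI β hn) _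

theorem ae_pathMeasure_nonneg (x : OnePoint E) : ∀ᵐ p ∂(X.pathMeasure x), 0 ≤ p.2 :=
  Measure.quasiMeasurePreserving_snd.ae (ae_restrict_mem measurableSet_Ici)

/-- Continuity of occupation integrals under dominated convergence of the weights. -/
theorem tendsto_integral_occ {β : ℝ} {Z : ℕ → S × ℝ → ℝ} {Z' : S × ℝ → ℝ}
    (hZ : ∀ n, Measurable (Z n)) (hZ' : Measurable Z') (h0 : ∀ n p, 0 ≤ Z n p) (h0' : ∀ p, 0 ≤ Z' p)
    (hle : ∀ n p, 0 ≤ p.2 → Z n p ≤ Real.exp (-β * p.2))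
    (hlim : ∀ p : S × ℝ, 0 ≤ p.2 → Tendsto (fun n => Z n p) atTop (𝓝 (Z' p)))
    {f : E → ℝ} (hf : Measurable f) {x : E} (hi : Integrable f (X.resolventKernel β x)) :
    Tendsto (fun n => ∫ y, f y ∂(X.occ (Z n) (x : OnePoint E))) atTop
      (𝓝 (∫ y, f y ∂(X.occ Z' (x : OnePoint E)))) := by
  rw [integral_occ hZ' h0' (x : OnePoint E) hf]
  refine Tendsto.congr (fun n => (integral_occ (hZ n) (h0 n) (x : OnePoint E) hf).symm) ?_
  rw [resolventKernel_apply, integrable_occ_iff (by fun_prop) (fun p => (Real.exp_pos _).le) _ hf]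
    at hi
  have hF : Measurable fun p => cemeteryExt f (X.pos p) :=
    (measurable_cemeteryExt hf).comp X.measurable_pos
  refine tendsto_integral_of_dominated_convergence _
    (fun n => ((hZ n).mul hF).aestronglyMeasurable) hi.norm (fun n => ?_) ?_
  · filter_upwards [ae_pathMeasure_nonneg (X := X) (x : OnePoint E)] with p hp
    rw [norm_mul, norm_mul, Real.norm_of_nonneg (h0 n p), Real.norm_of_nonneg (Real.exp_pos _).le]
    exact mul_le_mul_of_nonneg_right (hle n p hp) (norm_nonneg _)
  · filter_upwards [ae_pathMeasure_nonneg (X := X) (x : OnePoint E)] with p hp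
    exact (hlim p hp).mul_const _

theorem abs_integral_occ_le {β : ℝ} {Z : S × ℝ → ℝ} (hZ : Measurable Z)
    (hle : ∀ p : S × ℝ, 0 ≤ p.2 → Z p ≤ Real.exp (-β * p.2)) {f : E → ℝ} {x : E}
    (hi : Integrable f (X.resolventKernel β x)) :
    |∫ y, f y ∂(X.occ Z (x : OnePoint E))| ≤ ∫ y, |f y| ∂(X.resolventKernel β x) :=
  (norm_integral_le_integral_norm f).trans
    (integral_mono_measure (occ_mono hZ (by fun_prop) hle _)
      (Eventually.of_forall fun y => norm_nonneg (f y)) hi.norm)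

section Generated

variable {μ : Measure E} {𝓔 : LowerBoundedSemiDirichletForm μ} {β : ℝ}

/-- The solution of the penalized problem is the resolvent of the process killed at rate
`n (1 - φ)`. -/
theorem IsGeneratedBy.ae_eq_killed (hX : X.IsGeneratedBy 𝓔) (hβ : 𝓔.β₀ < β) (hφ : Continuous φ)
    (hs : HasCompactSupport φ) (hI : ∀ x, φ x ∈ Icc (0 : ℝ) 1) (hq : Measurable fun x => 1 - φ x)
    (hqI : ∀ x, 1 - φ x ∈ Icc (0 : ℝ) 1) {n : ℝ} (hn : 0 ≤ n) (h : Lp ℝ 2 μ) {w : 𝓔.FormSpace}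
    (hw : ∀ g, 𝓔.penalizedL hq hqI β n w g = 𝓔.innerFunctional h g) :
    𝓔.incl w =ᵐ[μ] fun x => ∫ y, h y ∂(X.occ (X.killedWeight β φ n) (x : OnePoint E)) := by
  -- Moving the penalty to the right side exhibits $w$ as $R_\beta k$.
  set k : Lp ℝ 2 μ := h - n • mulLp μ hq hqI (𝓔.incl w)
  have hk : k =ᵐ[μ] fun x => h x - n * (1 - φ x) * 𝓔.incl w x := by
    filter_upwards [Lp.coeFn_sub h (n • mulLp μ hq hqI (𝓔.incl w)),
      Lp.coeFn_smul n (mulLp μ hq hqI (𝓔.incl w)), coeFn_mulLp hq hqI (𝓔.incl w)] with x a b c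
    rw [a, Pi.sub_apply, b, Pi.smul_apply, c, smul_eq_mul, mul_assoc]
  have hwk : ∀ g, 𝓔.shiftedL β w g = 𝓔.innerFunctional k g := fun g => by
    have := hw g
    rw [𝓔.penalizedL_apply] at this
    rw [𝓔.innerFunctional_apply, inner_sub_left, real_inner_smul_left,
      ← 𝓔.innerFunctional_apply h, ← this, add_sub_cancel_right]
  -- Only the integrability of $h$ against the resolvent kernel is drawn from $w'$.
  obtain ⟨w', hw'⟩ := exists_shiftedL_eq hβ h
  have hka := hX.ae_integrable hβ k hwk
  filter_upwards [hka, hX.ae_integrable hβ h hw', hX.ae_ae hβ hk, hX.ae_ae hβ hka]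
    with x h1 h2 h3 h4
  have hle := occ_killedWeight_le (X := X) hφ hs hI β hn x
  have h5 := h1.1.mono_measure hle
  have h6 := h2.1.mono_measure hle
  rw [h1.2, integral_resolvent_eq hφ hs hI β hn h1.1]
  -- Here $n(1-\varphi)R_\beta k=n(1-\varphi)w=h-k$ a.e. for the killed occupation measure, so
  -- $R_\beta k=Uk+U(h-k)=Uh$.
  have h7 : ∫ y, n * (1 - φ y) * ∫ z, k z ∂(X.resolventKernel β y)
      ∂(X.occ (X.killedWeight β φ n) (x : OnePoint E)) =
      ∫ y, (h y - k y) ∂(X.occ (X.killedWeight β φ n) (x : OnePoint E)) := by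
    refine integral_congr_ae ?_
    filter_upwards [hle.absolutelyContinuous.ae_le h3, hle.absolutelyContinuous.ae_le h4]
      with y a b
    rw [← b.2, a]; ring
  rw [h7, integral_sub h6 h5]; ring

end Generated

variable (X) in
/-- The discount factor restricted to the times before the process has left `{φ = 1}`. -/
noncomputable def survivalWeight (β : ℝ) (φ : E → ℝ) (p : S × ℝ) : ℝ :=
  {p : S × ℝ | X.clock φ p = 0}.indicator (fun p => Real.exp (-β * p.2)) p

theorem survivalWeight_nonneg (β : ℝ) (p : S × ℝ) : 0 ≤ X.survivalWeight β φ p :=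
  indicator_nonneg (fun _ _ => (Real.exp_pos _).le) _

theorem survivalWeight_le (β : ℝ) (p : S × ℝ) :
    X.survivalWeight β φ p ≤ Real.exp (-β * p.2) :=
  indicator_le_self' (fun _ _ => (Real.exp_pos _).le) _

theorem measurable_survivalWeight (hφ : Continuous φ) (hs : HasCompactSupport φ)
    (hI : ∀ x, φ x ∈ Icc (0 : ℝ) 1) (β : ℝ) : Measurable (X.survivalWeight β φ) :=
  Measurable.indicator (by fun_prop) (measurable_clock hφ hs hI (measurableSet_singleton 0))

theorem tendsto_killedWeight (hI : ∀ x, φ x ∈ Icc (0 : ℝ) 1) (β : ℝ) (p : S × ℝ) (hp : 0 ≤ p.2) :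
    Tendsto (fun n : ℕ => X.killedWeight β φ n p) atTop (𝓝 (X.survivalWeight β φ p)) := by
  unfold killedWeight survivalWeight
  rcases (clock_nonneg (X := X) hI hp).eq_or_lt with h | h
  · rw [indicator_of_mem (show p ∈ {p | X.clock φ p = 0} from h.symm)]
    simp [← h]
  · rw [indicator_of_notMem (show p ∉ {p | X.clock φ p = 0} from h.ne')]
    have h1 : Tendsto (fun n : ℕ => -(n : ℝ) * X.clock φ p) atTop atBot := by
      simp_rw [neg_mul]
      exact tendsto_neg_atTop_atBot.comp
        (tendsto_natCast_atTop_atTop.atTop_mul_const h)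
    simpa using (Real.tendsto_exp_atBot.comp h1).const_mul (Real.exp (-β * p.2))

theorem clock_mono (hφ : Continuous φ) (hs : HasCompactSupport φ)
    (hI : ∀ x, φ x ∈ Icc (0 : ℝ) 1) (ω : S) {s t : ℝ} (hst : s ≤ t) :
    X.clock φ (ω, s) ≤ X.clock φ (ω, t) := by
  have h := intervalIntegral.integral_add_adjacent_intervals
    (intervalIntegrable_rate (X := X) hφ hs hI ω 0 s) (intervalIntegrable_rate hφ hs hI ω s t)
  have h2 : 0 ≤ ∫ r in s..t, X.rate φ (ω, r) :=
    intervalIntegral.integral_nonneg hst fun r _ => (rate_mem (X := X) hI (ω, r)).1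
  unfold clock; linarith

/-- Before the clock starts the process stays in `{φ = 1}`. -/
theorem rate_eq_zero_of_clock_eq_zero (hφ : Continuous φ) (hs : HasCompactSupport φ)
    (hI : ∀ x, φ x ∈ Icc (0 : ℝ) 1) {ω : S} {s t : ℝ} (hs0 : 0 ≤ s) (hst : s < t)
    (h : X.clock φ (ω, t) = 0) : X.rate φ (ω, s) = 0 := by
  have h0 : ∀ r ∈ Icc s t, X.clock φ (ω, r) = 0 := fun r hr =>
    le_antisymm (h ▸ clock_mono hφ hs hI ω hr.2) (clock_nonneg hI (hs0.trans hr.1))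
  have h1 := (clock_hasDerivWithinAt (X := X) hφ hs hI ω s).mono
    (Icc_subset_Ici_self : Icc s t ⊆ Ici s)
  have h2 : HasDerivWithinAt (fun t => X.clock φ (ω, t)) 0 (Icc s t) s :=
    (hasDerivWithinAt_const s (Icc s t) (0 : ℝ)).congr h0 (h0 s (left_mem_Icc.mpr hst.le))
  exact (uniqueDiffOn_Icc hst s (left_mem_Icc.mpr hst.le)).eq_deriv _ h1 h2

/-- If the clock is still zero at some $t>0$, right-continuity forces the rate at time $0$ to
vanish, that is $\varphi(x)=1$. From any other starting point the weight is zero for all $t>0$. -/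
theorem integral_occ_survivalWeight_eq_zero (hφ : Continuous φ) (hs : HasCompactSupport φ)
    (hI : ∀ x, φ x ∈ Icc (0 : ℝ) 1) (β : ℝ) {f : E → ℝ} (hf : Measurable f) {x : E}
    (hx : φ x ≠ 1) : ∫ y, f y ∂(X.occ (X.survivalWeight β φ) (x : OnePoint E)) = 0 := by
  rw [integral_occ (measurable_survivalWeight hφ hs hI β) (survivalWeight_nonneg β) _ hf]
  refine integral_eq_zero_of_ae ?_
  have h1 : ∀ᵐ p ∂(X.pathMeasure x), p.2 ∈ Ioi (0 : ℝ) := by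
    refine Measure.quasiMeasurePreserving_snd.ae (p := fun t => t ∈ Ioi (0 : ℝ)) ?_
    rw [← restrict_Ioi_eq_restrict_Ici]
    exact ae_restrict_mem measurableSet_Ioi
  have h2 : ∀ᵐ p ∂(X.pathMeasure x), X.X 0 p.1 = x :=
    Measure.quasiMeasurePreserving_fst.ae (X.start x)
  filter_upwards [h1, h2] with p hp hp0
  have : p ∉ {p | X.clock φ p = 0} := fun h => hx (by
    have h3 := rate_eq_zero_of_clock_eq_zero (X := X) hφ hs hI (ω := p.1) le_rfl hp h
    simp only [rate, pos, Real.toNNReal_zero, hp0, cemeteryExt_coe] at h3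
    linarith)
  rw [survivalWeight, indicator_of_notMem this, zero_mul, Pi.zero_apply]

end HuntProcess

/-! ### Passage to the limit in the penalization and in the exhaustion -/

namespace HuntProcess

variable {E : Type*} [MetricSpace E] [LocallyCompactSpace E] [TopologicalSpace.SeparableSpace E]
  [MeasurableSpace E] [BorelSpace E]
  {S : Type*} [MeasurableSpace S] {X : HuntProcess E S} {φ : E → ℝ}
  {μ : Measure E} {𝓔 : LowerBoundedSemiDirichletForm μ} {β : ℝ}

/-- Supplies $R_\beta|h|\in L^2$, which dominates the occupation integral of $h$ for every
nonnegative weight at most $e^{-\beta t}$. -/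
theorem IsGeneratedBy.exists_lp_eq_integral_abs (hX : X.IsGeneratedBy 𝓔) (hβ : 𝓔.β₀ < β)
    (h : Lp ℝ 2 μ) : ∃ k : Lp ℝ 2 μ, ∀ᵐ x ∂μ, Integrable h (X.resolventKernel β x) ∧
      ∫ y, |h y| ∂(X.resolventKernel β x) = k x := by
  obtain ⟨w, hw⟩ := exists_shiftedL_eq hβ h
  obtain ⟨w', hw'⟩ := exists_shiftedL_eq hβ |h|
  refine ⟨𝓔.incl w', ?_⟩
  filter_upwards [hX.ae_integrable hβ h hw, hX.ae_integrable hβ |h| hw',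
    hX.ae_ae hβ (Lp.coeFn_abs h)] with x h1 h2 h3
  exact ⟨h1.1, by rw [h2.2]; exact integral_congr_ae (h3.mono fun y hy => hy.symm)⟩

/-- Bounded weak convergence in the form domain of functions given by occupation integrals. -/
theorem IsGeneratedBy.exists_limit (hX : X.IsGeneratedBy 𝓔) (hβ : 𝓔.β₀ < β) {h : Lp ℝ 2 μ}
    {Z : ℕ → S × ℝ → ℝ} {Z' : S × ℝ → ℝ}
    (hZ : ∀ n, Measurable (Z n)) (hZ' : Measurable Z') (h0 : ∀ n p, 0 ≤ Z n p) (h0' : ∀ p, 0 ≤ Z' p)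
    (hle : ∀ n (p : S × ℝ), 0 ≤ p.2 → Z n p ≤ Real.exp (-β * p.2))
    (hlim : ∀ p : S × ℝ, 0 ≤ p.2 → Tendsto (fun n => Z n p) atTop (𝓝 (Z' p)))
    {w : ℕ → 𝓔.FormSpace} {M : ℝ} (hM : ∀ n, ‖w n‖ ≤ M)
    (hw : ∀ n, 𝓔.incl (w n) =ᵐ[μ] fun x => ∫ y, h y ∂(X.occ (Z n) (x : OnePoint E))) :
    ∃ z : 𝓔.FormSpace, ‖z‖ ≤ M ∧
      (𝓔.incl z =ᵐ[μ] fun x => ∫ y, h y ∂(X.occ Z' (x : OnePoint E))) ∧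
      ∀ ℓ : 𝓔.FormSpace →L[ℝ] ℝ, Tendsto (fun n => ℓ (w n)) atTop (𝓝 (ℓ z)) := by
  have hm : Measurable h := (Lp.stronglyMeasurable h).measurable
  obtain ⟨k, hk⟩ := hX.exists_lp_eq_integral_abs hβ h
  obtain ⟨y, hy, hlimy⟩ := exists_lp_limit_of_dominated (f := fun n => 𝓔.incl (w n)) (g := k)
    (v := fun x => ∫ y, h y ∂(X.occ Z' (x : OnePoint E))) (fun n => by
      filter_upwards [hw n, hk] with x h1 h2
      rw [h1, ← h2.2]
      exact abs_integral_occ_le (hZ n) (hle n) h2.1) (by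
      filter_upwards [ae_all_iff.mpr hw, hk] with x h1 h2
      simp_rw [h1]
      exact tendsto_integral_occ hZ hZ' h0 h0' hle hlim hm h2.1)
  obtain ⟨z, rfl, hzM, hz⟩ := exists_weak_limit 𝓔.incl 𝓔.incl_injective w hM hlimy
  exact ⟨z, hzM, hy, hz⟩

/-- The resolvent of the process killed on leaving `{φ = 1}`. -/
theorem IsGeneratedBy.exists_survival (hX : X.IsGeneratedBy 𝓔) (hβ : 𝓔.β₀ < β)
    (hφ : Continuous φ) (hs : HasCompactSupport φ) (hI : ∀ x, φ x ∈ Icc (0 : ℝ) 1)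
    (h : Lp ℝ 2 μ) : ∃ z : 𝓔.FormSpace, ‖z‖ ≤ ‖h‖ / 𝓔.coerc β ∧
      z ∈ 𝓔.vanishing {x | φ x ≠ 1} ∧
      (∀ g ∈ 𝓔.vanishing {x | φ x ≠ 1}, 𝓔.shiftedL β z g = 𝓔.innerFunctional h g) ∧
      𝓔.incl z =ᵐ[μ] fun x => ∫ y, h y ∂(X.occ (X.survivalWeight β φ) (x : OnePoint E)) := by
  have hq : Measurable fun x => 1 - φ x := by have := hφ.measurable; fun_prop
  have hqI : ∀ x, 1 - φ x ∈ Icc (0 : ℝ) 1 := fun x =>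
    ⟨sub_nonneg.mpr (hI x).2, sub_le_self _ (hI x).1⟩
  -- The penalty is nonnegative, so coercivity and the bound on $\|w_n\|$ are uniform in $n$.
  have hle : ∀ (n : ℕ) (f : 𝓔.FormSpace), 𝓔.shiftedL β f f ≤ 𝓔.penalizedL hq hqI β n f f :=
    fun n f => by
      rw [𝓔.penalizedL_apply]
      exact le_add_of_nonneg_right (mul_nonneg n.cast_nonneg (inner_mulLp_nonneg hq hqI _))
  have hex : ∀ n : ℕ, ∃ w : 𝓔.FormSpace, ∀ g, 𝓔.penalizedL hq hqI β n w g =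
      𝓔.innerFunctional h g := fun n => by
    obtain ⟨w, hw, -⟩ := existsUnique_of_coercive (𝓔.penalizedL hq hqI β n) (𝓔.coerc_pos hβ)
      (fun f => (𝓔.coerc_mul_le β f).trans (hle n f)) ⊤ isClosed_univ (𝓔.innerFunctional h)
    exact ⟨w, fun g => hw.2 g trivial⟩
  choose w hw using hex
  obtain ⟨z, hzM, hz, hlim⟩ := hX.exists_limit hβ (h := h)
    (Z := fun n : ℕ => X.killedWeight β φ n) (Z' := X.survivalWeight β φ)
    (fun n => measurable_killedWeight hφ hs hI β n) (measurable_survivalWeight hφ hs hI β)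
    (fun n => killedWeight_nonneg β n) (survivalWeight_nonneg β)
    (fun n => killedWeight_le hI β n.cast_nonneg) (tendsto_killedWeight hI β)
    (fun n => norm_le_of_shiftedL_eq hβ ((hle n (w n)).trans (hw n (w n)).le))
    (fun n => hX.ae_eq_killed hβ hφ hs hI hq hqI n.cast_nonneg h (hw n))
  refine ⟨z, hzM, ?_, fun g hg => ?_, hz⟩
  · filter_upwards [hz] with x hx h1
    rw [hx]
    exact integral_occ_survivalWeight_eq_zero hφ hs hI β (Lp.stronglyMeasurable h).measurable h1
  -- Test functions vanishing on $\{\varphi\ne1\}$ do not see the penalty, so their equation is the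
  -- same for every $n$.
  · refine tendsto_nhds_unique (hlim ((𝓔.shiftedL β).flip g))
      (tendsto_const_nhds.congr fun n => ?_)
    rw [ContinuousLinearMap.flip_apply, ← hw n, 𝓔.penalizedL_apply,
      inner_mulLp_eq_zero hq hqI _ (g := 𝓔.incl g), mul_zero, add_zero]
    filter_upwards [hg] with x hx hx'
    exact hx fun h1 => hx' (by rw [h1, sub_self])

variable (X) in
/-- The discount factor restricted to the times at which the process has not left `{φ m = 1}` for
some `m`. -/
noncomputable def limitWeight (β : ℝ) (φ : ℕ → E → ℝ) (p : S × ℝ) : ℝ :=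
  {p : S × ℝ | ∃ m, X.clock (φ m) p = 0}.indicator (fun p => Real.exp (-β * p.2)) p

theorem limitWeight_nonneg (β : ℝ) (φ : ℕ → E → ℝ) (p : S × ℝ) : 0 ≤ X.limitWeight β φ p :=
  indicator_nonneg (fun _ _ => (Real.exp_pos _).le) _

theorem limitWeight_le (β : ℝ) (φ : ℕ → E → ℝ) (p : S × ℝ) :
    X.limitWeight β φ p ≤ Real.exp (-β * p.2) :=
  indicator_le_self' (fun _ _ => (Real.exp_pos _).le) _

theorem measurable_limitWeight {φ : ℕ → E → ℝ} (hφ : ∀ m, Continuous (φ m))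
    (hs : ∀ m, HasCompactSupport (φ m)) (hI : ∀ m x, φ m x ∈ Icc (0 : ℝ) 1) (β : ℝ) :
    Measurable (X.limitWeight β φ) := by
  refine Measurable.indicator (by fun_prop) ?_
  rw [ofPred_exists]
  exact MeasurableSet.iUnion fun m =>
    measurable_clock (hφ m) (hs m) (hI m) (measurableSet_singleton 0)

theorem clock_anti {φ ψ : E → ℝ} (hφ : Continuous φ) (hs : HasCompactSupport φ)
    (hI : ∀ x, φ x ∈ Icc (0 : ℝ) 1) (hψ : Continuous ψ) (hs' : HasCompactSupport ψ)
    (hI' : ∀ x, ψ x ∈ Icc (0 : ℝ) 1) (h : φ ≤ ψ) {p : S × ℝ} (hp : 0 ≤ p.2) :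
    X.clock ψ p ≤ X.clock φ p := by
  refine intervalIntegral.integral_mono_on hp (intervalIntegrable_rate hψ hs' hI' _ _ _)
    (intervalIntegrable_rate hφ hs hI _ _ _) fun s _ => ?_
  unfold rate
  generalize X.pos (p.1, s) = z
  induction z with
  | infty => simp
  | coe x => simpa only [cemeteryExt_coe] using sub_le_sub_left (h x) 1

/-- The approximants vanish a.e. on the open sets $\{\varphi_m\ne1\}\supseteq\Omega^c$, hence lie in
$\mathcal F^\Omega$, which is weakly closed. A test function vanishing a.e. off a compact
$K\subseteq\Omega$ is admissible once $\varphi_m=1$ on $K$. Since the equation holds on a closed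
subspace, spectral synthesis extends it to all of $\mathcal F^\Omega$. -/
theorem IsGeneratedBy.isWeakSolution_limit (hX : X.IsGeneratedBy 𝓔) (h𝓔 : 𝓔.IsRegular)
    (hβ : 𝓔.β₀ < β) {Ω : Set E} {φ : ℕ → E → ℝ} (hφ : ∀ m, Continuous (φ m))
    (hs : ∀ m, HasCompactSupport (φ m)) (hI : ∀ m x, φ m x ∈ Icc (0 : ℝ) 1)
    (hΩ : ∀ m, ∀ x ∉ Ω, φ m x = 0) (hmono : Monotone φ)
    (hK : ∀ K, IsCompact K → K ⊆ Ω → ∃ m, ∀ x ∈ K, φ m x = 1) (h : Lp ℝ 2 μ) :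
    ∃ z ∈ 𝓔.partSub Ω, (∀ g ∈ 𝓔.partSub Ω, 𝓔.shiftedL β z g = 𝓔.innerFunctional h g) ∧
      𝓔.incl z =ᵐ[μ] fun x => ∫ y, h y ∂(X.occ (X.limitWeight β φ) (x : OnePoint E)) := by
  choose w hwM hwv hwg hw using fun m => hX.exists_survival hβ (hφ m) (hs m) (hI m) h
  obtain ⟨z, -, hz, hlim⟩ := hX.exists_limit hβ (h := h)
    (Z := fun m => X.survivalWeight β (φ m)) (Z' := X.limitWeight β φ)
    (fun m => measurable_survivalWeight (hφ m) (hs m) (hI m) β) (measurable_limitWeight hφ hs hI β)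
    (fun m => survivalWeight_nonneg β) (limitWeight_nonneg β φ)
    (fun m p _ => survivalWeight_le β p) (fun p hp => by
      refine tendsto_const_nhds.congr' ?_
      by_cases hex : ∃ m, X.clock (φ m) p = 0
      · obtain ⟨m, hm⟩ := hex
        filter_upwards [eventually_ge_atTop m] with k hk
        have hk0 : X.clock (φ k) p = 0 := le_antisymm
          (hm ▸ clock_anti (hφ m) (hs m) (hI m) (hφ k) (hs k) (hI k) (hmono hk) hp)
          (clock_nonneg (hI k) hp)
        rw [limitWeight, survivalWeight,
          indicator_of_mem (show p ∈ {p | X.clock (φ k) p = 0} from hk0),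
          indicator_of_mem (show p ∈ {p | ∃ m, X.clock (φ m) p = 0} from ⟨m, hm⟩)]
      · refine Eventually.of_forall fun k => ?_
        change X.limitWeight β φ p = X.survivalWeight β (φ k) p
        rw [limitWeight, survivalWeight,
          indicator_of_notMem (show p ∉ {p | X.clock (φ k) p = 0} from fun hk => hex ⟨k, hk⟩),
          indicator_of_notMem (show p ∉ {p | ∃ m, X.clock (φ m) p = 0} from hex)]) hwM hw
  have hopen : ∀ m, IsOpen {x | φ m x ≠ 1} := fun m => isOpen_ne.preimage (hφ m)
  have hmem : z ∈ 𝓔.partSub Ω := mem_of_weak_limit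
    (LowerBoundedSemiDirichletForm.isClosed_partSub Ω) (fun m =>
      h𝓔.mem_partSub_of_vanishing (hopen m) (fun x hx => by
        simp [hΩ m x hx]) (hwv m)) hlim
  refine ⟨z, hmem, fun g hg => ?_, hz⟩
  have key : 𝓔.partSub Ω ≤ LinearMap.ker (𝓔.shiftedL β z - 𝓔.innerFunctional h).toLinearMap := by
    refine h𝓔.partSub_le (ContinuousLinearMap.isClosed_ker _) fun K hKc hKΩ g hg => ?_
    obtain ⟨m, hm⟩ := hK K hKc hKΩ
    change (𝓔.shiftedL β z - 𝓔.innerFunctional h) g = 0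
    rw [sub_apply, sub_eq_zero]
    refine tendsto_nhds_unique (hlim ((𝓔.shiftedL β).flip g)) (tendsto_const_nhds.congr' ?_)
    filter_upwards [eventually_ge_atTop m] with k hk
    rw [ContinuousLinearMap.flip_apply]
    refine (hwg k g (Eventually.mono (f := ae μ) hg fun x hx hne => ?_)).symm
    exact hx fun hxK => hne (le_antisymm (hI k x).2 (hm x hxK ▸ hmono hk x))
  have := key hg
  change (𝓔.shiftedL β z - 𝓔.innerFunctional h) g = 0 at this
  rwa [sub_apply, sub_eq_zero] at this

end HuntProcess

/-! ### Hitting times and the exit from $\Omega$ -/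

namespace HuntProcess

section Hitting

variable {E : Type*} [TopologicalSpace E] {S : Type*} [MeasurableSpace S] {X : HuntProcess E S}

variable (X) in
/-- The first time at which the process is in `V`. -/
noncomputable def hit (V : Set (OnePoint E)) (ω : S) : WithTop ℝ≥0 :=
  ⨅ (t : ℝ≥0) (_ : X.X t ω ∈ V), (t : WithTop ℝ≥0)

theorem hit_le {V : Set (OnePoint E)} {ω : S} {t : ℝ≥0} (h : X.X t ω ∈ V) : X.hit V ω ≤ t :=
  iInf₂_le t h

theorem hit_lt_iff {V : Set (OnePoint E)} {ω : S} {a : WithTop ℝ≥0} :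
    X.hit V ω < a ↔ ∃ t : ℝ≥0, X.X t ω ∈ V ∧ (t : WithTop ℝ≥0) < a := by
  simp only [hit, iInf_lt_iff, exists_prop]

theorem hit_anti {V W : Set (OnePoint E)} (h : V ⊆ W) (ω : S) : X.hit W ω ≤ X.hit V ω :=
  le_iInf₂ fun _ ht => hit_le (h ht)

theorem exists_Ico_subset {V : Set (OnePoint E)} (hV : IsOpen V) {ω : S} {t : ℝ≥0}
    (h : X.X t ω ∈ V) : ∃ u > t, ∀ s ∈ Ico t u, X.X s ω ∈ V :=
  mem_nhdsGE_iff_exists_Ico_subset.mp (X.rightCont ω t (hV.mem_nhds h))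

/-- A right-continuous path that enters an open set stays there for a while, so it is seen there at
a time of a countable dense set. This gives $\{\mathrm{hit}<t\}$, and right-continuity of the
filtration does the rest. -/
theorem isStoppingTime_hit {V : Set (OnePoint E)} (hV : IsOpen V) :
    IsStoppingTime X.filt (X.hit V) := by
  have := X.rightCont_filt
  refine isStoppingTime_of_measurableSet_lt_of_isRightContinuous fun t => ?_
  obtain ⟨D, hDc, hD⟩ := TopologicalSpace.exists_countable_dense ℝ≥0
  have : {ω | X.hit V ω < t} = ⋃ s ∈ D ∩ Iio t, X.X s ⁻¹' V := by
    ext ω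
    simp only [mem_ofPred_eq, hit_lt_iff, mem_iUnion, mem_preimage, exists_prop]
    constructor
    · rintro ⟨s, hs, hst⟩
      obtain ⟨u, hu, hsu⟩ := exists_Ico_subset hV hs
      obtain ⟨r, hrD, hr⟩ := hD.exists_between (lt_min hu (WithTop.coe_lt_coe.mp hst))
      exact ⟨r, ⟨hrD, hr.2.trans_le (min_le_right _ _)⟩,
        hsu r ⟨hr.1.le, hr.2.trans_le (min_le_left _ _)⟩⟩
    · rintro ⟨s, hs, hsV⟩
      exact ⟨s, hsV, WithTop.coe_lt_coe.mpr hs.2⟩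
  rw [this]
  refine MeasurableSet.biUnion (hDc.mono inter_subset_left) fun s hs => ?_
  exact X.filt.mono (le_of_lt hs.2) _ (X.adapted s hV.measurableSet)

/-- At a finite hitting time of `V` the process is in no open set disjoint from `V`. -/
theorem notMem_of_hit_eq {V W : Set (OnePoint E)} (hW : IsOpen W) (hVW : Disjoint V W) {ω : S}
    {t : ℝ≥0} (h : X.hit V ω = t) : X.X t ω ∉ W := fun hx => by
  obtain ⟨u, hu, hsu⟩ := exists_Ico_subset hW hx
  obtain ⟨s, hs, hsu'⟩ := hit_lt_iff.mp (h.trans_lt (WithTop.coe_lt_coe.mpr hu))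
  have hts : t ≤ s := WithTop.coe_le_coe.mp (h ▸ hit_le hs)
  exact hVW.le_bot ⟨hs, hsu s ⟨hts, WithTop.coe_lt_coe.mp hsu'⟩⟩

theorem mem_of_lt_exitTime {Ω : Set E} {ω : S} {t : ℝ≥0} (h : (t : ℝ≥0∞) < X.exitTime Ω ω) :
    X.X t ω ∈ ((↑) : E → OnePoint E) '' Ω := by
  by_contra hx
  exact absurd (iInf₂_le t hx) (not_le.mpr h)

theorem le_exitTime {Ω : Set E} {ω : S} {a : ℝ≥0∞}
    (h : ∀ t : ℝ≥0, (t : ℝ≥0∞) < a → X.X t ω ∈ ((↑) : E → OnePoint E) '' Ω) :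
    a ≤ X.exitTime Ω ω :=
  le_iInf₂ fun t ht => not_lt.mp fun hlt => ht (h t hlt)

end Hitting

variable {E : Type*} [MetricSpace E] [LocallyCompactSpace E] [TopologicalSpace.SeparableSpace E]
  [MeasurableSpace E] [BorelSpace E]
  {S : Type*} [MeasurableSpace S] {X : HuntProcess E S}

theorem hit_le_of_clock_ne_zero {φ : E → ℝ} {ω : S} {t : ℝ} (ht : 0 ≤ t)
    (h : X.clock φ (ω, t) ≠ 0) : X.hit {z | cemeteryExt φ z ≠ 1} ω ≤ t.toNNReal := by
  by_contra hlt
  refine h (intervalIntegral.integral_zero_ae (Eventually.of_forall fun s hs => ?_))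
  by_contra hne
  have h1 : X.X s.toNNReal ω ∈ {z | cemeteryExt φ z ≠ 1} := fun h1 => hne (by
    change 1 - cemeteryExt φ (X.X s.toNNReal ω) = 0
    rw [h1, sub_self])
  rw [uIoc_of_le ht] at hs
  exact hlt ((hit_le h1).trans (WithTop.coe_le_coe.mpr (Real.toNNReal_mono hs.2)))

/-- The process leaves `Ω` exactly when it has left all the sets `{φ m = 1}` of an exhaustion. -/
theorem ae_exists_clock_eq_zero_iff {Ω : Set E} (hΩo : IsOpen Ω) {φ : ℕ → E → ℝ}
    (hφ : ∀ m, Continuous (φ m)) (hs : ∀ m, HasCompactSupport (φ m))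
    (hI : ∀ m x, φ m x ∈ Icc (0 : ℝ) 1) (hΩ : ∀ m, ∀ x ∉ Ω, φ m x = 0) (hmono : Monotone φ)
    (hK : ∀ K, IsCompact K → K ⊆ Ω → ∃ m, ∀ x ∈ K, φ m x = 1) (x : OnePoint E) :
    ∀ᵐ ω ∂(X.P x), ∀ t : ℝ, 0 ≤ t → t ≠ (X.exitTime Ω ω).toReal →
      ((∃ m, X.clock (φ m) (ω, t) = 0) ↔ ENNReal.ofReal t < X.exitTime Ω ω) := by
  set V : ℕ → Set (OnePoint E) := fun m => {z | cemeteryExt (φ m) z ≠ 1} with hV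
  have hVo : ∀ m, IsOpen (V m) := fun m =>
    isOpen_ne.preimage (continuous_cemeteryExt (hφ m) (hs m))
  have hVa : ∀ {m k}, m ≤ k → V k ⊆ V m := fun {m k} hmk z hz h1 => hz (by
    induction z with
    | infty => simp at h1
    | coe y =>
      rw [cemeteryExt_coe] at h1 ⊢
      exact le_antisymm (hI k y).2 (h1 ▸ hmono hmk y))
  filter_upwards [X.quasiLeftCont (fun m => X.hit (V m)) (fun ω => ⨆ m, X.hit (V m) ω)
    (fun m => isStoppingTime_hit (hVo m)) (fun ω m k hmk => hit_anti (hVa hmk) ω)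
    (fun ω => isLUB_iSup) x] with ω hω t ht htne
  constructor
  -- A zero clock keeps the path in $\Omega$ before $t$, hence $t\le\tau_\Omega$; equality is
  -- excluded by hypothesis. If $\tau_\Omega=\infty$, `toReal` returns $0$ and the excluded time is
  -- harmless.
  · rintro ⟨m, hm⟩
    refine lt_of_le_of_ne (le_exitTime fun s hst => ?_) fun heq => htne ?_
    · have hst' : (s : ℝ) < t := by
        rwa [← ENNReal.ofReal_coe_nnreal, ENNReal.ofReal_lt_ofReal_iff_of_nonneg s.coe_nonneg] at hst
      have h1 := rate_eq_zero_of_clock_eq_zero (X := X) (hφ m) (hs m) (hI m) s.coe_nonneg hst' hm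
      simp only [rate, pos, Real.toNNReal_coe] at h1
      revert h1
      generalize X.X s ω = z
      induction z with
      | infty => simp
      | coe y =>
        intro h1
        refine ⟨y, by_contra fun hy => ?_, rfl⟩
        rw [cemeteryExt_coe, hΩ m y hy] at h1
        norm_num at h1
    · rw [← heq, ENNReal.toReal_ofReal ht]
  · intro hlt
    -- If every clock has started by time $t<\tau_\Omega$, the hitting times increase to some
    -- $\tau\le t$ with $X_\tau\in\Omega$. Quasi-left-continuity puts the hitting positions, for
    -- large $m$, in the interior of a compact $K\subseteq\Omega$ on which $\varphi_m=1$. But at its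
    -- hitting time of $\{\varphi_m\ne1\}$ the path cannot be in an open set disjoint from it.
    by_contra! hne
    have hle : ∀ m, X.hit (V m) ω ≤ t.toNNReal := fun m => hit_le_of_clock_ne_zero ht (hne m)
    have hsup : ⨆ m, X.hit (V m) ω ≤ t.toNNReal := iSup_le hle
    obtain ⟨τ, hτ, hτt⟩ := WithTop.le_coe_iff.mp hsup
    have hlim := hω (by rw [hτ]; exact WithTop.coe_ne_top)
    rw [hτ, WithTop.untopD_coe] at hlim
    obtain ⟨y, hyΩ, hy⟩ := mem_of_lt_exitTime (X := X) (Ω := Ω) (ω := ω) (t := τ)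
      (lt_of_le_of_lt (ENNReal.coe_le_coe.mpr hτt) hlt)
    obtain ⟨K, hKc, hyK, hKΩ⟩ := exists_compact_subset hΩo hyΩ
    obtain ⟨m₀, hm₀⟩ := hK K hKc hKΩ
    have hWo : IsOpen (((↑) : E → OnePoint E) '' interior K) :=
      OnePoint.isOpenEmbedding_coe.isOpenMap _ isOpen_interior
    have hev := hlim.eventually (hWo.mem_nhds ⟨y, hyK, hy⟩)
    obtain ⟨m, hm, hmm₀⟩ := (hev.and (eventually_ge_atTop m₀)).exists
    obtain ⟨s, hs', -⟩ := WithTop.le_coe_iff.mp (hle m)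
    rw [hs', WithTop.untopD_coe] at hm
    refine notMem_of_hit_eq (X := X) (V := V m) hWo ?_ hs' hm
    rw [Set.disjoint_right]
    rintro _ ⟨z, hz, rfl⟩ hzV
    refine hzV ?_
    rw [cemeteryExt_coe]
    exact le_antisymm (hI m z).2 (hm₀ z (interior_subset hz) ▸ hmono hmm₀ z)

end HuntProcess

/-! ### Identification with the resolvent of the part process -/

namespace HuntProcess

variable {E : Type*} [MetricSpace E] [LocallyCompactSpace E] [TopologicalSpace.SeparableSpace E]
  [MeasurableSpace E] [BorelSpace E]
  {S : Type*} [MeasurableSpace S] {X : HuntProcess E S}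

/-- The weight $e^{-\beta t}$ is strictly positive, so a set null for the resolvent kernel is
visited only on a $P_x\otimes dt$-null set. -/
theorem ae_pathMeasure_of_ae {β : ℝ} {x : E} {p : E → Prop}
    (hp : ∀ᵐ y ∂(X.resolventKernel β x), p y) :
    ∀ᵐ q ∂(X.pathMeasure x), ∀ y : E, X.pos q = y → p y := by
  set N := toMeasurable (X.resolventKernel β x) {y | ¬ p y}
  have hNm : MeasurableSet N := measurableSet_toMeasurable _ _
  have hN0 : X.resolventKernel β x N = 0 := (measure_toMeasurable _).trans hp
  have hi : Measurable (N.indicator (1 : E → ℝ≥0∞)) := measurable_one.indicator hNm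
  have hZ : Measurable fun q : S × ℝ => Real.exp (-β * q.2) := by fun_prop
  rw [← lintegral_indicator_one hNm, resolventKernel_apply, lintegral_occ hZ _ hi]
    at hN0
  filter_upwards [(lintegral_eq_zero_iff (hZ.ennreal_ofReal.mul
    ((measurable_cemeteryExt hi).comp X.measurable_pos))).mp hN0] with q hq y hy
  by_contra hpy
  have hyN : y ∈ N := subset_toMeasurable _ _ hpy
  simp [hy, hyN, (Real.exp_pos _).not_ge] at hq

theorem measurableSet_timeInterval (T : ℝ≥0∞) : MeasurableSet (timeInterval T) :=
  measurableSet_Ici.inter (measurableSet_lt ENNReal.measurable_ofReal measurable_const)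

theorem restrict_timeInterval (T : ℝ≥0∞) :
    (volume.restrict (Ici (0 : ℝ))).restrict (timeInterval T) =
      volume.restrict (timeInterval T) := by
  rw [Measure.restrict_restrict (measurableSet_timeInterval T),
    inter_eq_left.mpr fun t ht => ht.1]

/-- Two null sets of times are discarded: the single time $\tau_\Omega$, and the times at which
$X_t$ lies where $f$ differs from $\xi1_\Omega$. The second allows $\xi$ to be replaced by a Borel
representative. -/
theorem ae_discounted_eq {β : ℝ} {Ω : Set E} (hΩo : IsOpen Ω) {φ : ℕ → E → ℝ}
    (hφ : ∀ m, Continuous (φ m)) (hs : ∀ m, HasCompactSupport (φ m))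
    (hI : ∀ m x, φ m x ∈ Icc (0 : ℝ) 1) (hΩ : ∀ m, ∀ x ∉ Ω, φ m x = 0) (hmono : Monotone φ)
    (hK : ∀ K, IsCompact K → K ⊆ Ω → ∃ m, ∀ x ∈ K, φ m x = 1) {x : E} {f ξ : E → ℝ}
    (hf : ∀ᵐ y ∂(X.resolventKernel β x), f y = Ω.indicator ξ y) :
    ∀ᵐ ω ∂(X.P x), (fun t => X.limitWeight β φ (ω, t) * cemeteryExt f (X.pos (ω, t)))
      =ᵐ[volume.restrict (Ici 0)]
      (timeInterval (X.exitTime Ω ω)).indicator (X.discounted β ξ ω) := by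
  filter_upwards [ae_exists_clock_eq_zero_iff (X := X) hΩo hφ hs hI hΩ hmono hK x,
    Measure.ae_ae_of_ae_prod (ae_pathMeasure_of_ae (X := X) hf)] with ω h1 h2
  have h3 : ∀ᵐ t ∂(volume.restrict (Ici (0 : ℝ))), t ≠ (X.exitTime Ω ω).toReal :=
    ae_restrict_of_ae (Measure.ae_ne volume _)
  filter_upwards [h2, h3, ae_restrict_mem measurableSet_Ici] with t ht htne h0
  have key := h1 t h0 htne
  by_cases hlt : ENNReal.ofReal t < X.exitTime Ω ω
  · obtain ⟨y, hyΩ, hy⟩ := mem_of_lt_exitTime (X := X) hlt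
    rw [limitWeight, indicator_of_mem
      (show (ω, t) ∈ {p : S × ℝ | ∃ m, X.clock (φ m) p = 0} from key.mpr hlt),
      indicator_of_mem (show t ∈ timeInterval (X.exitTime Ω ω) from ⟨h0, hlt⟩), discounted_eq,
      ← show (y : OnePoint E) = X.pos (ω, t) from hy, cemeteryExt_coe, cemeteryExt_coe,
      ht y hy.symm, indicator_of_mem hyΩ]
  · rw [limitWeight, indicator_of_notMem
      (show (ω, t) ∉ {p : S × ℝ | ∃ m, X.clock (φ m) p = 0} from fun h => hlt (key.mp h)),
      indicator_of_notMem (show t ∉ timeInterval (X.exitTime Ω ω) from fun h => hlt h.2), zero_mul]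

/-- Fubini on $P_x\otimes dt$: the integrand is dominated by that of the full resolvent, so both
iterated integrals exist. -/
theorem partResolventExists_and_eq {β : ℝ} {Ω : Set E} (hΩo : IsOpen Ω) {φ : ℕ → E → ℝ}
    (hφ : ∀ m, Continuous (φ m)) (hs : ∀ m, HasCompactSupport (φ m))
    (hI : ∀ m x, φ m x ∈ Icc (0 : ℝ) 1) (hΩ : ∀ m, ∀ x ∉ Ω, φ m x = 0) (hmono : Monotone φ)
    (hK : ∀ K, IsCompact K → K ⊆ Ω → ∃ m, ∀ x ∈ K, φ m x = 1) {x : E} {f ξ : E → ℝ}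
    (hfm : Measurable f) (hfi : Integrable f (X.resolventKernel β x))
    (hf : ∀ᵐ y ∂(X.resolventKernel β x), f y = Ω.indicator ξ y) :
    X.PartResolventExists Ω β ξ x ∧
      ∫ y, f y ∂(X.occ (X.limitWeight β φ) (x : OnePoint E)) = X.partResolvent Ω β ξ x := by
  have hZ := measurable_limitWeight (X := X) hφ hs hI β
  have hZ0 := limitWeight_nonneg (X := X) β φ
  have hle : X.occ (X.limitWeight β φ) (x : OnePoint E) ≤ X.resolventKernel β x :=
    occ_mono hZ (by fun_prop) (fun p _ => limitWeight_le β φ p) _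
  have hF := (integrable_occ_iff hZ hZ0 _ hfm).mp (hfi.mono_measure hle)
  rw [pathMeasure] at hF
  have hae := ae_discounted_eq (X := X) (β := β) hΩo hφ hs hI hΩ hmono hK hf
  have hint : ∀ᵐ ω ∂(X.P x), ∫ t in Ici (0 : ℝ),
      X.limitWeight β φ (ω, t) * cemeteryExt f (X.pos (ω, t)) =
      ∫ t in timeInterval (X.exitTime Ω ω), X.discounted β ξ ω t := by
    filter_upwards [hae] with ω hω
    rw [integral_congr_ae hω, integral_indicator (measurableSet_timeInterval _),
      restrict_timeInterval]
  refine ⟨⟨?_, hF.integral_prod_left.congr hint⟩, ?_⟩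
  · filter_upwards [hae, hF.prod_right_ae] with ω hω hi
    rw [IntegrableOn, ← restrict_timeInterval]
    exact (integrable_indicator_iff (measurableSet_timeInterval _)).mp (hi.congr hω)
  · rw [integral_occ hZ hZ0 _ hfm, pathMeasure, integral_prod _ hF]
    exact integral_congr_ae hint

variable {μ : Measure E} {𝓔 : LowerBoundedSemiDirichletForm μ} {β : ℝ}

/-- The weak solution is the resolvent of the process killed on leaving `Ω`. -/
theorem IsGeneratedBy.ae_eq_partResolvent (hX : X.IsGeneratedBy 𝓔) (h𝓔 : 𝓔.IsRegular)
    (hβ : 𝓔.β₀ < β) {Ω : Set E} (hΩ : IsOpen Ω) {ξ : E → ℝ} {h : Lp ℝ 2 μ}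
    (hh : h =ᵐ[μ] Ω.indicator ξ) {u : 𝓔.dom} (hu : 𝓔.IsWeakSolution Ω β ξ u) :
    ∀ᵐ x ∂μ, X.PartResolventExists Ω β ξ x ∧ (u : Lp ℝ 2 μ) x = X.partResolvent Ω β ξ x := by
  obtain ⟨φ, hφ, hs, hI, hφΩ, hstep, hK⟩ := exists_exhausting_functions hΩ
  have hmono : Monotone φ := monotone_nat_of_le_succ fun m x => by
    by_cases h0 : φ m x = 0
    · rw [h0]; exact (hI _ x).1
    · rw [hstep m x h0]; exact (hI m x).2
  obtain ⟨z, hzΩ, hzg, hz⟩ := hX.isWeakSolution_limit h𝓔 hβ hφ hs hI hφΩ hmono hK h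
  have hzu : 𝓔.toDom z = u :=
    (LowerBoundedSemiDirichletForm.existsUnique_isWeakSolution hΩ.measurableSet hβ hh).unique
      ((LowerBoundedSemiDirichletForm.isWeakSolution_toDom_iff hΩ.measurableSet hh).mpr
        ⟨hzΩ, hzg⟩) hu
  obtain ⟨k, hk⟩ := hX.exists_lp_eq_integral_abs hβ h
  filter_upwards [hz, hk, hX.ae_ae hβ hh] with x h1 h2 h3
  have h4 := partResolventExists_and_eq hΩ hφ hs hI hφΩ hmono hK
    (Lp.stronglyMeasurable h).measurable h2.1 h3
  exact ⟨h4.1, by rw [← hzu, ← 𝓔.incl_apply, h1, h4.2]⟩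

end HuntProcess

theorem theorem2p1 {E : Type*} [MetricSpace E] [LocallyCompactSpace E]
    [TopologicalSpace.SeparableSpace E] [MeasurableSpace E] [BorelSpace E]
    (μ : Measure E) [SigmaFinite μ] [μ.IsOpenPosMeasure]
    (𝓔 : LowerBoundedSemiDirichletForm μ) (h𝓔 : 𝓔.IsRegular)
    (Ω : Set E) (hΩ : IsOpen Ω) (β : ℝ) (hβ : 𝓔.β₀ < β)
    (ξ : E → ℝ) (hξ : MemLp ξ 2 (μ.restrict Ω)) :
    (∃! u : 𝓔.dom, 𝓔.IsWeakSolution Ω β ξ u) ∧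
    ∀ u : 𝓔.dom, 𝓔.IsWeakSolution Ω β ξ u →
      (∀ (S : Type*) [MeasurableSpace S] (X : HuntProcess E S), X.IsGeneratedBy 𝓔 →
        ∀ᵐ x ∂μ, X.PartResolventExists Ω β ξ x ∧
          (u : Lp ℝ 2 μ) x = X.partResolvent Ω β ξ x) ∧
      extendedRecip (𝓔.pairing Ω ξ u) =
        ⨅ f ∈ 𝓔.constraintSet Ω ξ 1, ⨆ g ∈ 𝓔.constraintSet Ω ξ 0,
          ((𝓔.shifted β (f + g) (f - g) : ℝ) : EReal) ∧
      (𝓔.IsSymmetric →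
        extendedRecip (𝓔.pairing Ω ξ u) =
          ⨅ f ∈ 𝓔.constraintSet Ω ξ 1, ((𝓔.shifted β f f : ℝ) : EReal)) := by
  have hmem := (memLp_indicator_iff_restrict hΩ.measurableSet).mpr hξ
  have hh : hmem.toLp =ᵐ[μ] Ω.indicator ξ := hmem.coeFn_toLp
  refine ⟨LowerBoundedSemiDirichletForm.existsUnique_isWeakSolution hΩ.measurableSet hβ hh,
    fun u hu => ⟨fun S _ X hX => hX.ae_eq_partResolvent h𝓔 hβ hΩ hh hu, ?_⟩⟩
  exact LowerBoundedSemiDirichletForm.extendedRecip_pairing_eq hΩ.measurableSet hβ hh hu
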